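/- Let $n\ge 3$ be odd and $m=(n-3)/2$. For $a,b\in\mathbf R$ and $d\ge 1$ let $$H_{(a,b)}(\mathbf R^d)=\{u\in\mathcal S'(\mathbf R^d):\ \langle x\rangle^a\langle D\rangle^b u\in L^2(\mathbf R^d)\},\qquad \|u\|_{(a,b)}=\|\langle x\rangle^a\langle D\rangle^b u\|_{L^2},$$ where $\langle x\rangle=(1+|x|^2)^{1/2}$, $D=-i\partial$, and $\langle D\rangle^b$ is the Fourier multiplier with symbol $\langle\xi\rangle^b$. For $t\in\mathbf R$ let $k_0(\cdot,t)\in\mathcal S'(\mathbf R^n)$ be the convolution kernel of the operator $\sin(t|D|)/|D|$, and for $f,g\in\mathcal S(\mathbf R^n)$ put $$A(f,g)(x,t)=\int_{\mathbf R^n} k_0(y,t)\,f(x-y)\,g(x+y)\,dy,\qquad (x,t)\in\mathbf R^n\times\mathbf R,$$ the integral being understood as the pairing of the distribution $k_0(\cdot,t)$ with the Schwartz function $y\mapsto f(x-y)g(x+y)$. Then $A$ maps $\mathcal S(\mathbf R^n)\times\mathcal S(\mathbf R^n)$ into $\mathcal S(\mathbf R^{n+1})$, and the following holds. (i) If $a',a'',a\in\mathbf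 R$ satisfy $0\le a<m+1+\min(a',a'')$ and $a\le a'+a''$, then $A$ extends to a continuous bilinear operator from $H_{(a',0)}(\mathbf R^n)\times H_{(a'',0)}(\mathbf R^n)$ to $H_{(a,-m)}(\mathbf R^{n+1})$. (ii) If $b',b'',b\in\mathbf R$ satisfy $b<m+1+\min(b',b'')$ and $b\le b'+b''$, then $A$ extends to a continuous bilinear operator from $H_{(0,b')}(\mathbf R^n)\times H_{(0,b'')}(\mathbf R^n)$ to $H_{(0,b-m)}(\mathbf R^{n+1})$. -/

import Mathlib

open MeasureTheory SchwartzMap FourierTransform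
open scoped ENNReal

set_option linter.unusedSectionVars false

noncomputable section

/-! ### The weighted Sobolev spaces `H_(a,b)` -/

section WeightedSobolev

variable (E : Type*) [NormedAddCommGroup E] [InnerProductSpace ℝ E] [FiniteDimensional ℝ E]
  [MeasurableSpace E] [BorelSpace E]

/-- The weight `⟨x⟩ ^ a = (1 + |x| ^ 2) ^ (a / 2)`. -/
def weight (a : ℝ) (x : E) : ℂ := ((1 + ‖x‖ ^ 2) ^ (a / 2) : ℝ)

/-- The symbol of `⟨D⟩ ^ b`, `D = -i ∂`. Mathlib's Fourier transform has the kernel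
`exp (-2 π i ⟨x, ξ⟩)`, so that `D` corresponds to multiplication by `2 π ξ`. -/
def bracketSymbol (b : ℝ) (ξ : E) : ℂ := weight E b ((2 * Real.pi) • ξ)

theorem weight_hasTemperateGrowth (a : ℝ) : (weight E a).HasTemperateGrowth :=
  Function.HasTemperateGrowth.comp Function.Complex.hasTemperateGrowth_ofReal
    (Function.hasTemperateGrowth_one_add_norm_sq_rpow E (a / 2))

theorem bracketSymbol_hasTemperateGrowth (b : ℝ) : (bracketSymbol E b).HasTemperateGrowth :=
  Function.HasTemperateGrowth.comp (weight_hasTemperateGrowth E b)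
    ((2 * Real.pi) • ContinuousLinearMap.id ℝ E).hasTemperateGrowth

theorem weight_neg_mul (a : ℝ) (x : E) : weight E (-a) x * weight E a x = 1 := by
  have h : (0 : ℝ) < 1 + ‖x‖ ^ 2 := by positivity
  rw [weight, weight, ← Complex.ofReal_mul, ← Real.rpow_add h]
  simp [neg_div]

/-- The operator `⟨x⟩ ^ a ⟨D⟩ ^ b` on tempered distributions. -/
def weightedBessel (a b : ℝ) : 𝓢'(E, ℂ) →L[ℂ] 𝓢'(E, ℂ) :=
  TemperedDistribution.smulLeftCLM ℂ (weight E a) ∘L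
    TemperedDistribution.fourierMultiplierCLM ℂ (bracketSymbol E b)

theorem weightedBessel_injective (a b : ℝ) : Function.Injective (weightedBessel E a b) := by
  have h1 : Function.LeftInverse (TemperedDistribution.smulLeftCLM ℂ (weight E (-a)))
      (TemperedDistribution.smulLeftCLM ℂ (weight E a)) := by
    intro u
    rw [TemperedDistribution.smulLeftCLM_smulLeftCLM_apply
      (weight_hasTemperateGrowth E _) (weight_hasTemperateGrowth E _)]
    have : weight E (-a) * weight E a = fun _ => 1 := funext (weight_neg_mul E a)
    rw [mul_comm, this, TemperedDistribution.smulLeftCLM_const, one_smul]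
  have h2 : Function.LeftInverse
      (TemperedDistribution.fourierMultiplierCLM ℂ (bracketSymbol E (-b)))
      (TemperedDistribution.fourierMultiplierCLM ℂ (bracketSymbol E b)) := by
    intro u
    rw [TemperedDistribution.fourierMultiplierCLM_fourierMultiplierCLM_apply
      (bracketSymbol_hasTemperateGrowth E _) (bracketSymbol_hasTemperateGrowth E _)]
    have : bracketSymbol E (-b) * bracketSymbol E b = fun _ => 1 :=
      funext fun ξ => weight_neg_mul E b _
    rw [mul_comm, this, TemperedDistribution.fourierMultiplierCLM_const]
    simp
  exact h1.injective.comp h2.injective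

/-- `H_(a,b)` as a subspace of the tempered distributions:
all `u` with `⟨x⟩ ^ a ⟨D⟩ ^ b u ∈ L²`. -/
def weightedSobolevSubmodule (a b : ℝ) : Submodule ℂ 𝓢'(E, ℂ) :=
  (LinearMap.range (Lp.toTemperedDistributionCLM ℂ (volume : Measure E) 2).toLinearMap).comap
    (weightedBessel E a b).toLinearMap

theorem mem_weightedSobolevSubmodule {a b : ℝ} {u : 𝓢'(E, ℂ)} :
    u ∈ weightedSobolevSubmodule E a b ↔
      ∃ v : Lp ℂ 2 (volume : Measure E), (v : 𝓢'(E, ℂ)) = weightedBessel E a b u :=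
  Iff.rfl

/-- The space `H_(a,b)`; it is normed below by `‖u‖ = ‖⟨x⟩ ^ a ⟨D⟩ ^ b u‖_{L²}`
(its topology is not the one inherited from the tempered distributions). -/
def WeightedSobolev (a b : ℝ) : Type _ := weightedSobolevSubmodule E a b

namespace WeightedSobolev

variable (a b : ℝ)

instance : AddCommGroup (WeightedSobolev E a b) :=
  inferInstanceAs (AddCommGroup (weightedSobolevSubmodule E a b))

instance : Module ℂ (WeightedSobolev E a b) :=
  inferInstanceAs (Module ℂ (weightedSobolevSubmodule E a b))

/-- The inclusion of `H_(a,b)` in the tempered distributions. -/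
def toDistribution : WeightedSobolev E a b →ₗ[ℂ] 𝓢'(E, ℂ) :=
  (weightedSobolevSubmodule E a b).subtype

theorem toDistribution_injective : Function.Injective (toDistribution E a b) :=
  Subtype.val_injective

theorem toTemperedDistribution_injective : Function.Injective
    (Lp.toTemperedDistributionCLM ℂ (volume : Measure E) 2) :=
  LinearMap.ker_eq_bot.1 (Lp.ker_toTemperedDistributionCLM_eq_bot (μ := (volume : Measure E)))

/-- The linear map `u ↦ ⟨x⟩ ^ a ⟨D⟩ ^ b u` from `H_(a,b)` to `L²`. -/
def toL2 : WeightedSobolev E a b →ₗ[ℂ] Lp ℂ 2 (volume : Measure E) :=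
  (LinearEquiv.ofInjective (Lp.toTemperedDistributionCLM ℂ (volume : Measure E) 2).toLinearMap
      (toTemperedDistribution_injective E)).symm.toLinearMap ∘ₗ
    ((weightedBessel E a b).toLinearMap ∘ₗ toDistribution E a b).codRestrict _
      (fun u : weightedSobolevSubmodule E a b => u.2)

theorem toL2_spec (u : WeightedSobolev E a b) :
    (toL2 E a b u : 𝓢'(E, ℂ)) = weightedBessel E a b (toDistribution E a b u) := by
  have h := LinearEquiv.ofInjective_symm_apply
    (f := (Lp.toTemperedDistributionCLM ℂ (volume : Measure E) 2).toLinearMap)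
    (h := toTemperedDistribution_injective E)
    (((weightedBessel E a b).toLinearMap ∘ₗ toDistribution E a b).codRestrict _
      (fun u : weightedSobolevSubmodule E a b => u.2) u)
  exact h

theorem toL2_injective : Function.Injective (toL2 E a b) := by
  intro u v h
  apply toDistribution_injective E a b
  apply weightedBessel_injective E a b
  rw [← toL2_spec, ← toL2_spec, h]

instance : NormedAddCommGroup (WeightedSobolev E a b) :=
  NormedAddCommGroup.induced _ _ (toL2 E a b) (toL2_injective E a b)

instance : NormedSpace ℂ (WeightedSobolev E a b) :=
  NormedSpace.induced ℂ _ _ (toL2 E a b)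

theorem norm_def (u : WeightedSobolev E a b) : ‖u‖ = ‖toL2 E a b u‖ := rfl

/-- A Schwartz function as an element of `H_(a,b)`. -/
def ofSchwartz (f : 𝓢(E, ℂ)) : WeightedSobolev E a b :=
  (⟨(f : 𝓢'(E, ℂ)), by
    refine (mem_weightedSobolevSubmodule E).2
      ⟨(SchwartzMap.smulLeftCLM ℂ (weight E a)
        (SchwartzMap.fourierMultiplierCLM ℂ (bracketSymbol E b) f)).toLp 2, ?_⟩
    rw [weightedBessel, ContinuousLinearMap.comp_apply,
      TemperedDistribution.fourierMultiplierCLM_toTemperedDistributionCLM_eq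
        (bracketSymbol_hasTemperateGrowth E b), Lp.toTemperedDistribution_toLp_eq]
    ext φ
    simp [weight_hasTemperateGrowth E a, mul_left_comm, mul_assoc]⟩ :
    weightedSobolevSubmodule E a b)

theorem toDistribution_ofSchwartz (f : 𝓢(E, ℂ)) :
    toDistribution E a b (ofSchwartz E a b f) = (f : 𝓢'(E, ℂ)) := rfl

end WeightedSobolev

end WeightedSobolev

/-! ### The bilinear operator `A` -/

section OperatorA

variable (E : Type*) [NormedAddCommGroup E] [InnerProductSpace ℝ E] [FiniteDimensional ℝ E]
  [MeasurableSpace E] [BorelSpace E]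

/-- The symbol of `sin (t|D|) / |D|` on the side of Mathlib's Fourier transform, i.e.
`sin (t r) / r` with `r = |2 π ξ|` (and `t` for `r = 0`). -/
def sineSymbol (t : ℝ) (ξ : E) : ℂ := (t * Real.sinc (t * (2 * Real.pi * ‖ξ‖)) : ℝ)

theorem sineSymbol_eq (t : ℝ) {ξ : E} (hξ : ξ ≠ 0) :
    sineSymbol E t ξ =
      (Real.sin (t * (2 * Real.pi * ‖ξ‖)) / (2 * Real.pi * ‖ξ‖) : ℝ) := by
  have hr : 2 * Real.pi * ‖ξ‖ ≠ 0 := by have := norm_pos_iff.2 hξ; positivity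
  rcases eq_or_ne t 0 with rfl | ht
  · simp [sineSymbol]
  · rw [sineSymbol, Real.sinc_of_ne_zero (mul_ne_zero ht hr)]
    congr 1
    field_simp

theorem memLp_sineSymbol (t : ℝ) : MemLp (sineSymbol E t) ∞ (volume : Measure E) := by
  refine memLp_top_of_bound (C := |t|) (Continuous.aestronglyMeasurable ?_)
    (Filter.Eventually.of_forall fun ξ => ?_)
  · exact Complex.continuous_ofReal.comp
      (continuous_const.mul (Real.continuous_sinc.comp (by fun_prop)))
  · rw [sineSymbol, Complex.norm_real, Real.norm_eq_abs, abs_mul]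
    exact mul_le_of_le_one_right (abs_nonneg t) (Real.abs_sinc_le_one _)

/-- The convolution kernel `k₀(·, t)` of the operator `sin (t|D|) / |D|`: the tempered
distribution which is the inverse Fourier transform of the symbol. -/
def sineKernel (t : ℝ) : 𝓢'(E, ℂ) :=
  𝓕⁻ ((memLp_sineSymbol E t).toLp (sineSymbol E t) : 𝓢'(E, ℂ))

variable {E}

/-- The Schwartz function `y ↦ f (x - y) * g (x + y)`. -/
def reflectedProduct (f g : 𝓢(E, ℂ)) (x : E) : 𝓢(E, ℂ) :=
  SchwartzMap.pairing (ContinuousLinearMap.mul ℂ ℂ)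
    (SchwartzMap.compCLMOfContinuousLinearEquiv ℂ (ContinuousLinearEquiv.neg ℝ)
      (f.compSubConstCLM ℂ (-x)))
    (g.compSubConstCLM ℂ (-x))

theorem reflectedProduct_apply (f g : 𝓢(E, ℂ)) (x y : E) :
    reflectedProduct f g x y = f (x - y) * g (x + y) := by
  simp [reflectedProduct, sub_eq_add_neg, add_comm]

/-- `A(f, g)(x, t) = ∫ k₀(y, t) f (x - y) g (x + y) dy`, the integral being the pairing of the
distribution `k₀(·, t)` with a Schwartz function, as a function on the Euclidean space `E × ℝ`. -/
def operatorA (f g : 𝓢(E, ℂ)) (z : WithLp 2 (E × ℝ)) : ℂ :=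
  sineKernel E z.snd (reflectedProduct f g z.fst)

variable (E)

/-- `A` maps pairs of Schwartz functions to Schwartz functions on `E × ℝ` and extends to a
continuous bilinear operator from `H_(a',b')(E) × H_(a'',b'')(E)` to `H_(a,b)(E × ℝ)`. -/
def OperatorAExtends (a' b' a'' b'' a b : ℝ) : Prop :=
  ∃ B : WeightedSobolev E a' b' →L[ℂ] WeightedSobolev E a'' b'' →L[ℂ]
      WeightedSobolev (WithLp 2 (E × ℝ)) a b,
    ∀ f g : 𝓢(E, ℂ), ∃ F : 𝓢(WithLp 2 (E × ℝ), ℂ), (∀ z, F z = operatorA f g z) ∧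
      B (WeightedSobolev.ofSchwartz E a' b' f) (WeightedSobolev.ofSchwartz E a'' b'' g) =
        WeightedSobolev.ofSchwartz (WithLp 2 (E × ℝ)) a b F

end OperatorA

end

/-!
Write `d = 2 m + 3` for the dimension and `Ψ(x, y) = f(x - y) g(x + y)` (`diagProduct`). By
Plancherel's formula in `y`, `A(f, g)(x, t)` is the integral of `sin (2 π t |ω|) / (2 π |ω|)`
against the Fourier transform of `Ψ(x, ·)` (`operatorA_eq_integral`). In polar coordinates
`ω = τ θ` with signed radii the Jacobian `|τ| ^ (d - 1)` is a polynomial because `d` is odd, and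
Fourier inversion gives (`operatorA_eq_fourierInv`)

  `A(f, g) = (4 π i)⁻¹ 𝓕⁻ (τ ^ (2 m + 1) ∫ 𝓕 Ψ(ξ, τ θ) dσ(θ))`.

The maps `(ξ, τ) ↦ (ξ, τ θ)` are linear isometries depending affinely on `θ`, so that averages of
Schwartz functions over them are Schwartz functions (`linMeanS`, `sphMeanS`); hence `A(f, g)` is
one.

Both estimates rest on a weighted Cauchy-Schwarz inequality on the spheres
(`exists_lintegral_sphere_mul_le`): if `b < m + 1 + min (b', b'')` and `b ≤ b' + b''`, the `L²`
norm of `|t| ^ (m + 1) ⟨(x, t)⟩ ^ b ∫ p(x - t θ) q(x + t θ) dσ(θ)` is bounded by the product of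
the norms of `⟨x⟩ ^ b' p` and `⟨x⟩ ^ b'' q`. Its kernel is controlled by the function
`(1 - ⟨e, θ⟩ ^ 2) ^ (-s)`, which is integrable over the sphere for `2 s < d - 1 = 2 m + 2`
(`exists_lintegral_sphere_proj_le`).

For weights on the Fourier side this is all: `𝓕 Ψ` is again a product in the variables
`(ξ - ω) / 2` and `(ξ + ω) / 2` (`fourier_diagProduct`), and
`|τ| ^ (4 m + 2) ⟨(ξ, τ)⟩ ^ (-2 m) ≤ |τ| ^ (2 m + 2)`.

For weights in space, `⟨D⟩ ^ (-m) A(f, g)` is a multiple of the function `waveMean m Ψ`. For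
integers `N`, the operator `waveMean m` is bounded in `L²` with the weight `⟨·⟩ ^ N`
(`bddOp_meanOp`). The proof is an induction on `N`: multiplication by a coordinate differentiates
the Fourier transform, and where too few factors `τ` are left to compensate the singularity of
polar coordinates, Hardy's inequality (`wEnergy_mulInnerPow_le`) recovers them. Real interpolation
(`BddOp.interpolate`) extends the bound to weights of any order `a ≥ 0`. Moreover `waveMean m Ψ`
depends, up to a constant, only on the average of `Ψ` over all rotations of `y`
(`waveMean_rotMeanS`), and the weighted norm of this average is one of the spherical means of `Ψ`
(`wEnergy_rotMeanS`), to which the weighted Cauchy-Schwarz inequality applies.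

Finally, Schwartz functions are dense in `H_(a,b)`, which is complete, so that the estimates
extend `A` by continuity (`operatorAExtends_of_le`).
-/

noncomputable section

open Metric

/-! ### Polar coordinates -/

section Polar

open scoped Pointwise

/-- The Cauchy-Schwarz inequality for Lebesgue integrals, in squared form. -/
theorem sq_lintegral_mul_le {α : Type*} [MeasurableSpace α] (μ : Measure α) {f g : α → ℝ≥0∞}
    (hf : AEMeasurable f μ) (hg : AEMeasurable g μ) :
    (∫⁻ a, f a * g a ∂μ) ^ 2 ≤ (∫⁻ a, f a ^ 2 ∂μ) * ∫⁻ a, g a ^ 2 ∂μ := by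
  have h := ENNReal.lintegral_mul_le_Lp_mul_Lq μ Real.HolderConjugate.two_two hf hg
  have h2 : ∀ x : ℝ≥0∞, (x ^ (1 / 2 : ℝ)) ^ 2 = x := fun x => by
    rw [← ENNReal.rpow_natCast, ← ENNReal.rpow_mul]; norm_num
  calc (∫⁻ a, f a * g a ∂μ) ^ 2
      ≤ ((∫⁻ a, f a ^ (2 : ℝ) ∂μ) ^ (1 / 2 : ℝ) * (∫⁻ a, g a ^ (2 : ℝ) ∂μ) ^ (1 / 2 : ℝ)) ^ 2 := by
        gcongr; exact h
    _ = _ := by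
        rw [mul_pow, h2, h2]
        simp

variable {E : Type*} [NormedAddCommGroup E] [InnerProductSpace ℝ E] [FiniteDimensional ℝ E]
  [MeasurableSpace E] [BorelSpace E]

/-- The surface measure of the unit sphere is invariant under linear isometries. -/
theorem measurePreserving_sphere (A : E ≃ₗᵢ[ℝ] E) :
    MeasurePreserving
      (fun θ : sphere (0 : E) 1 => (⟨A θ, by simp⟩ : sphere (0 : E) 1))
      (volume : Measure E).toSphere (volume : Measure E).toSphere := by
  have hm : Measurable fun θ : sphere (0 : E) 1 => (⟨A θ, by simp⟩ : sphere (0 : E) 1) :=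
    Measurable.subtype_mk (A.continuous.measurable.comp measurable_subtype_coe)
  refine ⟨hm, Measure.ext fun s hs => ?_⟩
  rw [Measure.map_apply hm hs, Measure.toSphere_apply' _ (hm hs), Measure.toSphere_apply' _ hs]
  congr 1
  have : Set.Ioo (0 : ℝ) 1 • (Subtype.val ''
      ((fun θ : sphere (0 : E) 1 => (⟨A θ, by simp⟩ : sphere (0 : E) 1)) ⁻¹' s)) =
      A ⁻¹' (Set.Ioo (0 : ℝ) 1 • (Subtype.val '' s)) := by
    ext y
    simp only [Set.mem_smul, Set.mem_image, Set.mem_preimage, Subtype.exists, exists_and_right,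
      exists_eq_right]
    constructor
    · rintro ⟨r, hr, _, ⟨hx, hs⟩, rfl⟩
      exact ⟨r, hr, A _, ⟨by simpa using hx, hs⟩, by simp⟩
    · rintro ⟨r, hr, x, ⟨hx, hs⟩, h⟩
      refine ⟨r, hr, A.symm x, ⟨by simpa using hx, by simpa using hs⟩, ?_⟩
      apply A.injective
      simpa using h
  rw [this]
  exact A.measurePreserving.measure_preimage_equiv (f := A.toMeasurableEquiv) _

/-- Polar coordinates on the half line of radii. -/
theorem lintegral_polar_Ioi {h : E → ℝ≥0∞} (hh : Measurable h) [Nontrivial E] :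
    ∫⁻ y, h y = ∫⁻ r in Set.Ioi (0 : ℝ), ENNReal.ofReal (r ^ (Module.finrank ℝ E - 1)) *
      ∫⁻ θ, h (r • (θ : E)) ∂(volume : Measure E).toSphere := by
  have hmp := (volume : Measure E).measurePreserving_homeomorphUnitSphereProd
  have hme := (Homeomorph.measurableEmbedding (homeomorphUnitSphereProd E))
  have hm2 : Measurable fun p : sphere (0 : E) 1 × Set.Ioi (0 : ℝ) => h ((p.2 : ℝ) • (p.1 : E)) :=
    hh.comp (by fun_prop)
  calc ∫⁻ y, h y = ∫⁻ y in ({0}ᶜ : Set E), h y := by rw [restrict_compl_singleton]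
    _ = ∫⁻ y : ({0}ᶜ : Set E), h y ∂(Measure.comap Subtype.val volume) :=
        (lintegral_subtype_comap (measurableSet_singleton _).compl _).symm
    _ = ∫⁻ y : ({0}ᶜ : Set E), (fun p : sphere (0 : E) 1 × Set.Ioi (0 : ℝ) =>
          h ((p.2 : ℝ) • (p.1 : E))) (homeomorphUnitSphereProd E y)
          ∂(Measure.comap Subtype.val volume) := by
        refine lintegral_congr fun y => ?_
        have := homeomorphUnitSphereProd_symm_apply_coe E (homeomorphUnitSphereProd E y)
        rw [Homeomorph.symm_apply_apply] at this
        simp only [← this]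
    _ = ∫⁻ p, h ((p.2 : ℝ) • (p.1 : E)) ∂((volume : Measure E).toSphere.prod
          (Measure.volumeIoiPow (Module.finrank ℝ E - 1))) :=
        hmp.lintegral_comp hm2
    _ = ∫⁻ r, ∫⁻ θ, h ((r : ℝ) • (θ : E)) ∂(volume : Measure E).toSphere
          ∂(Measure.volumeIoiPow (Module.finrank ℝ E - 1)) :=
        lintegral_prod_symm _ hm2.aemeasurable
    _ = ∫⁻ r : Set.Ioi (0 : ℝ), ENNReal.ofReal ((r : ℝ) ^ (Module.finrank ℝ E - 1)) *
          ∫⁻ θ, h ((r : ℝ) • (θ : E)) ∂(volume : Measure E).toSphere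
          ∂(Measure.comap Subtype.val volume) := by
        rw [Measure.volumeIoiPow, lintegral_withDensity_eq_lintegral_mul]
        · rfl
        · fun_prop
        · exact hm2.lintegral_prod_left'
    _ = _ := lintegral_subtype_comap measurableSet_Ioi (fun r : ℝ =>
          ENNReal.ofReal (r ^ (Module.finrank ℝ E - 1)) *
            ∫⁻ θ, h (r • (θ : E)) ∂(volume : Measure E).toSphere)

theorem lintegral_sphere_neg (h : E → ℝ≥0∞) :
    ∫⁻ θ, h (-(θ : E)) ∂(volume : Measure E).toSphere =
      ∫⁻ θ, h (θ : E) ∂(volume : Measure E).toSphere := by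
  have hmp := measurePreserving_sphere (LinearIsometryEquiv.neg ℝ (E := E))
  have hme : MeasurableEmbedding (fun θ : sphere (0 : E) 1 =>
      (⟨LinearIsometryEquiv.neg ℝ (θ : E), by simp⟩ : sphere (0 : E) 1)) := by
    refine MeasurableEquiv.measurableEmbedding
      ⟨⟨_, fun θ => ⟨LinearIsometryEquiv.neg ℝ (θ : E), by simp⟩, fun θ => ?_, fun θ => ?_⟩, ?_, ?_⟩
    · ext; simp
    · ext; simp
    · exact hmp.measurable
    · exact hmp.measurable
  have := hmp.lintegral_comp_emb hme (fun θ => h θ)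
  simpa using this

/-- Polar coordinates with signed radii, which cover the space twice. -/
theorem lintegral_polar {h : E → ℝ≥0∞} (hh : Measurable h) [Nontrivial E] :
    ∫⁻ r : ℝ, ENNReal.ofReal (|r| ^ (Module.finrank ℝ E - 1)) *
      ∫⁻ θ, h (r • (θ : E)) ∂(volume : Measure E).toSphere = 2 * ∫⁻ y, h y := by
  set G : ℝ → ℝ≥0∞ := fun r => ENNReal.ofReal (|r| ^ (Module.finrank ℝ E - 1)) *
      ∫⁻ θ, h (r • (θ : E)) ∂(volume : Measure E).toSphere with hG
  have hpos : ∫⁻ r in Set.Ioi 0, G r = ∫⁻ y, h y := by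
    rw [lintegral_polar_Ioi hh]
    refine setLIntegral_congr_fun measurableSet_Ioi fun r hr => ?_
    simp only [hG, abs_of_pos (Set.mem_Ioi.1 hr)]
  have heven : ∀ r, G (-r) = G r := fun r => by
    simp only [hG, abs_neg]
    congr 1
    rw [← lintegral_sphere_neg (fun y => h (r • y))]
    simp
  have hneg : ∫⁻ r in Set.Iio 0, G r = ∫⁻ r in Set.Ioi 0, G r := by
    have := (Measure.measurePreserving_neg (volume : Measure ℝ)).setLIntegral_comp_emb
      (MeasurableEquiv.neg ℝ).measurableEmbedding G (Set.Iio 0)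
    simpa [heven] using this
  rw [← lintegral_add_compl G (measurableSet_Ioi (a := (0 : ℝ))), Set.compl_Ioi, hpos,
    setLIntegral_congr Iio_ae_eq_Iic.symm, hneg, hpos, two_mul]

variable (E) in
/-- The map `(x, t) ↦ (x, t θ)`. -/
def ray (θ : E) : WithLp 2 (E × ℝ) →L[ℝ] WithLp 2 (E × E) :=
  (WithLp.prodContinuousLinearEquiv 2 ℝ E E).symm.toContinuousLinearMap ∘L
    ((ContinuousLinearMap.fst ℝ E ℝ).prod ((ContinuousLinearMap.snd ℝ E ℝ).smulRight θ)) ∘L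
    (WithLp.prodContinuousLinearEquiv 2 ℝ E ℝ).toContinuousLinearMap

@[simp] theorem ray_fst (θ : E) (z : WithLp 2 (E × ℝ)) : (ray E θ z).fst = z.fst := rfl

@[simp] theorem ray_snd (θ : E) (z : WithLp 2 (E × ℝ)) : (ray E θ z).snd = z.snd • θ := rfl

theorem ray_eq (θ : E) (z : WithLp 2 (E × ℝ)) : ray E θ z = WithLp.toLp 2 (z.fst, z.snd • θ) := rfl

theorem norm_ray (θ : sphere (0 : E) 1) (z : WithLp 2 (E × ℝ)) : ‖ray E (θ : E) z‖ = ‖z‖ := by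
  rw [WithLp.prod_norm_eq_of_L2, WithLp.prod_norm_eq_of_L2]
  simp [norm_smul]

theorem continuous_ray : Continuous fun p : E × WithLp 2 (E × ℝ) => ray E p.1 p.2 := by
  simp only [ray_eq]
  fun_prop

theorem continuous_ray_sphere :
    Continuous fun p : sphere (0 : E) 1 × WithLp 2 (E × ℝ) => ray E (p.1 : E) p.2 :=
  continuous_ray.comp (f := fun p : sphere (0 : E) 1 × WithLp 2 (E × ℝ) => ((p.1 : E), p.2))
    ((continuous_subtype_val.comp continuous_fst).prodMk continuous_snd)

/-- The weight `|t| ^ (d - 1)` of polar coordinates, as a function of `(x, t)`. -/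
def polarWeight (z : WithLp 2 (E × ℝ)) : ℝ≥0∞ := ENNReal.ofReal (|z.snd| ^ (Module.finrank ℝ E - 1))

theorem measurable_polarWeight : Measurable (polarWeight : WithLp 2 (E × ℝ) → ℝ≥0∞) := by
  unfold polarWeight
  fun_prop

theorem lintegral_withLp {F G : Type*} [NormedAddCommGroup F] [InnerProductSpace ℝ F]
    [FiniteDimensional ℝ F] [MeasurableSpace F] [BorelSpace F]
    [NormedAddCommGroup G] [InnerProductSpace ℝ G] [FiniteDimensional ℝ G]
    [MeasurableSpace G] [BorelSpace G] {h : WithLp 2 (F × G) → ℝ≥0∞} (hh : Measurable h) :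
    ∫⁻ z, h z = ∫⁻ x : F, ∫⁻ y : G, h (WithLp.toLp 2 (x, y)) := by
  rw [← (WithLp.volume_preserving_toLp F G).lintegral_comp hh, Measure.volume_eq_prod,
    lintegral_prod]
  exact (hh.comp (WithLp.volume_preserving_toLp F G).measurable).aemeasurable

/-- Polar coordinates in the second variable. -/
theorem lintegral_ray {h : WithLp 2 (E × E) → ℝ≥0∞} (hh : Measurable h) [Nontrivial E] :
    ∫⁻ z, polarWeight z * ∫⁻ θ, h (ray E (θ : E) z) ∂(volume : Measure E).toSphere =
      2 * ∫⁻ z, h z := by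
  have h1 : Measurable fun p : sphere (0 : E) 1 × WithLp 2 (E × ℝ) => h (ray E (p.1 : E) p.2) :=
    hh.comp continuous_ray_sphere.measurable
  have h2 : Measurable fun z => ∫⁻ θ : sphere (0 : E) 1, h (ray E (θ : E) z)
      ∂(volume : Measure E).toSphere := h1.lintegral_prod_left'
  have h3 : Measurable fun z => polarWeight z * ∫⁻ θ : sphere (0 : E) 1, h (ray E (θ : E) z)
      ∂(volume : Measure E).toSphere := measurable_polarWeight.mul h2
  rw [lintegral_withLp h3, lintegral_withLp hh,
    ← lintegral_const_mul]
  · refine lintegral_congr fun x => ?_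
    rw [← lintegral_polar (h := fun y => h (WithLp.toLp 2 (x, y))) (by fun_prop)]
    rfl
  · exact Measurable.lintegral_prod_right' (f := fun p : E × E => h (WithLp.toLp 2 p))
      (by fun_prop)

/-- The measure which polar coordinates transport to Lebesgue measure. -/
theorem map_ray [Nontrivial E] :
    Measure.map (fun p : sphere (0 : E) 1 × WithLp 2 (E × ℝ) => ray E (p.1 : E) p.2)
      ((volume : Measure E).toSphere.prod (volume.withDensity polarWeight)) =
      (2 : ℝ≥0∞) • (volume : Measure (WithLp 2 (E × E))) := by
  have hm : Measurable fun p : sphere (0 : E) 1 × WithLp 2 (E × ℝ) => ray E (p.1 : E) p.2 :=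
    continuous_ray_sphere.measurable
  refine Measure.ext fun s hs => ?_
  rw [Measure.map_apply hm hs, Measure.smul_apply, smul_eq_mul, ← lintegral_indicator_one hs,
    ← lintegral_ray (measurable_one.indicator hs), ← lintegral_indicator_one (hm hs),
    lintegral_prod_symm _ (measurable_one.indicator (hm hs)).aemeasurable,
    lintegral_withDensity_eq_lintegral_mul _ measurable_polarWeight]
  · rfl
  · exact (measurable_one.indicator (hm hs)).lintegral_prod_left'

/-- Polar coordinates in the second variable, for the Bochner integral. -/
theorem integral_ray [Nontrivial E] {h : WithLp 2 (E × E) → ℂ} (hh : Integrable h) :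
    ∫ z : WithLp 2 (E × ℝ), (|z.snd| ^ (Module.finrank ℝ E - 1) : ℝ) •
      ∫ θ, h (ray E (θ : E) z) ∂(volume : Measure E).toSphere = 2 * ∫ z, h z := by
  have hm : Measurable fun p : sphere (0 : E) 1 × WithLp 2 (E × ℝ) => ray E (p.1 : E) p.2 :=
    continuous_ray_sphere.measurable
  have h2 : Integrable h ((2 : ℝ≥0∞) • (volume : Measure (WithLp 2 (E × E)))) :=
    hh.smul_measure (by simp)
  have h3 : ∫ z, h z ∂((2 : ℝ≥0∞) • (volume : Measure (WithLp 2 (E × E)))) = 2 * ∫ z, h z := by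
    rw [integral_smul_measure]; simp
  rw [← h3, ← map_ray]
  rw [← map_ray] at h2
  rw [integral_map hm.aemeasurable h2.1, integral_prod_symm]
  · have hd : (fun z : WithLp 2 (E × ℝ) => polarWeight z) =
        fun z => ((Real.toNNReal (|z.snd| ^ (Module.finrank ℝ E - 1)) : NNReal) : ℝ≥0∞) := rfl
    rw [show (volume : Measure (WithLp 2 (E × ℝ))).withDensity polarWeight =
      volume.withDensity fun z =>
        ((Real.toNNReal (|z.snd| ^ (Module.finrank ℝ E - 1)) : NNReal) : ℝ≥0∞) from rfl,
      integral_withDensity_eq_integral_smul (by fun_prop)]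
    refine integral_congr_ae (Filter.Eventually.of_forall fun z => ?_)
    simp only [NNReal.smul_def]
    rw [Real.coe_toNNReal _ (by positivity)]
  · exact h2.comp_measurable hm

end Polar

/-! ### A singular integral over the sphere -/

section SphereSingularity

theorem ENNReal.rpow_neg_le_rpow_neg {x y : ℝ≥0∞} (h : x ≤ y) {s : ℝ} (hs : 0 ≤ s) :
    y ^ (-s) ≤ x ^ (-s) := by
  rw [ENNReal.rpow_neg, ENNReal.rpow_neg, ENNReal.inv_le_inv]
  exact ENNReal.rpow_le_rpow h hs

theorem lintegral_fin_prod {n : ℕ} {g : Fin n → ℝ → ℝ≥0∞} (hg : ∀ i, Measurable (g i)) :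
    ∫⁻ y : Fin n → ℝ, ∏ i, g i (y i) = ∏ i, ∫⁻ r, g i r := by
  induction n with
  | zero => simp [volume_pi]
  | succ n ih =>
    have hmp := (volume_preserving_piFinSuccAbove (fun _ : Fin (n + 1) => ℝ) 0).symm
    have hm : Measurable fun y : Fin (n + 1) → ℝ => ∏ i, g i (y i) :=
      Finset.measurable_fun_prod _ fun i _ => (hg i).comp (measurable_pi_apply i)
    rw [← hmp.lintegral_comp hm]
    simp only [Fin.prod_univ_succ, MeasurableEquiv.piFinSuccAbove_symm_apply,
      Fin.insertNthEquiv_zero, Fin.consEquiv_apply, Fin.cons_zero, Fin.cons_succ]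
    have hm' : Measurable fun y : Fin n → ℝ => ∏ i, g i.succ (y i) :=
      Finset.measurable_fun_prod _ fun i _ => (hg i.succ).comp (measurable_pi_apply i)
    rw [Measure.volume_eq_prod, lintegral_prod_mul (hg 0).aemeasurable hm'.aemeasurable,
      ih fun i => hg i.succ]

/-- `|r| ^ (-2 α)` is integrable near the origin of the line for `α < 1 / 2`. -/
theorem lintegral_rpow_neg_lt_top {α : ℝ} (hα : 2 * α < 1) :
    ∫⁻ r : ℝ, (Set.Icc (-1) 1).indicator (fun r => ENNReal.ofReal (r ^ 2) ^ (-α)) r < ∞ := by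
  rw [lintegral_indicator measurableSet_Icc]
  have hmeas : Measurable fun r : ℝ => ENNReal.ofReal (r ^ 2) ^ (-α) := by fun_prop
  have hpos : ∫⁻ r in Set.Ioc (0 : ℝ) 1, ENNReal.ofReal (r ^ 2) ^ (-α) < ∞ := by
    have h := (intervalIntegral.intervalIntegrable_rpow' (a := 0) (b := 1)
      (show -1 < -(2 * α) by linarith)).1
    refine lt_of_eq_of_lt ?_ h.2
    refine setLIntegral_congr_fun measurableSet_Ioc fun r hr => ?_
    rw [ENNReal.ofReal_rpow_of_pos (by have := hr.1; positivity),
      Real.enorm_eq_ofReal (Real.rpow_nonneg hr.1.le _), ← Real.rpow_natCast,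
      ← Real.rpow_mul hr.1.le]
    norm_num
  have hneg : ∫⁻ r in Set.Ico (-1 : ℝ) 0, ENNReal.ofReal (r ^ 2) ^ (-α) < ∞ := by
    have := (Measure.measurePreserving_neg (volume : Measure ℝ)).setLIntegral_comp_emb
      (MeasurableEquiv.neg ℝ).measurableEmbedding (fun r => ENNReal.ofReal (r ^ 2) ^ (-α))
      (Set.Ico (-1) 0)
    simp only [even_two.neg_pow, Set.image_neg_eq_neg, Set.neg_Ico, neg_zero, neg_neg] at this
    rw [this]
    exact hpos
  have hsub : Set.Icc (-1 : ℝ) 1 ⊆ Set.Ico (-1 : ℝ) 0 ∪ ({0} ∪ Set.Ioc 0 1) := by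
    intro r hr
    rcases lt_trichotomy r 0 with h | h | h
    · exact Or.inl ⟨hr.1, h⟩
    · exact Or.inr (Or.inl h)
    · exact Or.inr (Or.inr ⟨h, hr.2⟩)
  calc _ ≤ ∫⁻ r in Set.Ico (-1 : ℝ) 0 ∪ ({0} ∪ Set.Ioc 0 1), ENNReal.ofReal (r ^ 2) ^ (-α) :=
        lintegral_mono_set hsub
    _ ≤ _ := (lintegral_union_le _ _ _).trans (add_le_add_right (lintegral_union_le _ _ _) _)
    _ < ∞ := by simp [hpos, hneg]

variable {E : Type*} [NormedAddCommGroup E] [InnerProductSpace ℝ E] [FiniteDimensional ℝ E]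
  [MeasurableSpace E] [BorelSpace E]

/-- The singularity `|Π y| ^ (-2 s)`, where `Π` is the projection along a unit vector `e`, is
integrable over the unit ball, uniformly in `e`: `|Π y|` dominates each of the `d - 1` remaining
coordinates, so that the integrand is bounded by a product of functions of one variable. -/
theorem exists_lintegral_ball_proj_le {k : ℕ} (hk : Module.finrank ℝ E = k + 1) {s : ℝ}
    (hs0 : 0 ≤ s) (hs : 2 * s < k) :
    ∃ C : ℝ≥0∞, C < ∞ ∧ ∀ e : E, ‖e‖ = 1 →
      ∫⁻ y, (closedBall (0 : E) 1).indicator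
        (fun y => ENNReal.ofReal (‖y‖ ^ 2 - inner ℝ e y ^ 2) ^ (-s)) y ≤ C := by
  have hk0 : (0 : ℝ) < k := by linarith
  -- the exponent is shared evenly between the `k = d - 1` coordinates orthogonal to `e`
  set α : ℝ := s / k with hα
  have hα0 : 0 ≤ α := by positivity
  have hα1 : 2 * α < 1 := by rw [hα, ← mul_div_assoc, div_lt_one hk0]; exact hs
  set g : Fin (k + 1) → ℝ → ℝ≥0∞ := Fin.cons
    ((Set.Icc (-1) 1).indicator fun _ => 1)
    (fun _ => (Set.Icc (-1) 1).indicator (fun r => ENNReal.ofReal (r ^ 2) ^ (-α))) with hg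
  have hgm : ∀ i, Measurable (g i) := by
    intro i
    refine Fin.cases ?_ (fun j => ?_) i
    · exact measurable_const.indicator measurableSet_Icc
    · simp only [hg, Fin.cons_succ]
      exact Measurable.indicator (by fun_prop) measurableSet_Icc
  refine ⟨∏ i, ∫⁻ r, g i r, ?_, fun e he => ?_⟩
  · refine ENNReal.prod_lt_top fun i _ => ?_
    refine Fin.cases ?_ (fun j => ?_) i
    · simp only [hg, Fin.cons_zero]
      rw [lintegral_indicator measurableSet_Icc]
      simp
    · simp only [hg, Fin.cons_succ]
      exact lintegral_rpow_neg_lt_top hα1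
  · have hv : Orthonormal ℝ (({0} : Set (Fin (k + 1))).domRestrict (fun _ => e)) := by
      refine ⟨fun _ => he, fun i j hij => (hij (Subsingleton.elim _ _)).elim⟩
    obtain ⟨b, hb⟩ := hv.exists_orthonormalBasis_extension_of_card_eq (by simpa using hk)
    have hb0 : b 0 = e := hb 0 rfl
    rw [← lintegral_fin_prod hgm]
    have hmp := (PiLp.volume_preserving_ofLp (Fin (k + 1))).comp b.measurePreserving_repr
    have hm : Measurable fun y : Fin (k + 1) → ℝ => ∏ i, g i (y i) :=
      Finset.measurable_fun_prod _ fun i _ => (hgm i).comp (measurable_pi_apply i)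
    rw [← hmp.lintegral_comp hm]
    refine lintegral_mono fun y => ?_
    simp only [Function.comp_apply]
    by_cases hy : y ∈ closedBall (0 : E) 1
    · rw [Set.indicator_of_mem hy]
      have hn : ‖y‖ ^ 2 = ∑ i, b.repr y i ^ 2 := by
        rw [← b.repr.norm_map, EuclideanSpace.norm_sq_eq]
        simp
      have hy1 : ∑ i, b.repr y i ^ 2 ≤ 1 := by
        rw [← hn]; simpa using pow_le_one₀ (n := 2) (norm_nonneg y) (by simpa using hy)
      have hmem : ∀ i, b.repr y i ∈ Set.Icc (-1 : ℝ) 1 := fun i => by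
        rw [Set.mem_Icc, ← abs_le, ← sq_le_one_iff_abs_le_one]
        exact (Finset.single_le_sum (f := fun i => b.repr y i ^ 2)
          (fun _ _ => sq_nonneg _) (Finset.mem_univ i)).trans hy1
      have he' : inner ℝ e y = b.repr y 0 := by rw [b.repr_apply_apply, hb0]
      have hproj : ‖y‖ ^ 2 - inner ℝ e y ^ 2 = ∑ i : Fin k, b.repr y i.succ ^ 2 := by
        rw [hn, he', Fin.sum_univ_succ]; ring
      rw [Fin.prod_univ_succ]
      simp only [hg, Fin.cons_zero, Fin.cons_succ, Set.indicator_of_mem (hmem _), one_mul]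
      have hpow : ∀ x : ℝ≥0∞, x ^ (-s) = ∏ _i : Fin k, x ^ (-α) := fun x => by
        rw [Finset.prod_const, Finset.card_univ, Fintype.card_fin, ← ENNReal.rpow_natCast,
          ← ENNReal.rpow_mul]
        congr 1
        rw [hα]; field_simp
      rw [hpow]
      refine Finset.prod_le_prod' fun i _ => ?_
      refine ENNReal.rpow_neg_le_rpow_neg (ENNReal.ofReal_le_ofReal ?_) ‹_›
      rw [hproj]
      exact Finset.single_le_sum (f := fun i : Fin k => b.repr y i.succ ^ 2)
          (fun _ _ => sq_nonneg _) (Finset.mem_univ i)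
    · rw [Set.indicator_of_notMem hy]
      exact zero_le

/-- On the unit sphere of dimension `d - 1`, the function `(1 - ⟨e, θ⟩ ^ 2) ^ (-s)` is integrable
uniformly in the unit vector `e`, if `2 s < d - 1`: the integral over the unit ball of the
homogeneous extension is at least that over the radii in `[1 / 2, 1]`. -/
theorem exists_lintegral_sphere_proj_le {k : ℕ} (hk : Module.finrank ℝ E = k + 1) {s : ℝ}
    (hs0 : 0 ≤ s) (hs : 2 * s < k) :
    ∃ C : ℝ≥0∞, C < ∞ ∧ ∀ e : E, ‖e‖ = 1 →
      ∫⁻ θ, ENNReal.ofReal (1 - inner ℝ e (θ : E) ^ 2) ^ (-s) ∂(volume : Measure E).toSphere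
        ≤ C := by
  have : Nontrivial E := Module.nontrivial_of_finrank_pos (R := ℝ) (by omega)
  obtain ⟨C, hC, h⟩ := exists_lintegral_ball_proj_le hk hs0 hs
  set c : ℝ≥0∞ := ENNReal.ofReal ((1 / 2) ^ k) * volume (Set.Icc (1 / 2 : ℝ) 1) with hc
  have hc0 : c ≠ 0 := by
    rw [hc, Real.volume_Icc]
    refine mul_ne_zero ?_ ?_ <;> rw [Ne, ENNReal.ofReal_eq_zero, not_le]
    · positivity
    · norm_num
  have hct : c ≠ ∞ := by
    rw [hc, Real.volume_Icc]; finiteness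
  refine ⟨2 * C / c, ENNReal.div_lt_top (by finiteness) hc0, fun e he => ?_⟩
  rw [ENNReal.le_div_iff_mul_le (Or.inl hc0) (Or.inl hct)]
  set I := ∫⁻ θ, ENNReal.ofReal (1 - inner ℝ e (θ : E) ^ 2) ^ (-s) ∂(volume : Measure E).toSphere
  refine le_trans ?_ (mul_le_mul_right (h e he) 2)
  rw [← lintegral_polar, hk, Nat.add_sub_cancel]
  · calc I * c = ∫⁻ r in Set.Icc (1 / 2 : ℝ) 1, ENNReal.ofReal ((1 / 2) ^ k) * I := by
          rw [setLIntegral_const, hc]; ring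
      _ ≤ ∫⁻ r in Set.Icc (1 / 2 : ℝ) 1, ENNReal.ofReal (|r| ^ k) *
            ∫⁻ θ, (closedBall (0 : E) 1).indicator
              (fun y => ENNReal.ofReal (‖y‖ ^ 2 - inner ℝ e y ^ 2) ^ (-s)) (r • (θ : E))
              ∂(volume : Measure E).toSphere := by
          refine setLIntegral_mono' measurableSet_Icc fun r hr => ?_
          have hr0 : (0 : ℝ) < r := by have := hr.1; linarith
          refine mul_le_mul' (ENNReal.ofReal_le_ofReal (pow_le_pow_left₀ (by norm_num)
            (hr.1.trans (le_abs_self r)) k)) (lintegral_mono fun θ => ?_)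
          have hθ : ‖(θ : E)‖ = 1 := by simp
          rw [Set.indicator_of_mem (by
              rw [mem_closedBall_zero_iff, norm_smul, hθ, mul_one, Real.norm_eq_abs,
                abs_of_pos hr0]
              exact hr.2)]
          refine ENNReal.rpow_neg_le_rpow_neg (ENNReal.ofReal_le_ofReal ?_) ‹_›
          have h1 : inner ℝ e (θ : E) ^ 2 ≤ 1 := by
            have := abs_real_inner_le_norm e (θ : E)
            rw [he, hθ, mul_one] at this
            rwa [sq_le_one_iff_abs_le_one]
          rw [norm_smul, hθ, inner_smul_right, mul_one, Real.norm_eq_abs, sq_abs, mul_pow]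
          have h2 : r ^ 2 ≤ 1 := pow_le_one₀ hr0.le hr.2
          nlinarith
      _ ≤ _ := setLIntegral_le_lintegral _ _
  · refine Measurable.indicator ?_ isClosed_closedBall.measurableSet
    fun_prop

end SphereSingularity

/-! ### The weighted Cauchy-Schwarz estimate for spherical means of products -/

section Bracket

variable {X : Type*} [NormedAddCommGroup X]

/-- The square `⟨x⟩ ^ (2 a) = (1 + |x| ^ 2) ^ a` of the weight, with values in `[0, ∞]`. -/
def bracketSq (a : ℝ) (x : X) : ℝ≥0∞ := ENNReal.ofReal ((1 + ‖x‖ ^ 2) ^ a)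

theorem measurable_bracketSq [MeasurableSpace X] [OpensMeasurableSpace X] (a : ℝ) :
    Measurable (bracketSq a : X → ℝ≥0∞) := by
  unfold bracketSq; fun_prop

@[simp] theorem bracketSq_zero (x : X) : bracketSq 0 x = 1 := by simp [bracketSq]

theorem bracketSq_ne_top (a : ℝ) (x : X) : bracketSq a x ≠ ∞ := ENNReal.ofReal_ne_top

theorem bracketSq_add (a b : ℝ) (x : X) :
    bracketSq (a + b) x = bracketSq a x * bracketSq b x := by
  have : (0 : ℝ) < 1 + ‖x‖ ^ 2 := by positivity
  rw [bracketSq, bracketSq, bracketSq, Real.rpow_add this, ENNReal.ofReal_mul (by positivity)]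

theorem bracketSq_mul_neg (a : ℝ) (x : X) : bracketSq a x * bracketSq (-a) x = 1 := by
  rw [← bracketSq_add, add_neg_cancel, bracketSq_zero]

theorem bracketSq_mono {a b : ℝ} (h : a ≤ b) (x : X) : bracketSq a x ≤ bracketSq b x :=
  ENNReal.ofReal_le_ofReal (Real.rpow_le_rpow_of_exponent_le (by nlinarith [sq_nonneg ‖x‖]) h)

theorem bracketSq_one (x : X) : bracketSq 1 x = 1 + ‖x‖ₑ ^ 2 := by
  rw [bracketSq, Real.rpow_one, ENNReal.ofReal_add (by norm_num) (by positivity),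
    ENNReal.ofReal_pow (norm_nonneg x), ofReal_norm, ENNReal.ofReal_one]

end Bracket

/-- If `A ≤ B` and `A + B = 2 Z`, then `B` is comparable with `Z`, and the weights in `Z` and `B`
can be absorbed, leaving a nonnegative power of `Z / A`. -/
theorem rpow_weight_le {A B Z b b' b'' : ℝ} (hA : 1 ≤ A) (hB : A ≤ B) (hZ : A + B = 2 * Z)
    (hb : b ≤ b' + b'') :
    Z ^ b * (A ^ (-b') * B ^ (-b'')) ≤ 2 ^ |b''| * (Z / A) ^ max (b - b'') 0 := by
  have hZA : A ≤ Z := by linarith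
  have hZB : Z ≤ B := by linarith
  have hB2 : B ≤ 2 * Z := by linarith
  have hZ1 : 1 ≤ Z := hA.trans hZA
  have h1 : B ^ (-b'') ≤ 2 ^ |b''| * Z ^ (-b'') := by
    rcases le_total 0 b'' with h | h
    · calc B ^ (-b'') ≤ Z ^ (-b'') := Real.rpow_le_rpow_of_nonpos (by linarith) hZB (by linarith)
        _ ≤ _ := le_mul_of_one_le_left (by positivity)
          (Real.one_le_rpow (by norm_num) (abs_nonneg _))
    · rw [abs_of_nonpos h, ← Real.mul_rpow (by norm_num) (by linarith)]
      exact Real.rpow_le_rpow (by linarith) hB2 (by linarith)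
  have h2 : Z ^ (b - b'') * A ^ (-b') ≤ (Z / A) ^ max (b - b'') 0 := by
    rcases le_total 0 (b - b'') with h | h
    · rw [max_eq_left h, Real.div_rpow (by linarith) (by linarith), div_eq_mul_inv,
        ← Real.rpow_neg (by linarith)]
      gcongr
      linarith
    · rw [max_eq_right h, Real.rpow_zero]
      calc Z ^ (b - b'') * A ^ (-b') ≤ A ^ (b - b'') * A ^ (-b') := by
            refine mul_le_mul_of_nonneg_right
              (Real.rpow_le_rpow_of_nonpos (by linarith) hZA h) (by positivity)
        _ = A ^ (b - b'' - b') := by rw [← Real.rpow_add (by linarith), sub_eq_add_neg _ b']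
        _ ≤ 1 := Real.rpow_le_one_of_one_le_of_nonpos hA (by linarith)
  calc Z ^ b * (A ^ (-b') * B ^ (-b''))
      ≤ Z ^ b * (A ^ (-b') * (2 ^ |b''| * Z ^ (-b''))) := by
        have : 0 ≤ A := by linarith
        have : 0 ≤ Z := by linarith
        gcongr
    _ = 2 ^ |b''| * (Z ^ (b - b'') * A ^ (-b')) := by
        rw [sub_eq_add_neg, Real.rpow_add (by linarith)]; ring
    _ ≤ _ := by gcongr

section WeightedMean

variable {E : Type*} [NormedAddCommGroup E] [InnerProductSpace ℝ E] [FiniteDimensional ℝ E]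
  [MeasurableSpace E] [BorelSpace E]

/-- The distance from `x = α e` to `t θ` controls `|(x, t)| |Π θ|`, where `Π` is the projection
along `e`. -/
theorem one_add_mul_proj_le (e θ : E) (he : ‖e‖ = 1) (hθ : ‖θ‖ = 1) (α t : ℝ) :
    (1 + (α ^ 2 + t ^ 2)) * (1 - inner ℝ e θ ^ 2) ≤ 2 * (1 + ‖α • e - t • θ‖ ^ 2) := by
  rw [norm_sub_sq_real, norm_smul, norm_smul, he, hθ, inner_smul_left, inner_smul_right]
  simp only [mul_one, Real.norm_eq_abs, sq_abs, conj_trivial]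
  set p := inner ℝ e θ
  nlinarith [sq_nonneg (α - t * p), sq_nonneg (t - α * p), sq_nonneg p]

/-- Passage from `Z p ≤ 2 A` to the powers; for `p ≤ 0` the right-hand side is infinite if `s > 0`.
-/
theorem ofReal_rpow_div_le {Z A p s : ℝ} (hA : 1 ≤ A) (hZ : 0 ≤ Z) (hs : 0 ≤ s)
    (h : Z * p ≤ 2 * A) :
    ENNReal.ofReal ((Z / A) ^ s) ≤ 2 ^ s * ENNReal.ofReal p ^ (-s) := by
  rw [← ENNReal.ofReal_rpow_of_nonneg (by positivity) hs, ENNReal.rpow_neg, ← ENNReal.inv_rpow,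
    ← ENNReal.mul_rpow_of_nonneg _ _ hs]
  refine ENNReal.rpow_le_rpow ?_ hs
  rcases le_or_gt p 0 with hp | hp
  · rw [ENNReal.ofReal_of_nonpos hp]; simp
  · rw [← div_eq_mul_inv, ← ENNReal.ofReal_ofNat, ← ENNReal.ofReal_div_of_pos hp]
    refine ENNReal.ofReal_le_ofReal ?_
    rw [div_le_div_iff₀ (by linarith) hp]
    exact h

/-- The kernel bound behind the weighted Cauchy-Schwarz estimate, pointwise on the sphere. The two
terms on the right correspond to the two possibilities for the smaller of `|x - t θ|` and
`|x + t θ|`. -/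
theorem bracketSq_mul_le {b b' b'' : ℝ} (hb : b ≤ b' + b'') (e θ : E) (he : ‖e‖ = 1)
    (hθ : ‖θ‖ = 1) (z : WithLp 2 (E × ℝ)) (hz : ∃ α : ℝ, z.fst = α • e) :
    bracketSq b z * (bracketSq (-b') (z.fst - z.snd • θ) * bracketSq (-b'') (z.fst + z.snd • θ)) ≤
      2 ^ |b''| * (2 ^ max (b - b'') 0 *
          ENNReal.ofReal (1 - inner ℝ e θ ^ 2) ^ (-max (b - b'') 0)) +
      2 ^ |b'| * (2 ^ max (b - b') 0 *
          ENNReal.ofReal (1 - inner ℝ e θ ^ 2) ^ (-max (b - b') 0)) := by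
  obtain ⟨α, hα⟩ := hz
  set t := z.snd
  set A := 1 + ‖z.fst - t • θ‖ ^ 2 with hA
  set B := 1 + ‖z.fst + t • θ‖ ^ 2 with hB
  set Z := 1 + ‖z‖ ^ 2 with hZ
  have hZ' : Z = 1 + (α ^ 2 + t ^ 2) := by
    rw [hZ, WithLp.prod_norm_sq_eq_of_L2, hα, norm_smul, he]; simp [t]
  have hAB : A + B = 2 * Z := by
    have := parallelogram_law_with_norm ℝ z.fst (t • θ)
    rw [hA, hB, hZ, WithLp.prod_norm_sq_eq_of_L2]
    have h2 : ‖t • θ‖ = ‖z.snd‖ := by rw [norm_smul, hθ, mul_one]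
    rw [h2] at this
    nlinarith
  have hA1 : 1 ≤ A := by rw [hA]; nlinarith [sq_nonneg ‖z.fst - t • θ‖]
  have hB1 : 1 ≤ B := by rw [hB]; nlinarith [sq_nonneg ‖z.fst + t • θ‖]
  have hpA : Z * (1 - inner ℝ e θ ^ 2) ≤ 2 * A := by
    rw [hZ', hA, hα]; exact one_add_mul_proj_le e θ he hθ α t
  have hpB : Z * (1 - inner ℝ e θ ^ 2) ≤ 2 * B := by
    have := one_add_mul_proj_le e (-θ) he (by simpa using hθ) α t
    rw [hZ', hB, hα]; simpa using this
  have hlhs : bracketSq b z *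
      (bracketSq (-b') (z.fst - t • θ) * bracketSq (-b'') (z.fst + t • θ)) =
      ENNReal.ofReal (Z ^ b * (A ^ (-b') * B ^ (-b''))) := by
    rw [ENNReal.ofReal_mul (by positivity), ENNReal.ofReal_mul (by positivity)]; rfl
  have h2 : ∀ s : ℝ, ENNReal.ofReal (2 ^ s) = 2 ^ s := fun s => by
    rw [← ENNReal.ofReal_rpow_of_pos (by norm_num), ENNReal.ofReal_ofNat]
  rw [hlhs]
  rcases le_total A B with h | h
  · refine le_trans ?_ le_self_add
    refine (ENNReal.ofReal_le_ofReal (rpow_weight_le hA1 h hAB hb)).trans ?_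
    rw [ENNReal.ofReal_mul (by positivity), h2]
    gcongr
    exact ofReal_rpow_div_le hA1 (by positivity) (le_max_right _ _) hpA
  · refine le_trans ?_ le_add_self
    rw [mul_comm (A ^ _)]
    refine (ENNReal.ofReal_le_ofReal (rpow_weight_le hB1 h (by rw [add_comm]; exact hAB)
      (by rw [add_comm]; exact hb))).trans ?_
    rw [ENNReal.ofReal_mul (by positivity), h2]
    gcongr
    exact ofReal_rpow_div_le hB1 (by positivity) (le_max_right _ _) hpB

/-- The integral of the dual weights over the sphere is `O(⟨(x, t)⟩ ^ (-2 b))`. -/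
theorem exists_lintegral_bracketSq_le {k : ℕ} (hk : Module.finrank ℝ E = k + 1) {b b' b'' : ℝ}
    (hk0 : 0 < k) (hb1 : 2 * b < k + 2 * min b' b'') (hb : b ≤ b' + b'') :
    ∃ C : ℝ≥0∞, C < ∞ ∧ ∀ z : WithLp 2 (E × ℝ), bracketSq b z *
      ∫⁻ θ, bracketSq (-b') (z.fst - z.snd • (θ : E)) * bracketSq (-b'') (z.fst + z.snd • (θ : E))
        ∂(volume : Measure E).toSphere ≤ C := by
  have : Nontrivial E := Module.nontrivial_of_finrank_pos (R := ℝ) (by omega)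
  have hk0' : (0 : ℝ) < k := by exact_mod_cast hk0
  have hmin1 := min_le_left b' b''
  have hmin2 := min_le_right b' b''
  obtain ⟨C1, hC1, h1⟩ := exists_lintegral_sphere_proj_le (E := E) hk
    (le_max_right (b - b'') 0)
    (by rcases max_cases (b - b'') 0 with h | h <;> rw [h.1] <;> linarith)
  obtain ⟨C2, hC2, h2⟩ := exists_lintegral_sphere_proj_le (E := E) hk
    (le_max_right (b - b') 0) (by rcases max_cases (b - b') 0 with h | h <;> rw [h.1] <;> linarith)
  have h2t : ∀ s : ℝ, (2 : ℝ≥0∞) ^ s ≠ ∞ := fun s =>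
    ENNReal.rpow_ne_top_of_ne_zero (by norm_num) (by norm_num)
  refine ⟨2 ^ |b''| * (2 ^ max (b - b'') 0 * C1) + 2 ^ |b'| * (2 ^ max (b - b') 0 * C2), ?_,
    fun z => ?_⟩
  · exact ENNReal.add_lt_top.2 ⟨ENNReal.mul_lt_top (h2t _).lt_top
      (ENNReal.mul_lt_top (h2t _).lt_top hC1), ENNReal.mul_lt_top (h2t _).lt_top
      (ENNReal.mul_lt_top (h2t _).lt_top hC2)⟩
  -- `e` is the direction of `x`, and any unit vector if `x = 0`
  obtain ⟨e, he, hz⟩ : ∃ e : E, ‖e‖ = 1 ∧ ∃ α : ℝ, z.fst = α • e := by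
    rcases eq_or_ne z.fst 0 with h | h
    · obtain ⟨e, he⟩ := exists_norm_eq E zero_le_one
      exact ⟨e, he, 0, by simp [h]⟩
    · exact ⟨‖z.fst‖⁻¹ • z.fst, by
        rw [norm_smul, norm_inv, norm_norm, inv_mul_cancel₀ (norm_ne_zero_iff.2 h)], ‖z.fst‖, by
        rw [smul_smul, mul_inv_cancel₀ (norm_ne_zero_iff.2 h), one_smul]⟩
  have hm : ∀ s : ℝ, Measurable fun θ : sphere (0 : E) 1 =>
      ENNReal.ofReal (1 - inner ℝ e (θ : E) ^ 2) ^ (-s) := fun s => by fun_prop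
  rw [← lintegral_const_mul' _ _ (bracketSq_ne_top _ _)]
  refine (lintegral_mono fun θ : sphere (0 : E) 1 =>
    bracketSq_mul_le hb e θ he (by simp) z hz).trans ?_
  rw [lintegral_add_left (by fun_prop), lintegral_const_mul' _ _ (h2t _),
    lintegral_const_mul' _ _ (h2t _), lintegral_const_mul' _ _ (h2t _),
    lintegral_const_mul' _ _ (h2t _)]
  gcongr
  · exact h1 e he
  · exact h2 e he

theorem lintegral_comp_smul {h : E → ℝ≥0∞} (hh : Measurable h) {r : ℝ} (hr : r ≠ 0) :
    ∫⁻ y, h (r • y) = ENNReal.ofReal |(r ^ Module.finrank ℝ E)⁻¹| * ∫⁻ y, h y := by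
  rw [← lintegral_map hh (measurable_const_smul r), Measure.map_addHaar_smul _ hr,
    lintegral_smul_measure, smul_eq_mul]

/-- The map `(x, y) ↦ (x - y, x + y)` transports products to products. -/
theorem lintegral_sub_add {P Q : E → ℝ≥0∞} (hP : Measurable P) (hQ : Measurable Q) :
    ∫⁻ z : WithLp 2 (E × E), P (z.fst - z.snd) * Q (z.fst + z.snd) =
      ENNReal.ofReal |((2 : ℝ) ^ Module.finrank ℝ E)⁻¹| * ((∫⁻ x, P x) * ∫⁻ x, Q x) := by
  have h1 : ∀ y : E, ∫⁻ x : E, P (x - y) * Q (x + y) = ∫⁻ u : E, P u * Q (u + (2 : ℝ) • y) := by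
    intro y
    rw [← lintegral_sub_right_eq_self (fun u => P u * Q (u + (2 : ℝ) • y)) y]
    refine lintegral_congr fun x => ?_
    congr 2
    rw [two_smul]; abel
  have hm : Measurable fun z : WithLp 2 (E × E) => P (z.fst - z.snd) * Q (z.fst + z.snd) := by
    fun_prop
  rw [lintegral_withLp hm]
  rw [lintegral_lintegral_swap (by fun_prop)]
  refine (lintegral_congr h1).trans ?_
  rw [lintegral_lintegral_swap (by fun_prop)]
  have h2 : ∀ u : E, ∫⁻ y : E, P u * Q (u + (2 : ℝ) • y) =
      P u * (ENNReal.ofReal |((2 : ℝ) ^ Module.finrank ℝ E)⁻¹| * ∫⁻ x, Q x) := by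
    intro u
    rw [lintegral_const_mul _ (by fun_prop),
      lintegral_comp_smul (h := fun y => Q (u + y)) (by fun_prop) two_ne_zero,
      lintegral_add_left_eq_self Q u]
  simp only [h2]
  rw [lintegral_mul_const _ hP]
  ring

/-- The weighted Cauchy-Schwarz estimate for spherical means of products. The weights of `p` and
`q` are inserted before the Cauchy-Schwarz inequality is applied on each sphere; the integral of
the dual weights is bounded, and the rest is an integral over `(x, y) = (x, t θ)` in polar
coordinates, which is a product in the variables `x - y` and `x + y`. -/
theorem exists_lintegral_sphere_mul_le {k : ℕ} (hk : Module.finrank ℝ E = k + 1) {b b' b'' : ℝ}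
    (hk0 : 0 < k) (hb1 : 2 * b < k + 2 * min b' b'') (hb : b ≤ b' + b'') :
    ∃ C : ℝ≥0∞, C < ∞ ∧ ∀ p q : E → ℝ≥0∞, Measurable p → Measurable q →
      ∫⁻ z : WithLp 2 (E × ℝ), polarWeight z * (bracketSq b z *
        (∫⁻ θ, p (z.fst - z.snd • (θ : E)) * q (z.fst + z.snd • (θ : E))
          ∂(volume : Measure E).toSphere) ^ 2) ≤
        C * ((∫⁻ x, bracketSq b' x * p x ^ 2) * ∫⁻ x, bracketSq b'' x * q x ^ 2) := by
  have : Nontrivial E := Module.nontrivial_of_finrank_pos (R := ℝ) (by omega)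
  obtain ⟨K, hK, hKle⟩ := exists_lintegral_bracketSq_le hk hk0 hb1 hb
  refine ⟨K * (2 * ENNReal.ofReal |((2 : ℝ) ^ Module.finrank ℝ E)⁻¹|), by finiteness,
    fun p q hp hq => ?_⟩
  set P : E → ℝ≥0∞ := fun x => bracketSq b' x * p x ^ 2 with hP
  set Q : E → ℝ≥0∞ := fun x => bracketSq b'' x * q x ^ 2 with hQ
  have hbm : ∀ a : ℝ, Measurable (bracketSq a : E → ℝ≥0∞) := measurable_bracketSq
  have hPm : Measurable P := (hbm _).mul (hp.pow_const 2)
  have hQm : Measurable Q := (hbm _).mul (hq.pow_const 2)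
  have hsq : ∀ (a : ℝ) (x : E), bracketSq (a / 2) x ^ 2 = bracketSq a x := fun a x => by
    rw [sq, ← bracketSq_add]; congr 1; ring
  set H : WithLp 2 (E × E) → ℝ≥0∞ := fun z => P (z.fst - z.snd) * Q (z.fst + z.snd) with hH
  have hHm : Measurable H := by fun_prop
  have key : ∀ z : WithLp 2 (E × ℝ), bracketSq b z *
      (∫⁻ θ, p (z.fst - z.snd • (θ : E)) * q (z.fst + z.snd • (θ : E))
          ∂(volume : Measure E).toSphere) ^ 2 ≤
      K * ∫⁻ θ, H (ray E (θ : E) z) ∂(volume : Measure E).toSphere := by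
    intro z
    have e1 : ∀ θ : sphere (0 : E) 1,
        p (z.fst - z.snd • (θ : E)) * q (z.fst + z.snd • (θ : E)) =
        (bracketSq (b' / 2) (z.fst - z.snd • (θ : E)) * p (z.fst - z.snd • (θ : E)) *
          (bracketSq (b'' / 2) (z.fst + z.snd • (θ : E)) * q (z.fst + z.snd • (θ : E)))) *
        (bracketSq (-(b' / 2)) (z.fst - z.snd • (θ : E)) *
          bracketSq (-(b'' / 2)) (z.fst + z.snd • (θ : E))) := by
      intro θ
      have h1 := bracketSq_mul_neg (b' / 2) (z.fst - z.snd • (θ : E))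
      have h2 := bracketSq_mul_neg (b'' / 2) (z.fst + z.snd • (θ : E))
      calc _ = (bracketSq (b' / 2) (z.fst - z.snd • (θ : E)) *
            bracketSq (-(b' / 2)) (z.fst - z.snd • (θ : E))) * p (z.fst - z.snd • (θ : E)) *
            ((bracketSq (b'' / 2) (z.fst + z.snd • (θ : E)) *
            bracketSq (-(b'' / 2)) (z.fst + z.snd • (θ : E))) *
              q (z.fst + z.snd • (θ : E))) := by rw [h1, h2, one_mul, one_mul]
        _ = _ := by ring
    have e2 := sq_lintegral_mul_le (volume : Measure E).toSphere
      (f := fun θ => bracketSq (b' / 2) (z.fst - z.snd • (θ : E)) * p (z.fst - z.snd • (θ : E)) *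
          (bracketSq (b'' / 2) (z.fst + z.snd • (θ : E)) * q (z.fst + z.snd • (θ : E))))
      (g := fun θ => bracketSq (-(b' / 2)) (z.fst - z.snd • (θ : E)) *
          bracketSq (-(b'' / 2)) (z.fst + z.snd • (θ : E)))
      (Measurable.aemeasurable (by fun_prop)) (Measurable.aemeasurable (by fun_prop))
    rw [← lintegral_congr e1] at e2
    simp only [mul_pow, hsq, ← neg_div] at e2
    calc _ ≤ bracketSq b z * ((∫⁻ θ, H (ray E (θ : E) z) ∂(volume : Measure E).toSphere) *
          ∫⁻ θ, bracketSq (-b') (z.fst - z.snd • (θ : E)) *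
            bracketSq (-b'') (z.fst + z.snd • (θ : E)) ∂(volume : Measure E).toSphere) := by
          gcongr
          exact e2
      _ = (bracketSq b z * ∫⁻ θ, bracketSq (-b') (z.fst - z.snd • (θ : E)) *
            bracketSq (-b'') (z.fst + z.snd • (θ : E)) ∂(volume : Measure E).toSphere) *
            ∫⁻ θ, H (ray E (θ : E) z) ∂(volume : Measure E).toSphere := by ring
      _ ≤ _ := by gcongr; exact hKle z
  calc _ ≤ ∫⁻ z : WithLp 2 (E × ℝ), K * (polarWeight z *
        ∫⁻ θ, H (ray E (θ : E) z) ∂(volume : Measure E).toSphere) := by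
        refine lintegral_mono fun z => ?_
        rw [mul_left_comm K]
        exact mul_le_mul_right (key z) _
    _ = K * (2 * ∫⁻ z, H z) := by
        rw [lintegral_const_mul' _ _ hK.ne, lintegral_ray hHm]
    _ = _ := by rw [lintegral_sub_add hPm hQm]; ring

end WeightedMean

/-! ### Averages of Schwartz functions over families of linear maps -/

section LinearMean

/-- Smoothness of order `n` and rapid decay of the `n`-th derivative. -/
def SchwartzOfOrder {V G : Type} [NormedAddCommGroup V] [NormedSpace ℝ V] [NormedAddCommGroup G]
    [NormedSpace ℝ G] (n : ℕ) (f : V → G) : Prop :=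
  ContDiff ℝ n f ∧ ∀ k : ℕ, ∃ C : ℝ, ∀ z, ‖z‖ ^ k * ‖iteratedFDeriv ℝ n f z‖ ≤ C

theorem SchwartzOfOrder.add {V G : Type} [NormedAddCommGroup V] [NormedSpace ℝ V]
    [NormedAddCommGroup G] [NormedSpace ℝ G] {n : ℕ} {f g : V → G} (hf : SchwartzOfOrder n f)
    (hg : SchwartzOfOrder n g) : SchwartzOfOrder n (fun z => f z + g z) := by
  refine ⟨hf.1.add hg.1, fun k => ?_⟩
  obtain ⟨C, hC⟩ := hf.2 k
  obtain ⟨D, hD⟩ := hg.2 k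
  refine ⟨C + D, fun z => ?_⟩
  have h : iteratedFDeriv ℝ n (fun z => f z + g z) z =
      iteratedFDeriv ℝ n f z + iteratedFDeriv ℝ n g z :=
    iteratedFDeriv_add_apply hf.1.contDiffAt hg.1.contDiffAt
  rw [h]
  calc _ ≤ ‖z‖ ^ k * (‖iteratedFDeriv ℝ n f z‖ + ‖iteratedFDeriv ℝ n g z‖) := by
        gcongr; exact norm_add_le _ _
    _ ≤ _ := by rw [mul_add]; exact add_le_add (hC z) (hD z)

theorem SchwartzOfOrder.sum {V G ι : Type} [NormedAddCommGroup V] [NormedSpace ℝ V]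
    [NormedAddCommGroup G] [NormedSpace ℝ G] {n : ℕ} (s : Finset ι) {f : ι → V → G}
    (hf : ∀ i, SchwartzOfOrder n (f i)) : SchwartzOfOrder n (fun z => ∑ i ∈ s, f i z) := by
  classical
  induction s using Finset.induction_on with
  | empty =>
    simp only [Finset.sum_empty]
    refine ⟨contDiff_const, fun k => ⟨0, fun z => ?_⟩⟩
    rw [iteratedFDeriv_fun_zero]; simp
  | insert i s hi ih =>
    simp only [Finset.sum_insert hi]
    exact (hf i).add ih

variable {S : Type} [TopologicalSpace S] [CompactSpace S] [MeasurableSpace S] [BorelSpace S]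
  (μ : Measure S) [IsFiniteMeasure μ]
  {V W : Type} [NormedAddCommGroup V] [NormedSpace ℝ V] [NormedAddCommGroup W] [NormedSpace ℝ W]
  {G : Type} [NormedAddCommGroup G] [NormedSpace ℝ G]

/-- The average `z ↦ ∫ c(θ) Φ(R_θ z) dμ(θ)` of the pull-backs of `Φ` by linear maps `R_θ`. -/
def linMean (R : S → V →L[ℝ] W) (c : C(S, ℝ)) (Φ : W → G) (z : V) : G :=
  ∫ θ, c θ • Φ (R θ z) ∂μ

theorem Continuous.integrable_of_compactSpace {F : Type} [NormedAddCommGroup F] {f : S → F}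
    (hf : Continuous f) : Integrable f μ :=
  hf.integrable_of_hasCompactSupport (HasCompactSupport.of_compactSpace f)

variable {ι : Type} [Fintype ι] {R : S → V →L[ℝ] W} {L₀ : V →L[ℝ] W} {L : ι → V →L[ℝ] W}
  {γ : ι → C(S, ℝ)}

theorem continuous_of_eq_sum (hR : ∀ θ, R θ = L₀ + ∑ l, γ l θ • L l) (z : V) :
    Continuous fun θ => R θ z := by
  simp only [hR, _root_.add_apply, _root_.sum_apply, _root_.smul_apply]
  fun_prop

variable [CompleteSpace G]

/-- The derivative of an average over linear maps depending linearly on parameters `γ_l` is a sum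
of such averages, with modified weights. -/
theorem hasFDerivAt_linMean (hR : ∀ θ, R θ = L₀ + ∑ l, γ l θ • L l)
    (hn : ∀ θ z, ‖R θ z‖ = ‖z‖) (c : C(S, ℝ)) (Φ : 𝓢(W, G)) (z : V) :
    HasFDerivAt (linMean μ R c Φ)
      (linMean μ R c (fun w => (fderiv ℝ Φ w) ∘L L₀) z +
        ∑ l, linMean μ R (c * γ l) (fun w => (fderiv ℝ Φ w) ∘L L l) z) z := by
  have hRc := continuous_of_eq_sum hR
  have hR' : Continuous R := by
    rw [funext hR]
    exact continuous_const.add (continuous_finsetSum _ fun l _ =>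
      (γ l).continuous.smul continuous_const)
  have hΦ' : Continuous (fderiv ℝ Φ) := (fderivCLM ℝ _ _ Φ).continuous
  have hcΦ : ∀ z, Continuous fun θ => fderiv ℝ Φ (R θ z) := fun z => hΦ'.comp (hRc z)
  have key : ∀ (w : V) (θ : S), c θ • (fderiv ℝ Φ (R θ w) ∘L R θ) =
      c θ • (fderiv ℝ Φ (R θ w) ∘L L₀) + ∑ l, (c * γ l) θ • (fderiv ℝ Φ (R θ w) ∘L L l) := by
    intro w θ
    generalize fderiv ℝ Φ (R θ w) = D
    rw [hR θ, ContinuousLinearMap.comp_add, smul_add, ContinuousLinearMap.comp_finsetSum,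
      Finset.smul_sum]
    congr 1
    refine Finset.sum_congr rfl fun l _ => ?_
    rw [ContinuousLinearMap.comp_smul, smul_smul]
    rfl
  have hcont : ∀ (T : V →L[ℝ] W) (c : C(S, ℝ)),
      Integrable (fun θ => c θ • (fderiv ℝ Φ (R θ z) ∘L T)) μ := fun T c =>
    Continuous.integrable_of_compactSpace μ
      (c.continuous.smul ((hcΦ z).clm_comp continuous_const))
  have hint : linMean μ R c (fun w => (fderiv ℝ Φ w) ∘L L₀) z +
        ∑ l, linMean μ R (c * γ l) (fun w => (fderiv ℝ Φ w) ∘L L l) z =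
      ∫ θ, c θ • (fderiv ℝ Φ (R θ z) ∘L R θ) ∂μ := by
    simp only [key]
    rw [integral_add (hcont _ c) (integrable_finsetSum _ fun l _ => hcont _ _),
      integral_finsetSum _ fun l _ => hcont _ _]
    rfl
  rw [hint]
  refine hasFDerivAt_integral_of_dominated_of_fderiv_le (s := Set.univ) (F' := fun w θ =>
      c θ • (fderiv ℝ Φ (R θ w) ∘L R θ))
    (bound := fun _ => ‖c‖ * (SchwartzMap.seminorm ℝ 0 1 Φ)) Filter.univ_mem ?_ ?_ ?_ ?_ ?_ ?_
  · exact Filter.Eventually.of_forall fun w => (Continuous.integrable_of_compactSpace μ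
      (c.continuous.smul (Φ.continuous.comp (hRc w)))).1
  · exact Continuous.integrable_of_compactSpace μ (c.continuous.smul (Φ.continuous.comp (hRc z)))
  · exact (Continuous.integrable_of_compactSpace μ
      (c.continuous.smul ((hcΦ z).clm_comp hR'))).1
  · refine Filter.Eventually.of_forall fun θ w _ => ?_
    rw [norm_smul]
    refine mul_le_mul (c.norm_coe_le_norm θ) ?_ (norm_nonneg _) (norm_nonneg _)
    refine (ContinuousLinearMap.opNorm_comp_le _ _).trans ?_
    have h1 := Φ.norm_iteratedFDeriv_le_seminorm ℝ 1 (R θ w)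
    rw [norm_iteratedFDeriv_one] at h1
    calc _ ≤ (SchwartzMap.seminorm ℝ 0 1 Φ) * 1 := by
          gcongr
          exact ContinuousLinearMap.opNorm_le_bound _ zero_le_one fun z => by rw [hn, one_mul]
      _ = _ := mul_one _
  · exact integrable_const _
  · refine Filter.Eventually.of_forall fun θ w _ => ?_
    exact ((Φ.hasFDerivAt (R θ w)).comp w (R θ).hasFDerivAt).const_smul (c θ)

/-- The induction on the order of the derivatives goes through all target spaces `G`, because the
derivative of `Φ` takes values in a space of linear maps. -/
theorem schwartzOfOrder_linMean (hR : ∀ θ, R θ = L₀ + ∑ l, γ l θ • L l)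
    (hn : ∀ θ z, ‖R θ z‖ = ‖z‖) (n : ℕ) :
    ∀ {G : Type} [NormedAddCommGroup G] [NormedSpace ℝ G]
    [CompleteSpace G] (c : C(S, ℝ)) (Φ : 𝓢(W, G)), SchwartzOfOrder n (linMean μ R c Φ) := by
  induction n with
  | zero =>
    intro G _ _ _ c Φ
    have hc : Continuous (linMean μ R c Φ) := continuous_iff_continuousAt.2 fun z =>
      (hasFDerivAt_linMean μ hR hn c Φ z).continuousAt
    refine ⟨by exact_mod_cast contDiff_zero.2 hc, fun k => ?_⟩
    refine ⟨‖c‖ * SchwartzMap.seminorm ℝ k 0 Φ * μ.real Set.univ, fun z => ?_⟩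
    rw [norm_iteratedFDeriv_zero, ← Real.norm_of_nonneg (pow_nonneg (norm_nonneg z) k),
      ← norm_smul, linMean, ← integral_smul]
    refine norm_integral_le_of_norm_le_const (Filter.Eventually.of_forall fun θ => ?_)
    rw [norm_smul, norm_smul, mul_left_comm, Real.norm_of_nonneg (pow_nonneg (norm_nonneg z) k)]
    refine mul_le_mul (c.norm_coe_le_norm θ) ?_ (by positivity) (norm_nonneg _)
    rw [← hn θ z]
    exact Φ.norm_pow_mul_le_seminorm ℝ k _
  | succ n ih =>
    intro G _ _ _ c Φ
    have hd : fderiv ℝ (linMean μ R c Φ) = fun z =>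
        linMean μ R c (fun w => (fderiv ℝ Φ w) ∘L L₀) z +
        ∑ l, linMean μ R (c * γ l) (fun w => (fderiv ℝ Φ w) ∘L L l) z :=
      funext fun z => (hasFDerivAt_linMean μ hR hn c Φ z).fderiv
    have hS : ∀ (T : V →L[ℝ] W) (c : C(S, ℝ)),
        SchwartzOfOrder n (linMean μ R c (fun w => (fderiv ℝ Φ w) ∘L T)) := fun T c =>
      ih c (((fderivCLM ℝ _ _ Φ)).postcompCLM ((ContinuousLinearMap.compL ℝ V W G).flip T))
    have h' : SchwartzOfOrder n (fderiv ℝ (linMean μ R c Φ)) := by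
      rw [hd]
      exact (hS _ c).add (SchwartzOfOrder.sum _ fun l => hS _ _)
    refine ⟨?_, fun k => ?_⟩
    · rw [Nat.cast_add, Nat.cast_one, contDiff_succ_iff_fderiv]
      exact ⟨fun z => (hasFDerivAt_linMean μ hR hn c Φ z).differentiableAt, by simp, h'.1⟩
    · obtain ⟨C, hC⟩ := h'.2 k
      exact ⟨C, fun z => by rw [← norm_iteratedFDeriv_fderiv]; exact hC z⟩

/-- The average of a Schwartz function over linear maps `R_θ`, as a Schwartz function. The maps are
isometric embeddings, which carries the decay over, and depend on `θ` through finitely many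
coefficients `γ_l`, so that derivatives of averages are again averages. -/
def linMeanS (hR : ∀ θ, R θ = L₀ + ∑ l, γ l θ • L l)
    (hn : ∀ θ z, ‖R θ z‖ = ‖z‖) (c : C(S, ℝ)) (Φ : 𝓢(W, ℂ)) : 𝓢(V, ℂ) where
  toFun := linMean μ R c Φ
  smooth' := contDiff_infty.2 fun n => (schwartzOfOrder_linMean μ hR hn n c Φ).1
  decay' k n := (schwartzOfOrder_linMean μ hR hn n c Φ).2 k

open scoped LineDeriv

theorem lineDerivOp_linMeanS (hR : ∀ θ, R θ = L₀ + ∑ l, γ l θ • L l)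
    (hn : ∀ θ z, ‖R θ z‖ = ‖z‖) (c : C(S, ℝ)) (Φ : 𝓢(W, ℂ)) (e : V) :
    ∂_{e} (linMeanS μ hR hn c Φ) = linMeanS μ hR hn c (∂_{L₀ e} Φ) +
      ∑ l, linMeanS μ hR hn (c * γ l) (∂_{L l e} Φ) := by
  ext z
  have hΦ' : Continuous (fderiv ℝ Φ) := (fderivCLM ℝ _ _ Φ).continuous
  have hev : ∀ (T : V →L[ℝ] W) (c : C(S, ℝ)),
      (linMean μ R c (fun w => (fderiv ℝ Φ w) ∘L T) z) e = linMeanS μ hR hn c (∂_{T e} Φ) z := by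
    intro T c
    rw [linMean, ContinuousLinearMap.integral_apply]
    · rfl
    · exact Continuous.integrable_of_compactSpace μ (c.continuous.smul
        ((hΦ'.comp (continuous_of_eq_sum hR z)).clm_comp continuous_const))
  rw [SchwartzMap.lineDerivOp_apply_eq_fderiv, _root_.add_apply, _root_.sum_apply]
  change fderiv ℝ (linMean μ R c Φ) z e = _
  rw [(hasFDerivAt_linMean μ hR hn c Φ z).fderiv, _root_.add_apply, _root_.sum_apply, hev]
  simp only [hev]

end LinearMean

/-! ### Spherical means of Schwartz functions -/

section SphericalMean

variable {E : Type} [NormedAddCommGroup E] [InnerProductSpace ℝ E] [FiniteDimensional ℝ E]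
  [MeasurableSpace E] [BorelSpace E]

instance : CompactSpace (sphere (0 : E) 1) := isCompact_iff_compactSpace.1 (isCompact_sphere _ _)

/-- A coordinate function on the unit sphere. -/
def sphCoord (l : Fin (Module.finrank ℝ E)) : C(sphere (0 : E) 1, ℝ) :=
  ⟨fun θ => inner ℝ (stdOrthonormalBasis ℝ E l) (θ : E), by fun_prop⟩

theorem ray_sub_apply (v : E) (z : WithLp 2 (E × ℝ)) :
    (ray E v - ray E 0) z = WithLp.toLp 2 (0, z.snd • v) := by
  apply (WithLp.equiv 2 (E × E)).injective
  ext <;> simp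

theorem ray_eq_sum (θ : sphere (0 : E) 1) : ray E (θ : E) = ray E 0 +
    ∑ l, sphCoord l θ • (ray E (stdOrthonormalBasis ℝ E l) - ray E 0) := by
  rw [← sub_eq_iff_eq_add']
  refine ContinuousLinearMap.ext fun z => ?_
  rw [_root_.sum_apply, ray_sub_apply]
  simp only [_root_.smul_apply, ray_sub_apply]
  have h : (θ : E) = ∑ l, sphCoord l θ • stdOrthonormalBasis ℝ E l :=
    ((stdOrthonormalBasis ℝ E).sum_repr' (θ : E)).symm
  conv_lhs => rw [h]
  set g := (WithLp.prodContinuousLinearEquiv 2 ℝ E E).symm.toContinuousLinearMap ∘L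
        ContinuousLinearMap.inr ℝ E E with hg
  have hgv : ∀ v, WithLp.toLp 2 ((0 : E), v) = g v := fun v => rfl
  simp only [hgv, map_smul, map_sum, Finset.smul_sum]
  exact Finset.sum_congr rfl fun l _ => smul_comm _ _ _

/-- The spherical mean `(x, t) ↦ ∫ c(θ) Φ(x, t θ) dσ(θ)` in the second variable, with an angular
weight `c`. -/
def sphMeanS (c : C(sphere (0 : E) 1, ℝ)) (Φ : 𝓢(WithLp 2 (E × E), ℂ)) :
    𝓢(WithLp 2 (E × ℝ), ℂ) :=
  linMeanS (volume : Measure E).toSphere ray_eq_sum norm_ray c Φ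

theorem sphMeanS_apply (c : C(sphere (0 : E) 1, ℝ)) (Φ : 𝓢(WithLp 2 (E × E), ℂ))
    (z : WithLp 2 (E × ℝ)) :
    sphMeanS c Φ z = ∫ θ, (c θ : ℂ) * Φ (ray E (θ : E) z) ∂(volume : Measure E).toSphere := by
  rfl

theorem continuous_ray_left (z : WithLp 2 (E × ℝ)) :
    Continuous fun θ : sphere (0 : E) 1 => ray E (θ : E) z :=
  continuous_of_eq_sum ray_eq_sum z

theorem integrable_sphMean (c : C(sphere (0 : E) 1, ℝ)) {Φ : WithLp 2 (E × E) → ℂ}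
    (hΦ : Continuous Φ) (z : WithLp 2 (E × ℝ)) :
    Integrable (fun θ : sphere (0 : E) 1 => (c θ : ℂ) * Φ (ray E (θ : E) z))
      (volume : Measure E).toSphere :=
  Continuous.integrable_of_compactSpace _ ((Complex.continuous_ofReal.comp c.continuous).mul
    (hΦ.comp (continuous_ray_left z)))

theorem sphMeanS_add (c : C(sphere (0 : E) 1, ℝ)) (Φ Φ' : 𝓢(WithLp 2 (E × E), ℂ)) :
    sphMeanS c (Φ + Φ') = sphMeanS c Φ + sphMeanS c Φ' := by
  ext z
  rw [_root_.add_apply, sphMeanS_apply, sphMeanS_apply, sphMeanS_apply,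
    ← integral_add (integrable_sphMean c Φ.continuous z) (integrable_sphMean c Φ'.continuous z)]
  simp [mul_add]

end SphericalMean

/-! ### Weighted energies -/

section Energy

variable {X : Type*} [NormedAddCommGroup X] [InnerProductSpace ℝ X] [FiniteDimensional ℝ X]
  [MeasurableSpace X] [BorelSpace X]

/-- The square of the norm of `⟨x⟩ ^ a u` in `L²`. -/
def wEnergy (a : ℝ) (u : X → ℂ) : ℝ≥0∞ := ∫⁻ x, bracketSq a x * ‖u x‖ₑ ^ 2

theorem enorm_weight_sq (a : ℝ) (x : X) : ‖weight X a x‖ₑ ^ 2 = bracketSq a x := by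
  have h : (0 : ℝ) < 1 + ‖x‖ ^ 2 := by positivity
  rw [weight, ← ofReal_norm, Complex.norm_real, Real.norm_of_nonneg (by positivity),
    ← ENNReal.ofReal_pow (by positivity), bracketSq, ← Real.rpow_natCast, ← Real.rpow_mul h.le]
  norm_num

theorem enorm_add_sq_le (x y : ℂ) : ‖x + y‖ₑ ^ 2 ≤ 2 * (‖x‖ₑ ^ 2 + ‖y‖ₑ ^ 2) := by
  have h := ENNReal.rpow_add_le_mul_rpow_add_rpow ‖x‖ₑ ‖y‖ₑ (p := 2) (by norm_num)
  norm_num at h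
  exact (pow_le_pow_left₀ zero_le (enorm_add_le x y) 2).trans h

theorem wEnergy_mono_weight {a b : ℝ} (h : a ≤ b) (u : X → ℂ) : wEnergy a u ≤ wEnergy b u :=
  lintegral_mono fun x => mul_le_mul_left (bracketSq_mono h x) _

theorem measurable_wEnergy (a : ℝ) {u : X → ℂ} (hu : Continuous u) :
    Measurable fun x => bracketSq a x * ‖u x‖ₑ ^ 2 :=
  (measurable_bracketSq a).mul (hu.measurable.enorm.pow_const 2)

theorem wEnergy_add_le (a : ℝ) {u v : X → ℂ} (hu : Continuous u) :
    wEnergy a (fun x => u x + v x) ≤ 2 * (wEnergy a u + wEnergy a v) := by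
  rw [wEnergy, wEnergy, wEnergy, ← lintegral_add_left (measurable_wEnergy a hu),
    ← lintegral_const_mul' _ _ (by norm_num)]
  refine lintegral_mono fun x => ?_
  calc _ ≤ bracketSq a x * (2 * (‖u x‖ₑ ^ 2 + ‖v x‖ₑ ^ 2)) := by
        gcongr; exact enorm_add_sq_le _ _
    _ = _ := by ring

theorem wEnergy_const_mul (a : ℝ) (c : ℂ) (u : X → ℂ) :
    wEnergy a (fun x => c * u x) = ‖c‖ₑ ^ 2 * wEnergy a u := by
  rw [wEnergy, wEnergy, ← lintegral_const_mul' _ _ (by finiteness)]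
  refine lintegral_congr fun x => ?_
  rw [enorm_mul]; ring

theorem wEnergy_zero_eq (u : X → ℂ) : wEnergy 0 u = ∫⁻ x, ‖u x‖ₑ ^ 2 := by
  simp [wEnergy]

theorem enorm_inner_sq_le (x w : X) :
    ‖(inner ℝ x w : ℂ)‖ₑ ^ 2 ≤ ‖w‖ₑ ^ 2 * bracketSq 1 x := by
  have h : ‖(inner ℝ x w : ℂ)‖ₑ ≤ ‖x‖ₑ * ‖w‖ₑ := by
    rw [← ofReal_norm, ← ofReal_norm, ← ofReal_norm, ← ENNReal.ofReal_mul (norm_nonneg _),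
      Complex.norm_real]
    exact ENNReal.ofReal_le_ofReal (norm_inner_le_norm x w)
  rw [bracketSq_one]
  calc _ ≤ (‖x‖ₑ * ‖w‖ₑ) ^ 2 := by gcongr
    _ ≤ _ := by rw [mul_pow, mul_comm]; gcongr; exact le_add_self

theorem wEnergy_inner_mul_le (a : ℝ) (w : X) (u : X → ℂ) :
    wEnergy a (fun x => (inner ℝ x w : ℂ) * u x) ≤ ‖w‖ₑ ^ 2 * wEnergy (a + 1) u := by
  rw [wEnergy, wEnergy, ← lintegral_const_mul' _ _ (by finiteness)]
  refine lintegral_mono fun x => ?_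
  have h := enorm_inner_sq_le x w
  rw [enorm_mul, mul_pow, bracketSq_add]
  calc _ ≤ bracketSq a x * (‖w‖ₑ ^ 2 * bracketSq 1 x * ‖u x‖ₑ ^ 2) := by gcongr
    _ = _ := by ring

theorem wEnergy_add_one {ι : Type*} [Fintype ι] (b : OrthonormalBasis ι ℝ X) (a : ℝ) {u : X → ℂ}
    (hu : Continuous u) :
    wEnergy (a + 1) u = wEnergy a u + ∑ i, wEnergy a (fun x => (inner ℝ x (b i) : ℂ) * u x) := by
  simp only [wEnergy]
  rw [← lintegral_finsetSum _ fun i _ => measurable_wEnergy a (by fun_prop),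
    ← lintegral_add_left (measurable_wEnergy a hu)]
  refine lintegral_congr fun x => ?_
  have h : ‖x‖ₑ ^ 2 = ∑ i, ‖(inner ℝ x (b i) : ℂ)‖ₑ ^ 2 := by
    rw [← ofReal_norm, ← ENNReal.ofReal_pow (norm_nonneg _), ← b.sum_sq_norm_inner_right x,
      ENNReal.ofReal_sum_of_nonneg (fun _ _ => by positivity)]
    refine Finset.sum_congr rfl fun i _ => ?_
    rw [ENNReal.ofReal_pow (norm_nonneg _), real_inner_comm, ← Complex.norm_real, ofReal_norm]
  rw [bracketSq_add, bracketSq_one, h]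
  simp only [enorm_mul, mul_pow]
  rw [mul_add, mul_one, add_mul, Finset.mul_sum, Finset.sum_mul]
  congr 1
  exact Finset.sum_congr rfl fun i _ => by ring

theorem integrable_norm_sq (u : 𝓢(X, ℂ)) : Integrable fun x => ‖u x‖ ^ 2 :=
  (u.memLp 2).integrable_norm_pow (by norm_num)

theorem wEnergy_zero_eq_ofReal (u : 𝓢(X, ℂ)) :
    wEnergy 0 u = ENNReal.ofReal (∫ x, ‖u x‖ ^ 2) := by
  rw [wEnergy_zero_eq, ofReal_integral_eq_lintegral_ofReal (integrable_norm_sq u)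
    (Filter.Eventually.of_forall fun x => by positivity)]
  refine lintegral_congr fun x => ?_
  rw [ENNReal.ofReal_pow (norm_nonneg _), ofReal_norm]

/-- Plancherel's theorem in terms of energies. -/
theorem wEnergy_fourier (u : 𝓢(X, ℂ)) : wEnergy 0 (𝓕 u : 𝓢(X, ℂ)) = wEnergy 0 u := by
  rw [wEnergy_zero_eq_ofReal, wEnergy_zero_eq_ofReal]
  exact congrArg _ (integral_norm_sq_fourier u)

theorem wEnergy_fourierInv (u : 𝓢(X, ℂ)) : wEnergy 0 (𝓕⁻ u : 𝓢(X, ℂ)) = wEnergy 0 u := by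
  rw [← wEnergy_fourier (𝓕⁻ u : 𝓢(X, ℂ)), FourierTransform.fourier_fourierInv_eq]

end Energy

/-! ### Operators which are bounded for weighted norms -/

section BddOp

variable {X Y Z : Type*} [NormedAddCommGroup X] [InnerProductSpace ℝ X] [FiniteDimensional ℝ X]
  [MeasurableSpace X] [BorelSpace X] [NormedAddCommGroup Y] [InnerProductSpace ℝ Y]
  [FiniteDimensional ℝ Y] [MeasurableSpace Y] [BorelSpace Y]
  [NormedAddCommGroup Z] [InnerProductSpace ℝ Z]
  [FiniteDimensional ℝ Z] [MeasurableSpace Z] [BorelSpace Z]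

/-- Boundedness of an operator between Schwartz spaces for the `L²` norms with the weights
`⟨x⟩ ^ b` in the source and `⟨y⟩ ^ a` in the target. -/
def BddOp (a b : ℝ) (T : 𝓢(X, ℂ) → 𝓢(Y, ℂ)) : Prop :=
  ∃ C : ℝ≥0∞, C < ∞ ∧ ∀ u, wEnergy a (T u) ≤ C * wEnergy b u

theorem BddOp.add {a b : ℝ} {T T' : 𝓢(X, ℂ) → 𝓢(Y, ℂ)} (h : BddOp a b T) (h' : BddOp a b T') :
    BddOp a b (fun u => T u + T' u) := by
  obtain ⟨C, hC, h⟩ := h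
  obtain ⟨C', hC', h'⟩ := h'
  refine ⟨2 * (C + C'), by finiteness, fun u => ?_⟩
  calc wEnergy a (T u + T' u) ≤ 2 * (wEnergy a (T u) + wEnergy a (T' u)) :=
        wEnergy_add_le a (T u).continuous
    _ ≤ 2 * (C * wEnergy b u + C' * wEnergy b u) := by gcongr <;> simp_all
    _ = _ := by ring

theorem BddOp.smul {a b : ℝ} {T : 𝓢(X, ℂ) → 𝓢(Y, ℂ)} (h : BddOp a b T) (c : ℂ) :
    BddOp a b (fun u => c • T u) := by
  obtain ⟨C, hC, h⟩ := h
  refine ⟨‖c‖ₑ ^ 2 * C, by finiteness, fun u => ?_⟩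
  refine (wEnergy_const_mul a c (T u)).le.trans ?_
  rw [mul_assoc]
  exact mul_le_mul_right (h u) _

theorem BddOp.zero (a b : ℝ) : BddOp a b (fun _ : 𝓢(X, ℂ) => (0 : 𝓢(Y, ℂ))) :=
  ⟨0, by simp, fun u => by simp [wEnergy]⟩

theorem BddOp.sum {ι : Type*} (s : Finset ι) {a b : ℝ} {T : ι → 𝓢(X, ℂ) → 𝓢(Y, ℂ)}
    (h : ∀ i, BddOp a b (T i)) : BddOp a b (fun u => ∑ i ∈ s, T i u) := by
  classical
  induction s using Finset.induction_on with
  | empty => simpa using BddOp.zero a b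
  | insert i s hi ih =>
    simp only [Finset.sum_insert hi]
    exact (h i).add ih

theorem BddOp.comp {a b c : ℝ} {T : 𝓢(Y, ℂ) → 𝓢(Z, ℂ)} {T' : 𝓢(X, ℂ) → 𝓢(Y, ℂ)}
    (h : BddOp a b T) (h' : BddOp b c T') : BddOp a c (fun u => T (T' u)) := by
  obtain ⟨C, hC, h⟩ := h
  obtain ⟨C', hC', h'⟩ := h'
  refine ⟨C * C', by finiteness, fun u => (h _).trans ?_⟩
  rw [mul_assoc]
  exact mul_le_mul_right (h' u) _

theorem BddOp.mono {a a' b b' : ℝ} {T : 𝓢(X, ℂ) → 𝓢(Y, ℂ)} (h : BddOp a b T) (ha : a' ≤ a)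
    (hb : b ≤ b') : BddOp a' b' T := by
  obtain ⟨C, hC, h⟩ := h
  exact ⟨C, hC, fun u => ((wEnergy_mono_weight ha _).trans (h u)).trans
    (mul_le_mul_right (wEnergy_mono_weight hb _) _)⟩

/-- Multiplication by the coordinate `⟨·, w⟩`. -/
def mulInner (w : X) : 𝓢(X, ℂ) →L[ℂ] 𝓢(X, ℂ) :=
  SchwartzMap.smulLeftCLM ℂ (fun x => (inner ℝ x w : ℂ))

theorem hasTemperateGrowth_inner (w : X) :
    (fun x : X => (inner ℝ x w : ℂ)).HasTemperateGrowth :=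
  Function.HasTemperateGrowth.comp Function.Complex.hasTemperateGrowth_ofReal
    (Function.hasTemperateGrowth_inner_left w)

theorem mulInner_apply (w : X) (u : 𝓢(X, ℂ)) (x : X) :
    mulInner w u x = (inner ℝ x w : ℂ) * u x := by
  rw [mulInner, smulLeftCLM_apply_apply (hasTemperateGrowth_inner w), smul_eq_mul]

theorem BddOp.mulInner (a : ℝ) (w : X) : BddOp a (a + 1) (_root_.mulInner w) :=
  ⟨‖w‖ₑ ^ 2, by finiteness, fun u => by
    have : (⇑(_root_.mulInner w u)) = fun x => (inner ℝ x w : ℂ) * u x :=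
      funext (mulInner_apply w u)
    rw [this]
    exact wEnergy_inner_mul_le a w u⟩

/-- To gain one power of the weight in the target, it suffices to control the products with the
coordinates. -/
theorem BddOp.of_mulInner {a b : ℝ} {T : 𝓢(X, ℂ) → 𝓢(Y, ℂ)} (h : BddOp a b T)
    (hT : ∀ w : Y, BddOp a b (fun u => _root_.mulInner w (T u))) : BddOp (a + 1) b T := by
  obtain ⟨C, hC, h⟩ := h
  choose D hD hT using hT
  refine ⟨C + ∑ i, D (stdOrthonormalBasis ℝ Y i), ENNReal.add_lt_top.2
    ⟨hC, ENNReal.sum_lt_top.2 fun i _ => hD _⟩, fun u => ?_⟩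
  rw [wEnergy_add_one (stdOrthonormalBasis ℝ Y) a (T u).continuous, add_mul, Finset.sum_mul]
  refine add_le_add (h u) (Finset.sum_le_sum fun i _ => ?_)
  have := hT (stdOrthonormalBasis ℝ Y i) u
  rwa [show (⇑(_root_.mulInner (stdOrthonormalBasis ℝ Y i) (T u))) = fun x =>
    (inner ℝ x (stdOrthonormalBasis ℝ Y i) : ℂ) * T u x from funext (mulInner_apply _ _)] at this

open scoped LineDeriv

/-- Leibniz' rule for the product of a Schwartz function with a function of temperate growth. -/
theorem lineDerivOp_smulLeftCLM {g g' : X → ℂ} (hg : g.HasTemperateGrowth)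
    (hg' : g'.HasTemperateGrowth) (e : X) (hd : ∀ x, HasLineDerivAt ℝ g (g' x) x e)
    (u : 𝓢(X, ℂ)) :
    ∂_{e} (SchwartzMap.smulLeftCLM ℂ g u) =
      SchwartzMap.smulLeftCLM ℂ g' u + SchwartzMap.smulLeftCLM ℂ g (∂_{e} u) := by
  ext x
  rw [_root_.add_apply, smulLeftCLM_apply_apply hg', smulLeftCLM_apply_apply hg,
    SchwartzMap.lineDerivOp_apply, SchwartzMap.smulLeftCLM_apply hg]
  have hu : HasLineDerivAt ℝ u (∂_{e} u x) x e := (u.hasFDerivAt x).hasLineDerivAt e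
  have h : HasLineDerivAt ℝ (fun x => g x * u x) (g' x * u x + g x * ∂_{e} u x) x e := by
    have := HasDerivAt.mul (hd x) hu
    simpa using! this
  exact h.lineDeriv

/-- Multiplication by a coordinate corresponds to a derivative of the Fourier transform. -/
theorem mulInner_fourierInv (e : X) (u : 𝓢(X, ℂ)) :
    mulInner e (𝓕⁻ u) = (-(2 * Real.pi * Complex.I)⁻¹) • 𝓕⁻ (∂_{e} u) := by
  rw [fourierInv_lineDerivOp_eq]
  ext x
  simp only [_root_.smul_apply, smul_eq_mul]
  rw [mulInner_apply, smulLeftCLM_apply_apply (Function.hasTemperateGrowth_inner_left e)]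
  have : (2 * Real.pi * Complex.I : ℂ) ≠ 0 := by simp [Real.pi_ne_zero]
  simp only [Complex.real_smul]
  field_simp

theorem lineDerivOp_fourier (e : X) (u : 𝓢(X, ℂ)) :
    ∂_{e} (𝓕 u) = 𝓕 ((-(2 * Real.pi * Complex.I)) • mulInner e u) := by
  rw [lineDerivOp_fourier_eq]
  congr 2
  ext x
  rw [mulInner_apply, smulLeftCLM_apply_apply (Function.hasTemperateGrowth_inner_left e)]
  rfl

end BddOp

/-! ### Bessel symbols and Hardy's inequality -/

section Symbols

variable {V : Type} [NormedAddCommGroup V] [InnerProductSpace ℝ V] [FiniteDimensional ℝ V]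
  [MeasurableSpace V] [BorelSpace V]

open scoped LineDeriv

theorem bracketSymbol_add (a b : ℝ) (z : V) :
    bracketSymbol V (a + b) z = bracketSymbol V a z * bracketSymbol V b z := by
  have : (0 : ℝ) < 1 + ‖(2 * Real.pi) • z‖ ^ 2 := by positivity
  rw [bracketSymbol, bracketSymbol, bracketSymbol, weight, weight, weight, add_div,
    Real.rpow_add this, Complex.ofReal_mul]

theorem hasLineDerivAt_bracketSymbol (b : ℝ) (z e : V) :
    HasLineDerivAt ℝ (bracketSymbol V b)
      ((4 * Real.pi ^ 2 * b : ℝ) * ((inner ℝ z e : ℂ) *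
        (bracketSymbol V (-2) z * bracketSymbol V b z))) z e := by
  have h0 : (0 : ℝ) < 1 + ‖(2 * Real.pi) • z‖ ^ 2 := by positivity
  have h1 : HasDerivAt (fun t : ℝ => (2 * Real.pi) • (z + t • e)) ((2 * Real.pi) • e) 0 := by
    have := (((hasDerivAt_id (0 : ℝ)).smul_const e).const_add z).const_smul (2 * Real.pi)
    rw [one_smul] at this
    exact this
  have h2 := ((h1.norm_sq).const_add 1).rpow_const (p := b / 2) (Or.inl (by positivity))
  have h3 := h2.ofReal_comp
  refine HasDerivAt.congr_deriv h3 ?_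
  rw [← bracketSymbol_add, bracketSymbol, weight]
  simp only [zero_smul, add_zero]
  rw [show (-2 + b) / 2 = b / 2 - 1 by ring, inner_smul_left, inner_smul_right]
  push_cast
  simp only [conj_trivial]
  push_cast
  ring

theorem hasLineDerivAt_inner (z w e : V) :
    HasLineDerivAt ℝ (fun z : V => (inner ℝ z w : ℂ)) (inner ℝ e w : ℂ) z e := by
  have h1 : HasDerivAt (fun t : ℝ => inner ℝ (z + t • e) w) (inner ℝ e w) 0 := by
    have := ((hasDerivAt_id (0 : ℝ)).mul_const (inner ℝ e w)).const_add (inner ℝ z w)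
    rw [one_mul] at this
    refine this.congr_of_eventuallyEq (Filter.Eventually.of_forall fun t => ?_)
    simp only [id]
    rw [inner_add_left, inner_smul_left, conj_trivial]
  exact h1.ofReal_comp

/-- The symbols generated by `⟨2 π z⟩ ^ (-p)` under the operations which occur in computing its
derivatives. They are all bounded by multiples of `⟨z⟩ ^ (-p)`. -/
inductive BesselSymbol (p : ℝ) : (V → ℂ) → Prop
  | base : BesselSymbol p (bracketSymbol V (-p))
  | bracket {s : V → ℂ} : BesselSymbol p s →
      BesselSymbol p (fun z => bracketSymbol V (-2) z * s z)
  | coord (e : V) {s : V → ℂ} : BesselSymbol p s →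
      BesselSymbol p (fun z => (inner ℝ z e : ℂ) * (bracketSymbol V (-2) z * s z))
  | add {s s' : V → ℂ} : BesselSymbol p s → BesselSymbol p s' →
      BesselSymbol p (fun z => s z + s' z)
  | smul (c : ℂ) {s : V → ℂ} : BesselSymbol p s → BesselSymbol p (fun z => c * s z)

theorem BesselSymbol.hasTemperateGrowth {p : ℝ} {s : V → ℂ} (hs : BesselSymbol p s) :
    s.HasTemperateGrowth := by
  induction hs with
  | base => exact bracketSymbol_hasTemperateGrowth V _
  | bracket _ ih => exact (bracketSymbol_hasTemperateGrowth V _).mul ih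
  | coord e _ ih =>
    exact (hasTemperateGrowth_inner e).mul ((bracketSymbol_hasTemperateGrowth V _).mul ih)
  | add _ _ ih ih' => exact ih.add ih'
  | smul c _ ih => exact (Function.HasTemperateGrowth.const c).mul ih

theorem HasLineDerivAt.fun_mul {f g : V → ℂ} {f' g' : ℂ} {z e : V}
    (hf : HasLineDerivAt ℝ f f' z e) (hg : HasLineDerivAt ℝ g g' z e) :
    HasLineDerivAt ℝ (fun z => f z * g z) (f' * g z + f z * g') z e := by
  have := HasDerivAt.mul hf hg
  simp only [zero_smul, add_zero] at this
  exact this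

theorem HasLineDerivAt.congr_lineDeriv {f : V → ℂ} {f' g' : ℂ} {z e : V}
    (hf : HasLineDerivAt ℝ f f' z e) (h : f' = g') : HasLineDerivAt ℝ f g' z e := h ▸ hf

theorem BesselSymbol.exists_lineDeriv {p : ℝ} {s : V → ℂ} (hs : BesselSymbol p s) (e : V) :
    ∃ s' : V → ℂ, BesselSymbol p s' ∧ ∀ z, HasLineDerivAt ℝ s (s' z) z e := by
  induction hs with
  | base =>
    exact ⟨_, .smul _ (.coord e .base), fun z => hasLineDerivAt_bracketSymbol (-p) z e⟩
  | @bracket s hs ih =>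
    obtain ⟨s', hs', hd⟩ := ih
    refine ⟨_, .add (.smul ((4 * Real.pi ^ 2 * (-2) : ℝ) : ℂ) (.coord e (.bracket hs)))
      (.bracket hs'), fun z => ?_⟩
    refine ((hasLineDerivAt_bracketSymbol (-2) z e).fun_mul (hd z)).congr_lineDeriv ?_
    ring
  | @coord w s hs ih =>
    obtain ⟨s', hs', hd⟩ := ih
    refine ⟨_, .add (.smul (inner ℝ e w : ℂ) (.bracket hs)) (.add
      (.smul ((4 * Real.pi ^ 2 * (-2) : ℝ) : ℂ) (.coord w (.coord e hs)))
      (.coord w hs')), fun z => ?_⟩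
    refine ((hasLineDerivAt_inner z w e).fun_mul
      ((hasLineDerivAt_bracketSymbol (-2) z e).fun_mul (hd z))).congr_lineDeriv ?_
    ring
  | add _ _ ih ih' =>
    obtain ⟨t, ht, hd⟩ := ih
    obtain ⟨t', ht', hd'⟩ := ih'
    exact ⟨_, .add ht ht', fun z => HasDerivAt.add (hd z) (hd' z)⟩
  | smul c _ ih =>
    obtain ⟨t, ht, hd⟩ := ih
    exact ⟨_, .smul c ht, fun z => HasDerivAt.const_mul c (hd z)⟩

theorem enorm_bracketSymbol_sq (a : ℝ) (z : V) :
    ‖bracketSymbol V a z‖ₑ ^ 2 = bracketSq a ((2 * Real.pi) • z) :=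
  enorm_weight_sq a _

theorem bracketSq_two_pi_le {a : ℝ} (ha : a ≤ 0) (z : V) :
    bracketSq a ((2 * Real.pi) • z) ≤ bracketSq a z := by
  refine ENNReal.ofReal_le_ofReal (Real.rpow_le_rpow_of_nonpos (by positivity) ?_ ha)
  rw [norm_smul, Real.norm_of_nonneg (by positivity)]
  have : (1 : ℝ) ≤ 2 * Real.pi := by linarith [Real.pi_gt_three]
  gcongr
  exact le_mul_of_one_le_left (norm_nonneg z) this

theorem BesselSymbol.exists_enorm_sq_le {p : ℝ} (hp : 0 ≤ p) {s : V → ℂ} (hs : BesselSymbol p s) :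
    ∃ C : ℝ≥0∞, C < ∞ ∧ ∀ z, ‖s z‖ₑ ^ 2 ≤ C * bracketSq (-p) z := by
  induction hs with
  | base =>
    refine ⟨1, by simp, fun z => ?_⟩
    rw [enorm_bracketSymbol_sq, one_mul]
    exact bracketSq_two_pi_le (by linarith) z
  | @bracket s hs ih =>
    obtain ⟨C, hC, h⟩ := ih
    refine ⟨C, hC, fun z => ?_⟩
    rw [enorm_mul, mul_pow, enorm_bracketSymbol_sq]
    calc _ ≤ 1 * (C * bracketSq (-p) z) := by
          gcongr
          · refine (bracketSq_two_pi_le (by norm_num) z).trans ?_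
            exact (bracketSq_mono (by norm_num : (-2 : ℝ) ≤ 0) z).trans_eq (bracketSq_zero z)
          · exact h z
      _ = _ := one_mul _
  | @coord w s hs ih =>
    obtain ⟨C, hC, h⟩ := ih
    refine ⟨‖w‖ₑ ^ 2 * C, by finiteness, fun z => ?_⟩
    have h1 := enorm_inner_sq_le z w
    have h2 : bracketSq (-2) ((2 * Real.pi) • z) ≤ bracketSq (-1) z :=
      (bracketSq_two_pi_le (by norm_num) z).trans (bracketSq_mono (by norm_num) z)
    rw [enorm_mul, enorm_mul, mul_pow, mul_pow, enorm_bracketSymbol_sq]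
    calc _ ≤ (‖w‖ₑ ^ 2 * bracketSq 1 z) * (bracketSq (-1) z * (C * bracketSq (-p) z)) := by
          gcongr; exact h z
      _ = (bracketSq 1 z * bracketSq (-1) z) * (‖w‖ₑ ^ 2 * C * bracketSq (-p) z) := by ring
      _ = _ := by rw [bracketSq_mul_neg, one_mul]
  | add _ _ ih ih' =>
    obtain ⟨C, hC, h⟩ := ih
    obtain ⟨D, hD, h'⟩ := ih'
    refine ⟨2 * (C + D), by finiteness, fun z => (enorm_add_sq_le _ _).trans ?_⟩
    calc _ ≤ 2 * (C * bracketSq (-p) z + D * bracketSq (-p) z) := by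
          gcongr
          · exact h z
          · exact h' z
      _ = _ := by ring
  | smul c _ ih =>
    obtain ⟨C, hC, h⟩ := ih
    refine ⟨‖c‖ₑ ^ 2 * C, by finiteness, fun z => ?_⟩
    rw [enorm_mul, mul_pow, mul_assoc]
    gcongr
    exact h z

theorem hasTemperateGrowth_inner_pow (e : V) (j : ℕ) :
    (fun z : V => (inner ℝ z e : ℂ) ^ j).HasTemperateGrowth := by
  induction j with
  | zero => simp
  | succ j ih => simp only [pow_succ]; exact ih.mul (hasTemperateGrowth_inner e)

theorem hasLineDerivAt_inner_pow (z w e : V) (j : ℕ) :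
    HasLineDerivAt ℝ (fun z : V => (inner ℝ z w : ℂ) ^ j)
      (j * (inner ℝ e w : ℂ) * (inner ℝ z w : ℂ) ^ (j - 1)) z e := by
  have := HasDerivAt.pow (hasLineDerivAt_inner z w e) j
  refine HasDerivAt.congr_deriv this ?_
  simp only [zero_smul, add_zero]
  ring

/-- Multiplication by a power of the coordinate `⟨·, e⟩`. -/
def mulInnerPow (e : V) (j : ℕ) : 𝓢(V, ℂ) →L[ℂ] 𝓢(V, ℂ) :=
  SchwartzMap.smulLeftCLM ℂ (fun z => (inner ℝ z e : ℂ) ^ j)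

theorem mulInnerPow_apply (e : V) (j : ℕ) (u : 𝓢(V, ℂ)) (z : V) :
    mulInnerPow e j u z = (inner ℝ z e : ℂ) ^ j * u z := by
  rw [mulInnerPow, smulLeftCLM_apply_apply (hasTemperateGrowth_inner_pow e j), smul_eq_mul]

theorem lineDerivOp_mulInnerPow (e w : V) (j : ℕ) (u : 𝓢(V, ℂ)) :
    ∂_{w} (mulInnerPow e j u) =
      (j * (inner ℝ w e : ℂ)) • mulInnerPow e (j - 1) u + mulInnerPow e j (∂_{w} u) := by
  rw [mulInnerPow, lineDerivOp_smulLeftCLM (hasTemperateGrowth_inner_pow e j)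
    ((Function.HasTemperateGrowth.const (j * (inner ℝ w e : ℂ))).mul
      (hasTemperateGrowth_inner_pow e (j - 1))) w (fun z => hasLineDerivAt_inner_pow z e w j)]
  congr 1
  ext z
  rw [smulLeftCLM_apply_apply ((Function.HasTemperateGrowth.const _).mul
    (hasTemperateGrowth_inner_pow e (j - 1))), _root_.smul_apply, mulInnerPow_apply, smul_eq_mul,
    smul_eq_mul, Pi.mul_apply, mul_assoc, mul_assoc]

/-- Hardy's inequality in the direction of a unit vector `e`. With `q = ⟨x, e⟩`, integration by
parts in `∫ q ^ (2 j + 1) ⟪h, ∂h⟫` shows that `(2 j + 1) ∫ |q ^ j h| ^ 2` equals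
`-2 ∫ q ⟪q ^ j h, q ^ j ∂h⟫`, to which the inequality between arithmetic and geometric means is
applied. -/
theorem wEnergy_mulInnerPow_le {e : V} (he : ‖e‖ = 1) (j : ℕ) (h : 𝓢(V, ℂ)) :
    wEnergy 0 (mulInnerPow e j h) ≤ 4 * wEnergy 0 (mulInnerPow e (j + 1) (∂_{e} h)) := by
  have hibp : ∫ x, inner ℝ (mulInnerPow e (2 * j + 1) h x) (∂_{e} h x) =
      -∫ x, inner ℝ (∂_{e} (mulInnerPow e (2 * j + 1) h) x) (h x) :=
    integral_bilinear_lineDerivOp_right_eq_neg_left (μ := (volume : Measure V))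
      (mulInnerPow e (2 * j + 1) h) h (innerSL ℝ (E := ℂ)) e
  have he' : inner ℝ e e = (1 : ℝ) := by rw [real_inner_self_eq_norm_sq, he, one_pow]
  rw [lineDerivOp_mulInnerPow, he'] at hibp
  have e1 : ∀ x, inner ℝ (mulInnerPow e (2 * j + 1) h x) (∂_{e} h x) =
      inner ℝ x e * inner ℝ (mulInnerPow e j h x) (mulInnerPow e j (∂_{e} h) x) := fun x => by
    simp only [mulInnerPow_apply, ← Complex.ofReal_pow, ← Complex.real_smul]
    simp only [inner_smul_left, inner_smul_right, conj_trivial]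
    ring
  have e2 : ∀ x, inner ℝ (((((2 * j + 1 : ℕ) : ℂ) * ((1 : ℝ) : ℂ)) •
      mulInnerPow e (2 * j + 1 - 1) h + mulInnerPow e (2 * j + 1) (∂_{e} h)) x) (h x) =
      (2 * j + 1) * ‖mulInnerPow e j h x‖ ^ 2 +
      inner ℝ x e * inner ℝ (mulInnerPow e j h x) (mulInnerPow e j (∂_{e} h) x) := fun x => by
    rw [_root_.add_apply, _root_.smul_apply, inner_add_left]
    congr 1
    · rw [← real_inner_self_eq_norm_sq]
      simp only [mulInnerPow_apply, Nat.add_sub_cancel, smul_eq_mul]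
      rw [show (((2 * j + 1 : ℕ) : ℂ) * ((1 : ℝ) : ℂ)) = ((2 * j + 1 : ℝ) : ℂ) by push_cast; ring]
      simp only [← Complex.ofReal_pow, ← Complex.real_smul]
      simp only [inner_smul_left, inner_smul_right, conj_trivial]
      ring
    · rw [real_inner_comm (mulInnerPow e j (∂_{e} h) x)]
      simp only [mulInnerPow_apply, ← Complex.ofReal_pow, ← Complex.real_smul]
      simp only [inner_smul_left, inner_smul_right, conj_trivial]
      ring
  simp only [e1, e2] at hibp
  set I := fun x => inner ℝ x e * inner ℝ (mulInnerPow e j h x) (mulInnerPow e j (∂_{e} h) x)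
    with hI
  have hIb : ∀ x, -(4 * I x) ≤
      ‖mulInnerPow e j h x‖ ^ 2 + 4 * ‖mulInnerPow e (j + 1) (∂_{e} h) x‖ ^ 2 := fun x => by
    have h1 : ‖mulInnerPow e (j + 1) (∂_{e} h) x‖ =
        |inner ℝ x e| * ‖mulInnerPow e j (∂_{e} h) x‖ := by
      rw [mulInnerPow_apply, mulInnerPow_apply, pow_succ', mul_assoc, norm_mul, Complex.norm_real,
        Real.norm_eq_abs]
    have h2 : -I x ≤ |inner ℝ x e| * (‖mulInnerPow e j h x‖ * ‖mulInnerPow e j (∂_{e} h) x‖) := by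
      rw [hI]
      refine (neg_le_abs _).trans ?_
      rw [abs_mul]
      gcongr
      exact abs_real_inner_le_norm _ _
    rw [h1]
    nlinarith [sq_nonneg (‖mulInnerPow e j h x‖ -
      2 * (|inner ℝ x e| * ‖mulInnerPow e j (∂_{e} h) x‖))]
  have hIi : Integrable I := by
    have := (bilinLeftCLM (innerSL ℝ (E := ℂ)) h.hasTemperateGrowth
      (mulInnerPow e (2 * j + 1) (∂_{e} h))).integrable (μ := (volume : Measure V))
    refine this.congr (Filter.Eventually.of_forall fun x => ?_)
    change inner ℝ (mulInnerPow e (2 * j + 1) (∂_{e} h) x) (h x) = I x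
    rw [hI, real_inner_comm]
    simp only [mulInnerPow_apply, ← Complex.ofReal_pow, ← Complex.real_smul]
    simp only [inner_smul_left, inner_smul_right, conj_trivial]
    ring
  have hi1 := integrable_norm_sq (mulInnerPow e j h)
  have hi2 := integrable_norm_sq (mulInnerPow e (j + 1) (∂_{e} h))
  rw [integral_add (hi1.const_mul _) hIi, integral_const_mul] at hibp
  have h3 := integral_mono (hIi.const_mul 4).neg (hi1.add (hi2.const_mul 4)) (fun x => hIb x)
  simp only [Pi.neg_apply, Pi.add_apply] at h3
  rw [integral_neg, integral_const_mul, integral_add hi1 (hi2.const_mul 4),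
    integral_const_mul] at h3
  have h4 : (0 : ℝ) ≤ ∫ x, ‖mulInnerPow e j h x‖ ^ 2 := integral_nonneg fun x => by positivity
  have h5 : (0 : ℝ) ≤ ∫ x, ‖mulInnerPow e (j + 1) (∂_{e} h) x‖ ^ 2 :=
    integral_nonneg fun x => by positivity
  rw [wEnergy_zero_eq_ofReal, wEnergy_zero_eq_ofReal,
    show (4 : ℝ≥0∞) = ENNReal.ofReal 4 by norm_num, ← ENNReal.ofReal_mul (by norm_num)]
  refine ENNReal.ofReal_le_ofReal ?_
  have h6 : (0 : ℝ) ≤ j * ∫ x, ‖mulInnerPow e j h x‖ ^ 2 := by positivity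
  linarith

end Symbols

/-! ### Weighted bounds for Fourier multipliers composed with averages -/

section MeanOperator

open scoped LineDeriv

section Multiplication

variable {V : Type} [NormedAddCommGroup V] [InnerProductSpace ℝ V] [FiniteDimensional ℝ V]
  [MeasurableSpace V] [BorelSpace V]

theorem bracketSq_pow (a : ℝ) (i : ℕ) (z : V) : bracketSq a z ^ i = bracketSq (a * i) z := by
  rw [bracketSq, bracketSq, ← ENNReal.ofReal_pow (by positivity), Real.rpow_mul (by positivity),
    Real.rpow_natCast]

theorem enorm_inner_sq_le_of_norm_eq_one {e : V} (he : ‖e‖ = 1) (z : V) :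
    ‖(inner ℝ z e : ℂ)‖ₑ ^ 2 ≤ bracketSq 1 z := by
  have h : ‖e‖ₑ = 1 := by rw [← ofReal_norm, he, ENNReal.ofReal_one]
  simpa [h] using enorm_inner_sq_le z e

/-- A symbol of order `-m` compensates a factor `⟨z, e⟩ ^ i` with `i ≤ m`. -/
theorem exists_wEnergy_mulInnerPow_smulLeftCLM_le {e : V} (he : ‖e‖ = 1) {m i : ℕ} (hi : i ≤ m)
    (j : ℕ) {s : V → ℂ} (hs : BesselSymbol m s) :
    ∃ C : ℝ≥0∞, C < ∞ ∧ ∀ u : 𝓢(V, ℂ),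
      wEnergy 0 (mulInnerPow e (j + i) (SchwartzMap.smulLeftCLM ℂ s u)) ≤
        C * wEnergy 0 (mulInnerPow e j u) := by
  obtain ⟨C, hC, h⟩ := hs.exists_enorm_sq_le (Nat.cast_nonneg m)
  refine ⟨C, hC, fun u => ?_⟩
  rw [wEnergy_zero_eq, wEnergy_zero_eq, ← lintegral_const_mul' _ _ hC.ne]
  refine lintegral_mono fun z => ?_
  rw [mulInnerPow_apply, mulInnerPow_apply, smulLeftCLM_apply_apply hs.hasTemperateGrowth]
  simp only [smul_eq_mul, enorm_mul, enorm_pow, mul_pow]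
  have h1 : (‖(inner ℝ z e : ℂ)‖ₑ ^ i) ^ 2 * ‖s z‖ₑ ^ 2 ≤ C := by
    calc _ ≤ bracketSq i z * (C * bracketSq (-m) z) := by
          gcongr
          · rw [← pow_mul, mul_comm, pow_mul]
            calc _ ≤ bracketSq 1 z ^ i := by gcongr; exact enorm_inner_sq_le_of_norm_eq_one he z
              _ = _ := by rw [bracketSq_pow, one_mul]
          · exact h z
      _ = C * bracketSq (i + -m) z := by rw [bracketSq_add]; ring
      _ ≤ C * 1 := by
          gcongr
          refine (bracketSq_mono (b := 0) ?_ z).trans_eq (bracketSq_zero z)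
          have : (i : ℝ) ≤ m := by exact_mod_cast hi
          linarith
      _ = C := mul_one C
  calc _ = ((‖(inner ℝ z e : ℂ)‖ₑ ^ i) ^ 2 * ‖s z‖ₑ ^ 2) *
        ((‖(inner ℝ z e : ℂ)‖ₑ ^ j) ^ 2 * ‖u z‖ₑ ^ 2) := by rw [pow_add]; ring
    _ ≤ _ := by gcongr

theorem BddOp.fourier : BddOp 0 0 (fun u : 𝓢(V, ℂ) => (𝓕 u : 𝓢(V, ℂ))) :=
  ⟨1, by simp, fun u => by rw [wEnergy_fourier, one_mul]⟩

/-- Multiplication by a coordinate, normalized so that it corresponds to a derivative on the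
Fourier side. -/
def dualDeriv (w : V) (u : 𝓢(V, ℂ)) : 𝓢(V, ℂ) := (-(2 * Real.pi * Complex.I)) • mulInner w u

theorem BddOp.dualDeriv (a : ℝ) (w : V) : BddOp a (a + 1) (_root_.dualDeriv w) :=
  (BddOp.mulInner a w).smul _

end Multiplication

variable {S : Type} [TopologicalSpace S] [CompactSpace S] [MeasurableSpace S] [BorelSpace S]
  (μ : Measure S) [IsFiniteMeasure μ]
  {V W : Type} [NormedAddCommGroup V] [InnerProductSpace ℝ V] [FiniteDimensional ℝ V]
  [MeasurableSpace V] [BorelSpace V] [NormedAddCommGroup W] [InnerProductSpace ℝ W]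
  [FiniteDimensional ℝ W] [MeasurableSpace W] [BorelSpace W]
  {ι : Type} [Fintype ι] {R : S → V →L[ℝ] W} {L₀ : V →L[ℝ] W} {L : ι → V →L[ℝ] W}
  {γ : ι → C(S, ℝ)} (hR : ∀ θ, R θ = L₀ + ∑ l, γ l θ • L l) (hn : ∀ θ z, ‖R θ z‖ = ‖z‖)

theorem lineDerivOp_linMeanS_fourier (c : C(S, ℝ)) (Ψ : 𝓢(W, ℂ)) (e : V) :
    ∂_{e} (linMeanS μ hR hn c (𝓕 Ψ)) = linMeanS μ hR hn c (𝓕 (dualDeriv (L₀ e) Ψ)) +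
      ∑ l, linMeanS μ hR hn (c * γ l) (𝓕 (dualDeriv (L l e) Ψ)) := by
  rw [lineDerivOp_linMeanS]
  simp only [lineDerivOp_fourier]
  rfl

/-- A factor `⟨z, e⟩ ^ (m + 1)` makes the average bounded in `L²`. With only `m + 1 - k` factors,
Hardy's inequality is used `k` times; every use differentiates the average, which amounts to one
more power of the weight on `Ψ`. -/
theorem bddOp_mulInnerPow_linMeanS {e : V} (he : ‖e‖ = 1) {m : ℕ}
    (hpol : ∀ c, BddOp 0 0 (fun Φ : 𝓢(W, ℂ) => mulInnerPow e (m + 1) (linMeanS μ hR hn c Φ)))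
    (k : ℕ) : ∀ (j : ℕ), j + k = m + 1 → ∀ c : C(S, ℝ),
    BddOp 0 k (fun Ψ : 𝓢(W, ℂ) => mulInnerPow e j (linMeanS μ hR hn c (𝓕 Ψ))) := by
  induction k with
  | zero =>
    rintro j hj c
    obtain rfl : j = m + 1 := by omega
    simpa using (hpol c).comp BddOp.fourier
  | succ k ih =>
    intro j hj c
    have key : BddOp 0 ((k + 1 : ℕ) : ℝ) (fun Ψ : 𝓢(W, ℂ) =>
        mulInnerPow e (j + 1) (linMeanS μ hR hn c (𝓕 (dualDeriv (L₀ e) Ψ))) +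
        ∑ l, mulInnerPow e (j + 1) (linMeanS μ hR hn (c * γ l) (𝓕 (dualDeriv (L l e) Ψ)))) := by
      rw [Nat.cast_succ]
      exact ((ih (j + 1) (by omega) c).comp (BddOp.dualDeriv k (L₀ e))).add
        (BddOp.sum _ fun l => (ih (j + 1) (by omega) (c * γ l)).comp (BddOp.dualDeriv k (L l e)))
    obtain ⟨C, hC, h⟩ := key
    refine ⟨4 * C, by finiteness, fun Ψ => (wEnergy_mulInnerPow_le he j _).trans ?_⟩
    rw [mul_assoc]
    refine mul_le_mul_right ?_ _
    rw [lineDerivOp_linMeanS_fourier, map_add, map_sum]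
    exact h Ψ

/-- The Fourier multiplier with symbol `⟨z, e⟩ ^ j s(z)` applied, on the Fourier side, to an average
over linear maps. -/
def meanOp (e : V) (j : ℕ) (s : V → ℂ) (c : C(S, ℝ)) (Ψ : 𝓢(W, ℂ)) : 𝓢(V, ℂ) :=
  𝓕⁻ (mulInnerPow e j (SchwartzMap.smulLeftCLM ℂ s (linMeanS μ hR hn c (𝓕 Ψ))))

/-- Multiplying `meanOp` by a coordinate differentiates its Fourier transform: the derivative falls
on the power of `⟨z, e⟩`, on the symbol or on the average. -/
theorem mulInner_meanOp (e w : V) (j : ℕ) {s s' : V → ℂ} (hs : s.HasTemperateGrowth)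
    (hs' : s'.HasTemperateGrowth) (hd : ∀ z, HasLineDerivAt ℝ s (s' z) z w) (c : C(S, ℝ))
    (Ψ : 𝓢(W, ℂ)) :
    mulInner w (meanOp μ hR hn e j s c Ψ) = (-(2 * Real.pi * Complex.I)⁻¹ : ℂ) •
      ((j * (inner ℝ w e : ℂ)) • meanOp μ hR hn e (j - 1) s c Ψ + (meanOp μ hR hn e j s' c Ψ +
        (meanOp μ hR hn e j s c (dualDeriv (L₀ w) Ψ) +
          ∑ l, meanOp μ hR hn e j s (c * γ l) (dualDeriv (L l w) Ψ)))) := by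
  have hF : ∀ u : 𝓢(V, ℂ), 𝓕⁻ u = (FourierTransform.fourierCLE ℂ 𝓢(V, ℂ)).symm u := fun u => rfl
  simp only [meanOp]
  rw [mulInner_fourierInv, lineDerivOp_mulInnerPow, lineDerivOp_smulLeftCLM hs hs' w hd,
    lineDerivOp_linMeanS_fourier]
  simp only [hF, map_add, map_sum, map_smul]

/-- The weighted bounds for the operators `meanOp`: the loss of powers of the weight is the number
of times that Hardy's inequality has to be used in order to produce the factor `⟨z, e⟩ ^ (m + 1)`
for which boundedness is known. Only `j ≤ 2 m + 1` is possible, since the symbol of order `-m`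
absorbs at most `m` further factors. -/
theorem bddOp_meanOp {e : V} (he : ‖e‖ = 1) {m : ℕ}
    (hpol : ∀ c, BddOp 0 0 (fun Φ : 𝓢(W, ℂ) => mulInnerPow e (m + 1) (linMeanS μ hR hn c Φ)))
    (N : ℕ) : ∀ j ≤ 2 * m + 1, ∀ s : V → ℂ, BesselSymbol m s → ∀ c : C(S, ℝ),
    BddOp N (N + (m + 1 - j : ℕ)) (meanOp μ hR hn e j s c) := by
  induction N with
  | zero =>
    intro j hj s hs c
    have key : ∃ C : ℝ≥0∞, C < ∞ ∧ ∀ u : 𝓢(V, ℂ),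
        wEnergy 0 (mulInnerPow e j (SchwartzMap.smulLeftCLM ℂ s u)) ≤
        C * wEnergy 0 (mulInnerPow e (m + 1 - (m + 1 - j)) u) := by
      obtain ⟨i, hi, hij⟩ : ∃ i ≤ m, m + 1 - (m + 1 - j) + i = j :=
        ⟨j - (m + 1 - (m + 1 - j)), by omega, by omega⟩
      have := exists_wEnergy_mulInnerPow_smulLeftCLM_le he hi (m + 1 - (m + 1 - j)) hs
      rwa [hij] at this
    obtain ⟨C, hC, h⟩ := key
    obtain ⟨D, hD, h'⟩ := bddOp_mulInnerPow_linMeanS μ hR hn he hpol (m + 1 - j)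
      (m + 1 - (m + 1 - j)) (by omega) c
    refine ⟨C * D, by finiteness, fun Ψ => ?_⟩
    rw [meanOp, Nat.cast_zero, wEnergy_fourierInv, zero_add, mul_assoc]
    exact (h _).trans (mul_le_mul_right (h' Ψ) _)
  | succ N ih =>
    intro j hj s hs c
    have hcast : ((N + 1 : ℕ) : ℝ) = N + 1 := by push_cast; ring
    -- a derivative of `⟨z, e⟩ ^ j` costs at most one power more, which is what the step allows
    have hle : ((m + 1 - (j - 1) : ℕ) : ℝ) ≤ 1 + (m + 1 - j : ℕ) := by
      exact_mod_cast (by omega : m + 1 - (j - 1) ≤ 1 + (m + 1 - j))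
    rw [hcast]
    refine BddOp.of_mulInner ((ih j hj s hs c).mono le_rfl (by linarith)) fun w => ?_
    obtain ⟨s', hs', hd⟩ := hs.exists_lineDeriv w
    have hmul := fun Ψ => mulInner_meanOp μ hR hn e w j hs.hasTemperateGrowth
      hs'.hasTemperateGrowth hd c Ψ
    simp only [hmul]
    refine BddOp.smul (BddOp.add (BddOp.smul ?_ _) (BddOp.add ?_ (BddOp.add ?_
      (BddOp.sum _ fun l => ?_)))) _
    · exact (ih (j - 1) (by omega) s hs c).mono le_rfl (by linarith)
    · exact (ih j hj s' hs' c).mono le_rfl (by linarith)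
    · exact ((ih j hj s hs c).comp (BddOp.dualDeriv _ (L₀ w))).mono le_rfl (by linarith)
    · exact ((ih j hj s hs (c * γ l)).comp (BddOp.dualDeriv _ (L l w))).mono le_rfl (by linarith)

end MeanOperator

/-! ### Interpolation between weights -/

section Interpolation

/-- Integration over the level `l` turns truncations of `X` into the power `X ^ θ`. -/
theorem lintegral_min_mul_rpow {θ : ℝ} (h0 : 0 < θ) (h1 : θ < 1) {X : ℝ} (hX : 0 < X) :
    ∫⁻ l in Set.Ioi (0 : ℝ), ENNReal.ofReal (min X l * l ^ (θ - 2)) =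
      ENNReal.ofReal ((1 / θ + 1 / (1 - θ)) * X ^ θ) := by
  have e1 : ∫⁻ l in Set.Ioc 0 X, ENNReal.ofReal (min X l * l ^ (θ - 2)) =
      ENNReal.ofReal (X ^ θ / θ) := by
    have hi : IntervalIntegrable (fun l : ℝ => l ^ (θ - 1)) volume 0 X :=
      intervalIntegral.intervalIntegrable_rpow' (by linarith)
    have h := ofReal_integral_eq_lintegral_ofReal
      ((intervalIntegrable_iff_integrableOn_Ioc_of_le hX.le).1 hi)
      ((ae_restrict_iff' measurableSet_Ioc).2 (Filter.Eventually.of_forall fun l hl =>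
        Real.rpow_nonneg hl.1.le _))
    rw [← intervalIntegral.integral_of_le hX.le, integral_rpow (Or.inl (by linarith)),
      sub_add_cancel, Real.zero_rpow h0.ne', sub_zero] at h
    rw [h]
    refine setLIntegral_congr_fun measurableSet_Ioc fun l hl => ?_
    rw [min_eq_right hl.2, show θ - 1 = 1 + (θ - 2) by ring, Real.rpow_add hl.1, Real.rpow_one]
  have e2 : ∫⁻ l in Set.Ioi X, ENNReal.ofReal (min X l * l ^ (θ - 2)) =
      ENNReal.ofReal (X ^ θ / (1 - θ)) := by
    have hi : IntegrableOn (fun l : ℝ => X * l ^ (θ - 2)) (Set.Ioi X) :=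
      (integrableOn_Ioi_rpow_of_lt (by linarith) hX).const_mul X
    have h := ofReal_integral_eq_lintegral_ofReal hi
      ((ae_restrict_iff' measurableSet_Ioi).2 (Filter.Eventually.of_forall fun l hl =>
        mul_nonneg hX.le (Real.rpow_nonneg (hX.trans hl).le _)))
    rw [integral_const_mul, integral_Ioi_rpow_of_lt (by linarith) hX] at h
    rw [show X ^ θ / (1 - θ) = X * (-X ^ (θ - 2 + 1) / (θ - 2 + 1)) by
      rw [show θ = 1 + (θ - 2 + 1) by ring, Real.rpow_add hX, Real.rpow_one]
      have : θ - 1 ≠ 0 := by linarith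
      have : 1 - θ ≠ 0 := by linarith
      have e : 1 - (1 + (θ - 2 + 1)) = -(θ - 1) := by ring
      have e' : 1 + (θ - 2 + 1) - 2 + 1 = θ - 1 := by ring
      have e'' : θ - 2 + 1 = θ - 1 := by ring
      rw [e, e', e'']
      field_simp, h]
    refine setLIntegral_congr_fun measurableSet_Ioi fun l hl => ?_
    rw [min_eq_left (le_of_lt hl)]
  rw [← Set.Ioc_union_Ioi_eq_Ioi hX.le, lintegral_union measurableSet_Ioi
    Set.Ioc_disjoint_Ioi_same, e1, e2, ← ENNReal.ofReal_add (by positivity)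
    (div_nonneg (by positivity) (by linarith))]
  congr 1
  ring

variable {V W : Type*} [NormedAddCommGroup V] [InnerProductSpace ℝ V] [FiniteDimensional ℝ V]
  [MeasurableSpace V] [BorelSpace V] [NormedAddCommGroup W] [InnerProductSpace ℝ W]
  [FiniteDimensional ℝ W] [MeasurableSpace W] [BorelSpace W]

/-- The function `l / (l + ⟨x⟩ ^ (2 N))`, which separates the regions where the weight
`⟨x⟩ ^ (2 N)` is small or large in comparison with `l`. -/
def weightCut (N l : ℝ) (x : W) : ℝ := l / (l + (1 + ‖x‖ ^ 2) ^ N)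

/-- `weightCut` is the composition of `r ↦ ⟨r⟩ ^ (-2)` with a function of temperate growth. -/
theorem hasTemperateGrowth_weightCut (N : ℝ) {l : ℝ} (hl : 0 < l) :
    (fun x : W => (weightCut N l x : ℂ)).HasTemperateGrowth := by
  have h1 : (fun x : W => l ^ (-(1 / 2) : ℝ) * (1 + ‖x‖ ^ 2) ^ (N / 2)).HasTemperateGrowth :=
    (Function.HasTemperateGrowth.const _).mul
      (Function.hasTemperateGrowth_one_add_norm_sq_rpow W (N / 2))
  have h2 := (weight_hasTemperateGrowth ℝ (-2)).comp h1
  convert h2 using 1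
  funext x
  have h3 : (0 : ℝ) < 1 + ‖x‖ ^ 2 := by positivity
  simp only [Function.comp, weightCut, weight]
  congr 1
  rw [show (-2 : ℝ) / 2 = -1 by norm_num, Real.rpow_neg_one, norm_mul, mul_pow,
    Real.norm_of_nonneg (by positivity), Real.norm_of_nonneg (by positivity)]
  have e1 : (l ^ (-(1 / 2) : ℝ)) ^ 2 = l⁻¹ := by
    rw [← Real.rpow_natCast, ← Real.rpow_mul hl.le, ← Real.rpow_neg_one]
    norm_num
  have e2 : ((1 + ‖x‖ ^ 2) ^ (N / 2)) ^ 2 = (1 + ‖x‖ ^ 2) ^ N := by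
    rw [← Real.rpow_natCast ((1 + ‖x‖ ^ 2) ^ (N / 2)), ← Real.rpow_mul h3.le]
    norm_num
  rw [e1, e2]
  field_simp

/-- The two pieces of the decomposition of a function by `weightCut`, in the norms with the weights
`⟨x⟩ ^ N` and `1`, are together controlled by the truncated weight. -/
theorem weightCut_mul_le {N l : ℝ} (hl : 0 < l) (x : W) :
    (1 + ‖x‖ ^ 2) ^ N * weightCut N l x ^ 2 + l * (1 - weightCut N l x) ^ 2 ≤
      min ((1 + ‖x‖ ^ 2) ^ N) l := by
  have hX : (0 : ℝ) < (1 + ‖x‖ ^ 2) ^ N := by positivity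
  rw [weightCut]
  generalize (1 + ‖x‖ ^ 2) ^ N = X at hX
  have h : X * (l / (l + X)) ^ 2 + l * (1 - l / (l + X)) ^ 2 = l * X / (l + X) := by
    field_simp
    ring
  rw [h, le_min_iff]
  constructor
  · rw [div_le_iff₀ (by positivity)]; nlinarith
  · rw [div_le_iff₀ (by positivity)]; nlinarith

/-- Bounds with the weights `1` and `⟨x⟩ ^ N` imply bounds with the truncated weights, uniformly in
the level `l`. -/
theorem lintegral_min_mul_le_of_bddOp {Q : 𝓢(W, ℂ) → 𝓢(V, ℂ)}
    (hadd : ∀ u v, Q (u + v) = Q u + Q v) {N : ℝ} {C : ℝ≥0∞}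
    (h0 : ∀ u, wEnergy 0 (Q u) ≤ C * wEnergy 0 u)
    (hN : ∀ u, wEnergy N (Q u) ≤ C * wEnergy N u) {l : ℝ} (hl : 0 < l) (u : 𝓢(W, ℂ)) :
    ∫⁻ z, ENNReal.ofReal (min ((1 + ‖z‖ ^ 2) ^ N) l) * ‖Q u z‖ₑ ^ 2 ≤
      2 * C * ∫⁻ x, ENNReal.ofReal (min ((1 + ‖x‖ ^ 2) ^ N) l) * ‖u x‖ₑ ^ 2 := by
  have hg := hasTemperateGrowth_weightCut (W := W) N hl
  set u₁ := SchwartzMap.smulLeftCLM ℂ (fun x : W => (weightCut N l x : ℂ)) u with hu₁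
  have e1 : ∀ x, ‖u₁ x‖ₑ ^ 2 = ENNReal.ofReal (weightCut N l x ^ 2) * ‖u x‖ₑ ^ 2 := fun x => by
    rw [hu₁, smulLeftCLM_apply_apply hg, smul_eq_mul, enorm_mul, mul_pow]
    congr 1
    rw [← ofReal_norm, ← ENNReal.ofReal_pow (norm_nonneg _), Complex.norm_real, Real.norm_eq_abs,
      sq_abs]
  have e2 : ∀ x, ‖(u - u₁) x‖ₑ ^ 2 = ENNReal.ofReal ((1 - weightCut N l x) ^ 2) * ‖u x‖ₑ ^ 2 :=
    fun x => by
    rw [_root_.sub_apply, hu₁, smulLeftCLM_apply_apply hg, smul_eq_mul, ← one_sub_mul, enorm_mul,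
      mul_pow, ← Complex.ofReal_one, ← Complex.ofReal_sub]
    congr 1
    rw [← ofReal_norm, ← ENNReal.ofReal_pow (norm_nonneg _), Complex.norm_real, Real.norm_eq_abs,
      sq_abs]
  have hQ : Q u = Q u₁ + Q (u - u₁) := by rw [← hadd, add_sub_cancel]
  calc ∫⁻ z, ENNReal.ofReal (min ((1 + ‖z‖ ^ 2) ^ N) l) * ‖Q u z‖ₑ ^ 2
      ≤ ∫⁻ z, 2 * (bracketSq N z * ‖Q u₁ z‖ₑ ^ 2 + ENNReal.ofReal l *
          (bracketSq 0 z * ‖Q (u - u₁) z‖ₑ ^ 2)) := by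
        refine lintegral_mono fun z => ?_
        rw [hQ, _root_.add_apply]
        calc _ ≤ ENNReal.ofReal (min ((1 + ‖z‖ ^ 2) ^ N) l) *
              (2 * (‖Q u₁ z‖ₑ ^ 2 + ‖Q (u - u₁) z‖ₑ ^ 2)) := by
              gcongr; exact enorm_add_sq_le _ _
          _ = 2 * (ENNReal.ofReal (min ((1 + ‖z‖ ^ 2) ^ N) l) * ‖Q u₁ z‖ₑ ^ 2 +
              ENNReal.ofReal (min ((1 + ‖z‖ ^ 2) ^ N) l) * ‖Q (u - u₁) z‖ₑ ^ 2) := by ring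
          _ ≤ _ := by
            rw [bracketSq_zero, one_mul, bracketSq]
            gcongr
            · exact min_le_left _ _
            · exact min_le_right _ _
    _ = 2 * (wEnergy N (Q u₁) + ENNReal.ofReal l * wEnergy 0 (Q (u - u₁))) := by
        rw [lintegral_const_mul' _ _ (by norm_num),
          lintegral_add_left (measurable_wEnergy N (Q u₁).continuous),
          lintegral_const_mul' _ _ (by finiteness)]
        rfl
    _ ≤ 2 * (C * wEnergy N u₁ + ENNReal.ofReal l * (C * wEnergy 0 (u - u₁ : 𝓢(W, ℂ)))) := by
        gcongr
        · exact hN _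
        · exact h0 _
    _ = 2 * C * ∫⁻ x, (bracketSq N x * ‖u₁ x‖ₑ ^ 2 + ENNReal.ofReal l *
          (bracketSq 0 x * ‖(u - u₁) x‖ₑ ^ 2)) := by
        rw [lintegral_add_left (measurable_wEnergy N u₁.continuous),
          lintegral_const_mul' _ _ (by finiteness), wEnergy, wEnergy]
        ring
    _ ≤ _ := by
        gcongr with x
        rw [e1, e2, bracketSq_zero, one_mul, bracketSq, ← mul_assoc, ← mul_assoc, ← add_mul,
          ← ENNReal.ofReal_mul (by positivity), ← ENNReal.ofReal_mul hl.le,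
          ← ENNReal.ofReal_add (by positivity) (by positivity)]
        gcongr
        exact weightCut_mul_le hl x

/-- The energy with an intermediate weight is an integral over `l` of energies with the truncated
weights. -/
theorem lintegral_lintegral_min {X : Type*} [NormedAddCommGroup X] [InnerProductSpace ℝ X]
    [FiniteDimensional ℝ X] [MeasurableSpace X] [BorelSpace X] {N a : ℝ} (h0 : 0 < a)
    (h1 : a < N) (u : 𝓢(X, ℂ)) :
    ∫⁻ l in Set.Ioi (0 : ℝ), ENNReal.ofReal (l ^ (a / N - 2)) *
      (∫⁻ x, ENNReal.ofReal (min ((1 + ‖x‖ ^ 2) ^ N) l) * ‖u x‖ₑ ^ 2) =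
      ENNReal.ofReal (1 / (a / N) + 1 / (1 - a / N)) * wEnergy a u := by
  have hN : 0 < N := h0.trans h1
  have hm : Measurable fun p : ℝ × X =>
      ENNReal.ofReal (min ((1 + ‖p.2‖ ^ 2) ^ N) p.1) * ‖u p.2‖ₑ ^ 2 := by
    have := u.continuous.measurable
    fun_prop
  have hm' : Measurable fun p : ℝ × X => ENNReal.ofReal (p.1 ^ (a / N - 2)) *
      (ENNReal.ofReal (min ((1 + ‖p.2‖ ^ 2) ^ N) p.1) * ‖u p.2‖ₑ ^ 2) := by
    have := u.continuous.measurable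
    fun_prop
  simp_rw [← lintegral_const_mul' _ _ ENNReal.ofReal_ne_top]
  rw [lintegral_lintegral_swap hm'.aemeasurable, wEnergy,
    ← lintegral_const_mul' _ _ (by finiteness)]
  refine lintegral_congr fun x => ?_
  have hX : (0 : ℝ) < (1 + ‖x‖ ^ 2) ^ N := by positivity
  have ha : ((1 + ‖x‖ ^ 2) ^ N) ^ (a / N) = (1 + ‖x‖ ^ 2) ^ a := by
    rw [← Real.rpow_mul (by positivity), mul_div_cancel₀ _ hN.ne']
  have := lintegral_min_mul_rpow (div_pos h0 hN) ((div_lt_one hN).2 h1) hX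
  have hθ : 0 < 1 - a / N := by linarith [(div_lt_one hN).2 h1]
  rw [ha, ENNReal.ofReal_mul (by positivity)] at this
  rw [bracketSq, ← mul_assoc, ← this, ← lintegral_mul_const' _ _ (by finiteness)]
  refine setLIntegral_congr_fun measurableSet_Ioi fun l hl => ?_
  have hl' : (0 : ℝ) < l := hl
  rw [ENNReal.ofReal_mul (by positivity)]
  ring

/-- Interpolation of weighted bounds between the weights `1` and `⟨x⟩ ^ N`: the bounds with the
truncated weights are integrated over the level `l`. -/
theorem BddOp.interpolate {Q : 𝓢(W, ℂ) → 𝓢(V, ℂ)} (hadd : ∀ u v, Q (u + v) = Q u + Q v)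
    {N a : ℝ} (h0 : BddOp 0 0 Q) (hN : BddOp N N Q) (ha : 0 < a) (haN : a < N) : BddOp a a Q := by
  obtain ⟨C₀, hC₀, h0⟩ := h0
  obtain ⟨C₁, hC₁, hN⟩ := hN
  have hN0 : 0 < N := ha.trans haN
  have hθ : 0 < 1 - a / N := by linarith [(div_lt_one hN0).2 haN]
  have hθ' : 0 < a / N := div_pos ha hN0
  have h := fun (l : ℝ) (hl : l ∈ Set.Ioi (0 : ℝ)) (u : 𝓢(W, ℂ)) =>
    lintegral_min_mul_le_of_bddOp hadd (C := C₀ + C₁)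
      (fun u => (h0 u).trans (mul_le_mul_left le_self_add _))
      (fun u => (hN u).trans (mul_le_mul_left le_add_self _)) hl u
  refine ⟨2 * (C₀ + C₁), by finiteness, fun u => ?_⟩
  have hc : ENNReal.ofReal (1 / (a / N) + 1 / (1 - a / N)) ≠ 0 :=
    (ENNReal.ofReal_pos.2 (by positivity)).ne'
  rw [← ENNReal.mul_le_mul_iff_right hc ENNReal.ofReal_ne_top, mul_left_comm,
    ← lintegral_lintegral_min ha haN, ← lintegral_lintegral_min ha haN,
    ← lintegral_const_mul' _ _ (by finiteness)]
  refine setLIntegral_mono' measurableSet_Ioi fun l hl => ?_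
  rw [mul_left_comm]
  exact mul_le_mul_right (h l hl u) _

end Interpolation

/-! ### Averages over rotations -/

section Rotation

variable {E : Type} [NormedAddCommGroup E] [InnerProductSpace ℝ E] [FiniteDimensional ℝ E]
  [MeasurableSpace E] [BorelSpace E] [CompleteSpace E]

instance : CompactSpace (unitary (E →L[ℝ] E)) := by
  refine isCompact_iff_compactSpace.1 (Metric.isCompact_of_isClosed_isBounded isClosed_unitary
    (isBounded_iff_forall_norm_le.2 ⟨1, fun A hA => ?_⟩))
  refine ContinuousLinearMap.opNorm_le_bound _ zero_le_one fun x => ?_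
  rw [one_mul]
  exact ((Unitary.linearIsometryEquiv (⟨A, hA⟩ : unitary (E →L[ℝ] E))).norm_map x).le

/-- The isometry `(x, y) ↦ (x, A⁻¹ y)`. -/
def rotIso (A : unitary (E →L[ℝ] E)) : WithLp 2 (E × E) ≃ₗᵢ[ℝ] WithLp 2 (E × E) :=
  LinearIsometryEquiv.withLpProdCongr 2 (LinearIsometryEquiv.refl ℝ E)
    (Unitary.linearIsometryEquiv A⁻¹)

theorem rotIso_apply (A : unitary (E →L[ℝ] E)) (z : WithLp 2 (E × E)) :
    rotIso A z = WithLp.toLp 2 (z.fst, ((A⁻¹ : unitary (E →L[ℝ] E)) : E →L[ℝ] E) z.snd) := rfl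

/-- The matrix coefficients of a rotation. -/
def rotCoeff (l : Fin (Module.finrank ℝ E) × Fin (Module.finrank ℝ E)) :
    C(unitary (E →L[ℝ] E), ℝ) :=
  ⟨fun A => inner ℝ ((A : E →L[ℝ] E) (stdOrthonormalBasis ℝ E l.1)) (stdOrthonormalBasis ℝ E l.2),
    by
      have : Continuous fun A : unitary (E →L[ℝ] E) => (A : E →L[ℝ] E) := continuous_subtype_val
      fun_prop⟩

/-- The linear map `(x, y) ↦ (x, 0)`. -/
def fstMap (E : Type) [NormedAddCommGroup E] [InnerProductSpace ℝ E] :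
    WithLp 2 (E × E) →L[ℝ] WithLp 2 (E × E) :=
  (WithLp.prodContinuousLinearEquiv 2 ℝ E E).symm.toContinuousLinearMap ∘L
    ContinuousLinearMap.inl ℝ E E ∘L ContinuousLinearMap.fst ℝ E E ∘L
    (WithLp.prodContinuousLinearEquiv 2 ℝ E E).toContinuousLinearMap

/-- The linear map `(x, y) ↦ (0, ⟨v, y⟩ u)`. -/
def rankOneMap (u v : E) : WithLp 2 (E × E) →L[ℝ] WithLp 2 (E × E) :=
  (WithLp.prodContinuousLinearEquiv 2 ℝ E E).symm.toContinuousLinearMap ∘L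
    ContinuousLinearMap.inr ℝ E E ∘L (innerSL ℝ v).smulRight u ∘L ContinuousLinearMap.snd ℝ E E ∘L
    (WithLp.prodContinuousLinearEquiv 2 ℝ E E).toContinuousLinearMap

theorem rotIso_eq_sum (A : unitary (E →L[ℝ] E)) :
    ((rotIso A).toContinuousLinearEquiv : WithLp 2 (E × E) →L[ℝ] WithLp 2 (E × E)) =
      fstMap E + ∑ l, rotCoeff l A • rankOneMap (stdOrthonormalBasis ℝ E l.1)
        (stdOrthonormalBasis ℝ E l.2) := by
  refine ContinuousLinearMap.ext fun z => ?_
  rw [_root_.add_apply, _root_.sum_apply]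
  simp only [_root_.smul_apply]
  have h1 : ∀ u v : E, rankOneMap u v z =
      ((WithLp.prodContinuousLinearEquiv 2 ℝ E E).symm.toContinuousLinearMap ∘L
    ContinuousLinearMap.inr ℝ E E) (inner ℝ v z.snd • u) := fun u v => rfl
  simp only [h1, ← map_smul, ← map_sum]
  have h2 : ∑ l : Fin (Module.finrank ℝ E) × Fin (Module.finrank ℝ E), rotCoeff l A •
      (inner ℝ (stdOrthonormalBasis ℝ E l.2) z.snd • stdOrthonormalBasis ℝ E l.1) =
      ((A⁻¹ : unitary (E →L[ℝ] E)) : E →L[ℝ] E) z.snd := by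
    rw [← (stdOrthonormalBasis ℝ E).sum_repr' (((A⁻¹ : unitary (E →L[ℝ] E)) : E →L[ℝ] E) z.snd),
      Fintype.sum_prod_type]
    refine Finset.sum_congr rfl fun k _ => ?_
    simp only [smul_smul, ← Finset.sum_smul]
    congr 1
    have h3 : ((A⁻¹ : unitary (E →L[ℝ] E)) : E →L[ℝ] E) =
      ContinuousLinearMap.adjoint (A : E →L[ℝ] E) := rfl
    rw [h3, ContinuousLinearMap.adjoint_inner_right,
      ← (stdOrthonormalBasis ℝ E).sum_inner_mul_inner]
    rfl
  rw [h2]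
  change WithLp.toLp 2 _ = WithLp.toLp 2 _ + WithLp.toLp 2 _
  rw [← WithLp.toLp_add]
  congr 1
  ext
  · change z.fst = z.fst + 0
    rw [add_zero]
  · change _ = (0 : E) + _
    rw [zero_add]
    rfl

/-- The Haar measure on the orthogonal group. -/
def rotMeasure (E : Type) [NormedAddCommGroup E] [InnerProductSpace ℝ E] [FiniteDimensional ℝ E]
    [CompleteSpace E] : Measure (unitary (E →L[ℝ] E)) := Measure.haar

instance : (rotMeasure E).IsHaarMeasure := inferInstanceAs (Measure.haar).IsHaarMeasure

/-- The average of `Ψ(x, A⁻¹ y)` over all rotations `A`, as a Schwartz function of `(x, y)`. -/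
def rotMeanS (Ψ : 𝓢(WithLp 2 (E × E), ℂ)) : 𝓢(WithLp 2 (E × E), ℂ) :=
  linMeanS (rotMeasure E) (fun A => rotIso_eq_sum A) (fun A z => (rotIso A).norm_map z) 1 Ψ

theorem rotMeanS_apply (Ψ : 𝓢(WithLp 2 (E × E), ℂ)) (z : WithLp 2 (E × E)) :
    rotMeanS Ψ z = ∫ A, Ψ (rotIso A z) ∂(rotMeasure E) := by
  change ∫ A, ((1 : C(unitary (E →L[ℝ] E), ℝ)) A) • Ψ (rotIso A z) ∂(rotMeasure E) = _
  simp

theorem continuous_rotIso : Continuous fun p : unitary (E →L[ℝ] E) × WithLp 2 (E × E) =>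
    rotIso p.1 p.2 := by
  have h : ∀ p : unitary (E →L[ℝ] E) × WithLp 2 (E × E), rotIso p.1 p.2 =
      (fstMap E + ∑ l, rotCoeff l p.1 • rankOneMap (stdOrthonormalBasis ℝ E l.1)
        (stdOrthonormalBasis ℝ E l.2)) p.2 := fun p => by
    rw [← rotIso_eq_sum]; rfl
  simp only [h, _root_.add_apply, _root_.sum_apply, _root_.smul_apply]
  fun_prop

theorem rotMeanS_rotIso (Ψ : 𝓢(WithLp 2 (E × E), ℂ)) (B : unitary (E →L[ℝ] E))
    (z : WithLp 2 (E × E)) : rotMeanS Ψ (rotIso B z) = rotMeanS Ψ z := by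
  rw [rotMeanS_apply, rotMeanS_apply,
    ← integral_mul_left_eq_self (fun A => Ψ (rotIso A z)) B]
  refine integral_congr_ae (Filter.Eventually.of_forall fun A => ?_)
  have h : rotIso (B * A) z = rotIso A (rotIso B z) := by
    rw [rotIso_apply, mul_inv_rev]; rfl
  simp only [h]

theorem rotIso_ray (A : unitary (E →L[ℝ] E)) (θ : E) (z : WithLp 2 (E × ℝ)) :
    rotIso A (ray E θ z) = ray E (Unitary.linearIsometryEquiv A⁻¹ θ) z := by
  rw [ray_eq, ray_eq, rotIso_apply]
  congr 2
  exact map_smul _ _ _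

/-- The group of rotations acts transitively on the unit sphere. -/
theorem exists_rotIso_ray (θ θ' : sphere (0 : E) 1) :
    ∃ A : unitary (E →L[ℝ] E), ∀ z, rotIso A (ray E (θ : E) z) = ray E (θ' : E) z := by
  have h : ‖(θ : E)‖ = ‖(θ' : E)‖ := by simp
  refine ⟨(Unitary.linearIsometryEquiv.symm (ℝ ∙ ((θ : E) - θ'))ᗮ.reflection)⁻¹, fun z => ?_⟩
  rw [rotIso_ray, inv_inv, MulEquiv.apply_symm_apply, Submodule.reflection_sub h]

theorem rotMeanS_ray (Ψ : 𝓢(WithLp 2 (E × E), ℂ)) (θ θ' : sphere (0 : E) 1)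
    (z : WithLp 2 (E × ℝ)) : rotMeanS Ψ (ray E (θ : E) z) = rotMeanS Ψ (ray E (θ' : E) z) := by
  obtain ⟨A, hA⟩ := exists_rotIso_ray θ θ'
  rw [← hA, rotMeanS_rotIso]

theorem sphMeanS_one_apply (Φ : 𝓢(WithLp 2 (E × E), ℂ)) (z : WithLp 2 (E × ℝ)) :
    sphMeanS 1 Φ z =
      ∫ θ : sphere (0 : E) 1, Φ (ray E (θ : E) z) ∂(volume : Measure E).toSphere := by
  simp [sphMeanS_apply]

/-- Spherical means are invariant under isometries of the sphere. -/
theorem integral_ray_linearIsometryEquiv (Φ : 𝓢(WithLp 2 (E × E), ℂ)) (A : E ≃ₗᵢ[ℝ] E)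
    (z : WithLp 2 (E × ℝ)) :
    ∫ θ : sphere (0 : E) 1, Φ (ray E (A θ) z) ∂(volume : Measure E).toSphere =
      ∫ θ : sphere (0 : E) 1, Φ (ray E (θ : E) z) ∂(volume : Measure E).toSphere := by
  have hmp := measurePreserving_sphere A
  conv_rhs => rw [← hmp.map_eq]
  have hc : Continuous fun θ : sphere (0 : E) 1 => Φ (ray E (θ : E) z) :=
    Φ.continuous.comp (continuous_ray_left z)
  rw [integral_map hmp.measurable.aemeasurable hc.aestronglyMeasurable]

theorem integral_rotIso_ray (Φ : 𝓢(WithLp 2 (E × E), ℂ)) (A : unitary (E →L[ℝ] E))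
    (z : WithLp 2 (E × ℝ)) :
    ∫ θ : sphere (0 : E) 1, Φ (rotIso A (ray E (θ : E) z)) ∂(volume : Measure E).toSphere =
      ∫ θ : sphere (0 : E) 1, Φ (ray E (θ : E) z) ∂(volume : Measure E).toSphere := by
  rw [← integral_ray_linearIsometryEquiv Φ (Unitary.linearIsometryEquiv A⁻¹)]
  simp only [rotIso_ray]

/-- Averaging over rotations does not change the spherical means, up to a constant. -/
theorem sphMeanS_rotMeanS (Φ : 𝓢(WithLp 2 (E × E), ℂ)) :
    sphMeanS 1 (rotMeanS Φ) = ((rotMeasure E).real Set.univ : ℂ) • sphMeanS 1 Φ := by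
  ext z
  rw [_root_.smul_apply, sphMeanS_one_apply, sphMeanS_one_apply]
  simp only [rotMeanS_apply]
  rw [integral_integral_swap]
  · simp [integral_rotIso_ray]
  · refine Continuous.integrable_of_compactSpace _ ?_
    refine Φ.continuous.comp (continuous_rotIso.comp (f := fun p :
      sphere (0 : E) 1 × unitary (E →L[ℝ] E) => (p.2, ray E (p.1 : E) z)) ?_)
    exact continuous_snd.prodMk ((continuous_ray_left z).comp continuous_fst)

/-- The group of rotations is compact and every rotation preserves the integral, so that the average
over rotations may be exchanged with the Fourier transform. -/
theorem integrable_comp_rotIso (Ψ : 𝓢(WithLp 2 (E × E), ℂ)) :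
    Integrable (fun p : unitary (E →L[ℝ] E) × WithLp 2 (E × E) => Ψ (rotIso p.1 p.2))
      ((rotMeasure E).prod volume) := by
  have hc : Continuous fun p : unitary (E →L[ℝ] E) × WithLp 2 (E × E) => Ψ (rotIso p.1 p.2) :=
    Ψ.continuous.comp continuous_rotIso
  rw [integrable_prod_iff hc.aestronglyMeasurable]
  refine ⟨Filter.Eventually.of_forall fun A =>
    ((rotIso A).measurePreserving.integrable_comp_emb
      (rotIso A).toHomeomorph.measurableEmbedding).2 Ψ.integrable, ?_⟩
  have h : ∀ A : unitary (E →L[ℝ] E), ∫ z, ‖Ψ (rotIso A z)‖ = ∫ z, ‖Ψ z‖ := fun A =>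
    (rotIso A).measurePreserving.integral_comp (rotIso A).toHomeomorph.measurableEmbedding
      (fun z => ‖Ψ z‖)
  simp only [h]
  exact integrable_const _

theorem integral_integral_mul_swap {α β : Type*} [MeasurableSpace α] [MeasurableSpace β]
    {μ : Measure α} {ν : Measure β} [SFinite μ] [SFinite ν] {F : α → β → ℂ}
    (hF : Integrable (fun p : α × β => F p.1 p.2) (μ.prod ν)) {k : β → ℂ}
    (hk : AEStronglyMeasurable k ν) (hk1 : ∀ z, ‖k z‖ ≤ 1) :
    ∫ A, ∫ z, k z * F A z ∂ν ∂μ = ∫ z, ∫ A, k z * F A z ∂μ ∂ν :=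
  integral_integral_swap (hF.bdd_mul (c := 1) hk.comp_snd
    (Filter.Eventually.of_forall fun p => hk1 p.2))

/-- The Fourier transform commutes with rotations, hence with averages over them. -/
theorem fourier_rotMeanS (Ψ : 𝓢(WithLp 2 (E × E), ℂ)) :
    𝓕 (rotMeanS Ψ) = rotMeanS (𝓕 Ψ) := by
  ext ζ
  have h1 : ∀ A : unitary (E →L[ℝ] E), (𝓕 Ψ : 𝓢(WithLp 2 (E × E), ℂ)) (rotIso A ζ) =
      ∫ z, (Real.fourierChar (-inner ℝ z ζ) : ℂ) * Ψ (rotIso A z) := fun A => by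
    rw [SchwartzMap.fourier_coe, ← Real.fourier_comp_linearIsometry, Real.fourier_eq]
    rfl
  have h2 : (𝓕 (rotMeanS Ψ) : 𝓢(WithLp 2 (E × E), ℂ)) ζ =
      ∫ z, ∫ A, (Real.fourierChar (-inner ℝ z ζ) : ℂ) * Ψ (rotIso A z) ∂(rotMeasure E) := by
    rw [SchwartzMap.fourier_coe, Real.fourier_eq]
    refine integral_congr_ae (Filter.Eventually.of_forall fun z => ?_)
    beta_reduce
    rw [integral_const_mul, rotMeanS_apply]
    rfl
  rw [rotMeanS_apply, h2]
  simp only [h1]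
  refine (integral_integral_mul_swap (integrable_comp_rotIso Ψ) ?_ fun z => ?_).symm
  · exact (continuous_subtype_val.comp (Real.continuous_fourierChar.comp
      (continuous_id.inner continuous_const).neg)).aestronglyMeasurable
  · exact (Circle.norm_coe _).le

/-- The weighted norm of an average over rotations is a weighted norm of the spherical means: the
average is constant on the spheres `y = t θ`, where it is a multiple of the spherical mean. -/
theorem wEnergy_rotMeanS [Nontrivial E] (a : ℝ) :
    ∃ C : ℝ≥0∞, C < ∞ ∧ ∀ Ψ : 𝓢(WithLp 2 (E × E), ℂ), wEnergy a (rotMeanS Ψ) ≤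
      C * ∫⁻ z, polarWeight z * (bracketSq a z * ‖sphMeanS 1 Ψ z‖ₑ ^ 2) := by
  set σ := (volume : Measure E).toSphere
  set κ : ℝ := (rotMeasure E).real Set.univ
  have hσ : σ Set.univ ≠ 0 := by
    rw [Measure.toSphere_apply_univ]
    exact mul_ne_zero (by exact_mod_cast Module.finrank_pos.ne') (measure_ball_pos _ _ one_pos).ne'
  have hσ' : σ Set.univ ≠ ∞ := measure_ne_top _ _
  have hC : σ Set.univ * (‖(κ : ℂ)‖ₑ / σ Set.univ) ^ 2 < ∞ :=
    ENNReal.mul_lt_top hσ'.lt_top (ENNReal.pow_lt_top (ENNReal.div_lt_top (by finiteness) hσ))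
  refine ⟨σ Set.univ * (‖(κ : ℂ)‖ₑ / σ Set.univ) ^ 2, hC, fun Ψ => ?_⟩
  have h1 : ∀ (z : WithLp 2 (E × ℝ)) (θ : sphere (0 : E) 1),
      ‖rotMeanS Ψ (ray E (θ : E) z)‖ₑ ^ 2 =
        (‖(κ : ℂ)‖ₑ / σ Set.univ) ^ 2 * ‖sphMeanS 1 Ψ z‖ₑ ^ 2 := fun z θ => by
    have h2 : sphMeanS 1 (rotMeanS Ψ) z = (σ.real Set.univ : ℂ) * rotMeanS Ψ (ray E (θ : E) z) := by
      rw [sphMeanS_one_apply]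
      simp only [rotMeanS_ray Ψ _ θ]
      simp [σ]
    rw [sphMeanS_rotMeanS, _root_.smul_apply, smul_eq_mul] at h2
    have h3 := congrArg (‖·‖ₑ) h2
    simp only [enorm_mul] at h3
    have h4 : ‖(σ.real Set.univ : ℂ)‖ₑ = σ Set.univ := by
      rw [← ofReal_norm, Complex.norm_real, Real.norm_of_nonneg measureReal_nonneg,
        ofReal_measureReal]
    rw [h4] at h3
    rw [← mul_pow, ENNReal.div_eq_inv_mul, mul_assoc, h3, ← mul_assoc,
      ENNReal.inv_mul_cancel hσ hσ',
      one_mul]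
  have h5 : ∀ z : WithLp 2 (E × ℝ), ∫⁻ θ : sphere (0 : E) 1, bracketSq a (ray E (θ : E) z) *
      ‖rotMeanS Ψ (ray E (θ : E) z)‖ₑ ^ 2 ∂σ = σ Set.univ * ((‖(κ : ℂ)‖ₑ / σ Set.univ) ^ 2 *
        (bracketSq a z * ‖sphMeanS 1 Ψ z‖ₑ ^ 2)) := fun z => by
    simp only [h1, bracketSq, norm_ray]
    rw [lintegral_const]
    ring
  have h6 := lintegral_ray (measurable_wEnergy a (rotMeanS Ψ).continuous)
  simp only [σ, h5] at h6
  calc wEnergy a (rotMeanS Ψ) ≤ 2 * wEnergy a (rotMeanS Ψ) := by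
        rw [two_mul]; exact le_self_add
    _ = _ := by
        rw [wEnergy, ← h6, ← lintegral_const_mul' _ _ hC.ne]
        refine lintegral_congr fun z => ?_
        ring

end Rotation

/-! ### Weighted bounds for the spherical mean operator of the wave equation -/

section SineOperator

variable {E : Type} [NormedAddCommGroup E] [InnerProductSpace ℝ E] [FiniteDimensional ℝ E]
  [MeasurableSpace E] [BorelSpace E]

/-- The unit vector in the direction of time. -/
def timeVec (E : Type) [NormedAddCommGroup E] [InnerProductSpace ℝ E] : WithLp 2 (E × ℝ) :=
  WithLp.toLp 2 (0, 1)

theorem norm_timeVec : ‖timeVec E‖ = 1 := by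
  rw [timeVec, WithLp.prod_norm_eq_of_L2]
  simp

theorem inner_timeVec (z : WithLp 2 (E × ℝ)) : inner ℝ z (timeVec E) = z.snd := by
  rw [timeVec, WithLp.prod_inner_apply]
  simp

/-- By the Cauchy-Schwarz inequality on the sphere, since `|t| ^ (2 m + 2)` is the weight of polar
coordinates. -/
theorem bddOp_sphMeanS [Nontrivial E] {m : ℕ} (hE : Module.finrank ℝ E = 2 * m + 3)
    (c : C(sphere (0 : E) 1, ℝ)) :
    BddOp 0 0 (fun Φ : 𝓢(WithLp 2 (E × E), ℂ) =>
      mulInnerPow (timeVec E) (m + 1) (sphMeanS c Φ)) := by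
  set σ := (volume : Measure E).toSphere
  have hc : (∫⁻ θ, ‖(c θ : ℂ)‖ₑ ^ 2 ∂σ) < ∞ := by
    calc _ ≤ ∫⁻ _, ENNReal.ofReal ‖c‖ ^ 2 ∂σ := by
          gcongr with θ
          rw [← ofReal_norm, Complex.norm_real]
          exact ENNReal.ofReal_le_ofReal (c.norm_coe_le_norm θ)
      _ < ∞ := by rw [lintegral_const]; finiteness
  refine ⟨(∫⁻ θ, ‖(c θ : ℂ)‖ₑ ^ 2 ∂σ) * 2, ENNReal.mul_lt_top hc (by finiteness), fun Φ => ?_⟩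
  have h1 : ∀ z, ‖mulInnerPow (timeVec E) (m + 1) (sphMeanS c Φ) z‖ₑ ^ 2 ≤
      (∫⁻ θ, ‖(c θ : ℂ)‖ₑ ^ 2 ∂σ) *
        (polarWeight z * ∫⁻ θ : sphere (0 : E) 1, ‖Φ (ray E (θ : E) z)‖ₑ ^ 2 ∂σ) := fun z => by
    rw [mulInnerPow_apply, inner_timeVec, enorm_mul, mul_pow, mul_left_comm]
    have h2 : ‖((z.snd : ℂ)) ^ (m + 1)‖ₑ ^ 2 = polarWeight z := by
      rw [polarWeight, hE, ← ofReal_norm, ← ENNReal.ofReal_pow (norm_nonneg _), norm_pow,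
        Complex.norm_real, Real.norm_eq_abs, ← pow_mul]
      congr 2
      omega
    rw [h2]
    gcongr
    refine le_trans ?_ (sq_lintegral_mul_le σ ?_ ?_)
    · gcongr
      rw [sphMeanS_apply]
      refine (enorm_integral_le_lintegral_enorm _).trans (lintegral_mono fun θ => ?_)
      rw [enorm_mul]
    · exact (Complex.continuous_ofReal.comp c.continuous).enorm.measurable.aemeasurable
    · exact (Φ.continuous.comp (continuous_ray_left z)).enorm.measurable.aemeasurable
  rw [wEnergy_zero_eq, wEnergy_zero_eq, mul_assoc, ← lintegral_ray (h := fun z => ‖Φ z‖ₑ ^ 2)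
    (by have := Φ.continuous.measurable; fun_prop), ← lintegral_const_mul' _ _ hc.ne]
  exact lintegral_mono h1

/-- The Fourier multiplier with symbol `τ ^ (2 m + 1) ⟨(ξ, τ)⟩ ^ (-m)`, applied to the function of
`(x, t)` whose Fourier transform is the spherical mean of the Fourier transform of `Ψ`. -/
def waveMean (m : ℕ) (Ψ : 𝓢(WithLp 2 (E × E), ℂ)) : 𝓢(WithLp 2 (E × ℝ), ℂ) :=
  𝓕⁻ (mulInnerPow (timeVec E) (2 * m + 1)
    (SchwartzMap.smulLeftCLM ℂ (bracketSymbol (WithLp 2 (E × ℝ)) (-m)) (sphMeanS 1 (𝓕 Ψ))))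

theorem waveMean_add (m : ℕ) (Ψ Ψ' : 𝓢(WithLp 2 (E × E), ℂ)) :
    waveMean m (Ψ + Ψ') = waveMean m Ψ + waveMean m Ψ' := by
  simp only [waveMean, FourierTransform.fourier_add, sphMeanS_add, map_add,
    FourierTransform.fourierInv_add]

theorem waveMean_rotMeanS [CompleteSpace E] (m : ℕ) (Ψ : 𝓢(WithLp 2 (E × E), ℂ)) :
    waveMean m (rotMeanS Ψ) = ((rotMeasure E).real Set.univ : ℂ) • waveMean m Ψ := by
  simp only [waveMean, fourier_rotMeanS, sphMeanS_rotMeanS, map_smul,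
    FourierTransform.fourierInv_smul]

/-- The operator `waveMean` is bounded for the norms with weights of any order `a ≥ 0`. -/
theorem bddOp_waveMean [Nontrivial E] {m : ℕ} (hE : Module.finrank ℝ E = 2 * m + 3) {a : ℝ}
    (ha : 0 ≤ a) : BddOp a a (waveMean (E := E) m) := by
  have key : ∀ N : ℕ, BddOp (N : ℝ) N (waveMean (E := E) m) := fun N => by
    have := bddOp_meanOp (volume : Measure E).toSphere ray_eq_sum norm_ray (norm_timeVec (E := E))
      (bddOp_sphMeanS hE) N (2 * m + 1) le_rfl _ .base 1
    refine BddOp.mono this le_rfl ?_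
    have h : m + 1 - (2 * m + 1) = 0 := by omega
    simp [h]
  rcases ha.eq_or_lt with rfl | ha
  · simpa using key 0
  obtain ⟨N, hN⟩ := exists_nat_gt a
  exact BddOp.interpolate (waveMean_add m) (by simpa using key 0) (key N) ha hN

/-- The operator `waveMean` depends on the spherical means of its argument only, and is bounded in
terms of them: `Ψ` may be replaced by its average over rotations. -/
theorem exists_wEnergy_waveMean_le [Nontrivial E] [CompleteSpace E] {m : ℕ}
    (hE : Module.finrank ℝ E = 2 * m + 3) {a : ℝ} (ha : 0 ≤ a) :
    ∃ C : ℝ≥0∞, C < ∞ ∧ ∀ Ψ : 𝓢(WithLp 2 (E × E), ℂ), wEnergy a (waveMean m Ψ) ≤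
      C * ∫⁻ z, polarWeight z * (bracketSq a z * ‖sphMeanS 1 Ψ z‖ₑ ^ 2) := by
  obtain ⟨C, hC, h⟩ := bddOp_waveMean hE ha
  obtain ⟨D, hD, h'⟩ := wEnergy_rotMeanS (E := E) a
  set κ : ℂ := ((rotMeasure E).real Set.univ : ℂ) with hκ
  have hκ0 : κ ≠ 0 := by
    rw [hκ, Complex.ofReal_ne_zero]
    exact (ENNReal.toReal_pos (NeZero.ne _) (measure_ne_top _ _)).ne'
  refine ⟨‖κ⁻¹‖ₑ ^ 2 * (C * D), by finiteness, fun Ψ => ?_⟩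
  have h1 : ⇑(waveMean m Ψ) = fun z => κ⁻¹ * waveMean m (rotMeanS Ψ) z := by
    funext z
    rw [waveMean_rotMeanS, _root_.smul_apply, smul_eq_mul, inv_mul_cancel_left₀ hκ0]
  rw [h1, wEnergy_const_mul, mul_assoc, mul_assoc]
  exact mul_le_mul_right ((h _).trans (mul_le_mul_right (h' Ψ) _)) _

end SineOperator

/-! ### Products of Schwartz functions in complementary variables -/

section Product

variable {V F G : Type*} [NormedAddCommGroup V] [NormedSpace ℝ V] [NormedAddCommGroup F]
  [NormedSpace ℝ F] [NormedAddCommGroup G] [NormedSpace ℝ G]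

theorem norm_iteratedFDeriv_comp_clm_le (f : 𝓢(F, ℂ)) (p : V →L[ℝ] F) (n : ℕ) (z : V) :
    ‖iteratedFDeriv ℝ n (fun z => f (p z)) z‖ ≤ ‖p‖ ^ n * ‖iteratedFDeriv ℝ n f (p z)‖ := by
  have h : iteratedFDeriv ℝ n (fun z => f (p z)) z =
      (iteratedFDeriv ℝ n f (p z)).compContinuousLinearMap fun _ => p :=
    p.iteratedFDeriv_comp_right (f.smooth ⊤) z (by exact_mod_cast le_top)
  rw [h, mul_comm]
  exact (ContinuousMultilinearMap.norm_compContinuousLinearMap_le _ _).trans_eq (by simp)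

theorem exists_pow_mul_norm_iteratedFDeriv_mul_le (f : 𝓢(F, ℂ)) (g : 𝓢(G, ℂ)) (p : V →L[ℝ] F)
    (q : V →L[ℝ] G) (h : ∀ z, ‖z‖ ≤ ‖p z‖ + ‖q z‖) (k n : ℕ) :
    ∃ C, ∀ z, ‖z‖ ^ k * ‖iteratedFDeriv ℝ n (fun z => f (p z) * g (q z)) z‖ ≤ C := by
  have key : ∀ i j : ℕ, ∃ C, ∀ z, ‖z‖ ^ k * (‖iteratedFDeriv ℝ i (fun z => f (p z)) z‖ *
      ‖iteratedFDeriv ℝ j (fun z => g (q z)) z‖) ≤ C := fun i j => by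
    refine ⟨2 ^ (k - 1) * (‖p‖ ^ i * ‖q‖ ^ j *
      (SchwartzMap.seminorm ℝ k i f * SchwartzMap.seminorm ℝ 0 j g +
        SchwartzMap.seminorm ℝ 0 i f * SchwartzMap.seminorm ℝ k j g)), fun z => ?_⟩
    have h1 : ‖z‖ ^ k ≤ 2 ^ (k - 1) * (‖p z‖ ^ k + ‖q z‖ ^ k) :=
      (pow_le_pow_left₀ (norm_nonneg z) (h z) k).trans
        (add_pow_le (norm_nonneg _) (norm_nonneg _) k)
    calc _ ≤ 2 ^ (k - 1) * (‖p z‖ ^ k + ‖q z‖ ^ k) * ((‖p‖ ^ i * ‖iteratedFDeriv ℝ i f (p z)‖) *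
          (‖q‖ ^ j * ‖iteratedFDeriv ℝ j g (q z)‖)) := by
          gcongr
          · exact norm_iteratedFDeriv_comp_clm_le f p i z
          · exact norm_iteratedFDeriv_comp_clm_le g q j z
      _ = 2 ^ (k - 1) * (‖p‖ ^ i * ‖q‖ ^ j *
          ((‖p z‖ ^ k * ‖iteratedFDeriv ℝ i f (p z)‖) * ‖iteratedFDeriv ℝ j g (q z)‖ +
          ‖iteratedFDeriv ℝ i f (p z)‖ * (‖q z‖ ^ k * ‖iteratedFDeriv ℝ j g (q z)‖))) := by ring
      _ ≤ _ := by
          gcongr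
          · exact f.le_seminorm ℝ k i _
          · exact g.norm_iteratedFDeriv_le_seminorm ℝ j _
          · exact f.norm_iteratedFDeriv_le_seminorm ℝ i _
          · exact g.le_seminorm ℝ k j _
  choose C hC using key
  refine ⟨∑ i ∈ Finset.range (n + 1), (n.choose i : ℝ) * C i (n - i), fun z => ?_⟩
  have hf : ContDiff ℝ n fun z => f (p z) := (f.smooth n).comp p.contDiff
  have hg : ContDiff ℝ n fun z => g (q z) := (g.smooth n).comp q.contDiff
  calc _ ≤ ‖z‖ ^ k * ∑ i ∈ Finset.range (n + 1), (n.choose i : ℝ) *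
        ‖iteratedFDeriv ℝ i (fun z => f (p z)) z‖ *
        ‖iteratedFDeriv ℝ (n - i) (fun z => g (q z)) z‖ := by
        gcongr
        exact norm_iteratedFDeriv_mul_le hf hg z le_rfl
    _ = ∑ i ∈ Finset.range (n + 1), (n.choose i : ℝ) * (‖z‖ ^ k *
        (‖iteratedFDeriv ℝ i (fun z => f (p z)) z‖ *
        ‖iteratedFDeriv ℝ (n - i) (fun z => g (q z)) z‖)) := by
        rw [Finset.mul_sum]
        exact Finset.sum_congr rfl fun i _ => by ring
    _ ≤ _ := by
        gcongr with i
        exact hC i (n - i) z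

/-- The product `f(p z) g(q z)`, where the norm of `z` is controlled by those of `p z` and `q z`,
as a Schwartz function. -/
def productS (p : V →L[ℝ] F) (q : V →L[ℝ] G) (h : ∀ z, ‖z‖ ≤ ‖p z‖ + ‖q z‖) (f : 𝓢(F, ℂ))
    (g : 𝓢(G, ℂ)) : 𝓢(V, ℂ) where
  toFun z := f (p z) * g (q z)
  smooth' := ((f.smooth ⊤).comp p.contDiff).mul ((g.smooth ⊤).comp q.contDiff)
  decay' k n := exists_pow_mul_norm_iteratedFDeriv_mul_le f g p q h k n

end Product

/-! ### The function `f(x - y) g(x + y)` -/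

section DoublePoint

variable {E : Type} [NormedAddCommGroup E] [InnerProductSpace ℝ E] [FiniteDimensional ℝ E]
  [MeasurableSpace E] [BorelSpace E]

/-- The map `(x, y) ↦ ((x - y) / √2, (x + y) / √2)`. -/
def diagIsometry (E : Type) [NormedAddCommGroup E] [InnerProductSpace ℝ E]
    [FiniteDimensional ℝ E] : WithLp 2 (E × E) ≃ₗᵢ[ℝ] WithLp 2 (E × E) :=
  LinearIsometry.toLinearIsometryEquiv
    { toLinearMap := ((WithLp.prodContinuousLinearEquiv 2 ℝ E E).symm.toContinuousLinearMap ∘L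
        (((√2)⁻¹ • (ContinuousLinearMap.fst ℝ E E - ContinuousLinearMap.snd ℝ E E)).prod
          ((√2)⁻¹ • (ContinuousLinearMap.fst ℝ E E + ContinuousLinearMap.snd ℝ E E))) ∘L
        (WithLp.prodContinuousLinearEquiv 2 ℝ E E).toContinuousLinearMap).toLinearMap
      norm_map' := fun z => by
        have h1 : ∀ u v : E, ‖WithLp.toLp 2 (u, v)‖ = √(‖u‖ ^ 2 + ‖v‖ ^ 2) := fun u v =>
          WithLp.prod_norm_eq_of_L2 _
        change ‖WithLp.toLp 2 ((√2)⁻¹ • (z.fst - z.snd), (√2)⁻¹ • (z.fst + z.snd))‖ = ‖z‖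
        rw [h1, WithLp.prod_norm_eq_of_L2, norm_smul, norm_smul, mul_pow, mul_pow,
          Real.norm_of_nonneg (by positivity), inv_pow, Real.sq_sqrt (by norm_num)]
        congr 1
        have h := parallelogram_law_with_norm ℝ z.fst z.snd
        linarith } rfl

theorem diagIsometry_fst (z : WithLp 2 (E × E)) :
    (diagIsometry E z).fst = (√2)⁻¹ • (z.fst - z.snd) := rfl

theorem diagIsometry_snd (z : WithLp 2 (E × E)) :
    (diagIsometry E z).snd = (√2)⁻¹ • (z.fst + z.snd) := rfl

/-- The function `(x, y) ↦ f(x - y) g(x + y)`. -/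
def diagProduct (f g : 𝓢(E, ℂ)) : 𝓢(WithLp 2 (E × E), ℂ) :=
  productS
    ((ContinuousLinearMap.fst ℝ E E - ContinuousLinearMap.snd ℝ E E) ∘L
      (WithLp.prodContinuousLinearEquiv 2 ℝ E E).toContinuousLinearMap)
    ((ContinuousLinearMap.fst ℝ E E + ContinuousLinearMap.snd ℝ E E) ∘L
      (WithLp.prodContinuousLinearEquiv 2 ℝ E E).toContinuousLinearMap)
    (fun z => by
      change ‖z‖ ≤ ‖z.fst - z.snd‖ + ‖z.fst + z.snd‖
      refine abs_le_of_sq_le_sq' ?_ (by positivity) |>.2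
      rw [WithLp.prod_norm_sq_eq_of_L2]
      have h := parallelogram_law_with_norm ℝ z.fst z.snd
      nlinarith [norm_nonneg (z.fst - z.snd), norm_nonneg (z.fst + z.snd)]) f g

theorem diagProduct_apply (f g : 𝓢(E, ℂ)) (z : WithLp 2 (E × E)) :
    diagProduct f g z = f (z.fst - z.snd) * g (z.fst + z.snd) := rfl

theorem integral_withLp {h : WithLp 2 (E × E) → ℂ} :
    ∫ z, h z = ∫ p : E × E, h (WithLp.toLp 2 p) := by
  rw [← (WithLp.volume_preserving_toLp E E).integral_comp]
  exact (WithLp.homeomorphProd 2 E E).symm.measurableEmbedding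

theorem integral_fourierChar_mul_comp_sqrt_two (f : 𝓢(E, ℂ)) (ξ : E) :
    ∫ x, (Real.fourierChar (-inner ℝ x ((√2)⁻¹ • ξ)) : ℂ) * f (√2 • x) =
      ((|(√2 ^ Module.finrank ℝ E)⁻¹| : ℝ) : ℂ) *
        (𝓕 f : 𝓢(E, ℂ)) ((2 : ℝ)⁻¹ • ξ) := by
  have h2 : (√2)⁻¹ = √2 * (2 : ℝ)⁻¹ := by
    have := Real.mul_self_sqrt (show (0 : ℝ) ≤ 2 by norm_num)
    field_simp
    linarith
  have h := Measure.integral_comp_smul (volume : Measure E) (fun x =>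
    (Real.fourierChar (-inner ℝ x ((2 : ℝ)⁻¹ • ξ)) : ℂ) * f x) √2
  rw [SchwartzMap.fourier_coe, Real.fourier_eq]
  simp only [Circle.smul_def, smul_eq_mul]
  rw [Complex.real_smul] at h
  rw [← h]
  refine integral_congr_ae (Filter.Eventually.of_forall fun x => ?_)
  beta_reduce
  rw [h2, mul_smul, inner_smul_right, inner_smul_left, conj_trivial]

/-- The Fourier transform of `f(x - y) g(x + y)`. -/
theorem fourier_diagProduct (f g : 𝓢(E, ℂ)) (z : WithLp 2 (E × E)) :
    (𝓕 (diagProduct f g) : 𝓢(WithLp 2 (E × E), ℂ)) z =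
      ((|(√2 ^ Module.finrank ℝ E)⁻¹| : ℝ) : ℂ) ^ 2 *
        ((𝓕 f : 𝓢(E, ℂ)) ((2 : ℝ)⁻¹ • (z.fst - z.snd)) *
          (𝓕 g : 𝓢(E, ℂ)) ((2 : ℝ)⁻¹ • (z.fst + z.snd))) := by
  -- a tensor product of dilates of `f` and `g`, composed with an isometry
  set T : WithLp 2 (E × E) → ℂ := fun z => f (√2 • z.fst) * g (√2 • z.snd) with hT
  have h1 : ⇑(diagProduct f g) = T ∘ diagIsometry E := by
    funext z
    simp only [hT, Function.comp, diagIsometry_fst, diagIsometry_snd]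
    rw [smul_inv_smul₀ (by positivity), smul_inv_smul₀ (by positivity), diagProduct_apply]
  rw [SchwartzMap.fourier_coe, h1, Real.fourier_comp_linearIsometry, Real.fourier_eq]
  have h3 := integral_fourierChar_mul_comp_sqrt_two f (z.fst - z.snd)
  have h4 := integral_fourierChar_mul_comp_sqrt_two g (z.fst + z.snd)
  rw [sq, mul_mul_mul_comm, ← h3, ← h4, ← integral_prod_mul, integral_withLp,
    Measure.volume_eq_prod]
  refine integral_congr_ae (Filter.Eventually.of_forall fun p => ?_)
  beta_reduce
  rw [hT, WithLp.prod_inner_apply, neg_add, AddChar.map_add_eq_mul, Circle.smul_def, smul_eq_mul,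
    Circle.coe_mul]
  change _ * _ * (f (√2 • p.1) * g (√2 • p.2)) =
    (Real.fourierChar (-inner ℝ p.1 (diagIsometry E z).fst) : ℂ) * f (√2 • p.1) *
      ((Real.fourierChar (-inner ℝ p.2 (diagIsometry E z).snd) : ℂ) * g (√2 • p.2))
  exact mul_mul_mul_comm _ _ _ _

end DoublePoint

/-! ### The operator `A` in terms of spherical means -/

section PartialFourier

variable {E : Type} [NormedAddCommGroup E] [InnerProductSpace ℝ E] [FiniteDimensional ℝ E]
  [MeasurableSpace E] [BorelSpace E]

/-- Decay of a Schwartz function in terms of a lower bound `r` of the norm of its argument. -/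
theorem SchwartzMap.exists_norm_le_one_add_norm_rpow {V : Type*} [NormedAddCommGroup V]
    [NormedSpace ℝ V] (Φ : 𝓢(V, ℂ)) (k : ℕ) :
    ∃ C : ℝ, ∀ z (r : ℝ), 0 ≤ r → r ≤ ‖z‖ → ‖Φ z‖ ≤ C * (1 + r) ^ (-(k : ℝ)) := by
  refine ⟨2 ^ k * ((Finset.Iic (k, 0)).sup fun m => SchwartzMap.seminorm ℝ m.1 m.2) Φ,
    fun z r hr hz => ?_⟩
  rw [Real.rpow_neg (by positivity), Real.rpow_natCast, ← div_eq_mul_inv,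
    le_div_iff₀ (by positivity), mul_comm]
  have h := Φ.one_add_le_sup_seminorm_apply (𝕜 := ℝ) (m := (k, 0)) le_rfl le_rfl z
  rw [norm_iteratedFDeriv_zero] at h
  refine le_trans ?_ h
  gcongr

theorem norm_fst_le_withLp (x y : E) : ‖x‖ ≤ ‖WithLp.toLp 2 (x, y)‖ := by
  have h : ‖WithLp.toLp 2 (x, y)‖ = √(‖x‖ ^ 2 + ‖y‖ ^ 2) := WithLp.prod_norm_eq_of_L2 _
  rw [h]
  exact Real.le_sqrt_of_sq_le (by linarith [sq_nonneg ‖y‖])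

theorem norm_snd_le_withLp (x y : E) : ‖y‖ ≤ ‖WithLp.toLp 2 (x, y)‖ := by
  have h : ‖WithLp.toLp 2 (x, y)‖ = √(‖x‖ ^ 2 + ‖y‖ ^ 2) := WithLp.prod_norm_eq_of_L2 _
  rw [h]
  exact Real.le_sqrt_of_sq_le (by linarith [sq_nonneg ‖x‖])

theorem integrable_one_add_norm_finrank (C : ℝ) :
    Integrable fun y : E => C * (1 + ‖y‖) ^ (-((Module.finrank ℝ E + 1 : ℕ) : ℝ)) :=
  (integrable_one_add_norm (by push_cast; linarith)).const_mul C

theorem continuous_toLp_pair : Continuous fun p : E × E => (WithLp.toLp 2 p : WithLp 2 (E × E)) :=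
  (WithLp.homeomorphProd 2 E E).symm.continuous

theorem integrable_toLp_pair (Φ : 𝓢(WithLp 2 (E × E), ℂ)) :
    Integrable (fun p : E × E => Φ (WithLp.toLp 2 p)) (volume.prod volume) :=
  ((WithLp.volume_preserving_toLp E E).integrable_comp_emb
    (WithLp.homeomorphProd 2 E E).symm.measurableEmbedding).2 Φ.integrable

theorem continuous_fourierChar_coe {X : Type*} [TopologicalSpace X] {h : X → ℝ}
    (hh : Continuous h) : Continuous fun x => (Real.fourierChar (h x) : ℂ) :=
  continuous_subtype_val.comp (Real.continuous_fourierChar.comp hh)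

/-- The Fourier transform of `y ↦ Ψ(x, y)` at `ω`, as a function of `x`. -/
def partialFourier (Ψ : 𝓢(WithLp 2 (E × E), ℂ)) (ω x : E) : ℂ :=
  ∫ y, (Real.fourierChar (-inner ℝ y ω) : ℂ) * Ψ (WithLp.toLp 2 (x, y))

theorem continuous_partialFourier (Ψ : 𝓢(WithLp 2 (E × E), ℂ)) (ω : E) :
    Continuous (partialFourier Ψ ω) := by
  obtain ⟨C, hC⟩ := Ψ.exists_norm_le_one_add_norm_rpow (Module.finrank ℝ E + 1)
  refine continuous_of_dominated (fun x => ?_) (fun x => Filter.Eventually.of_forall fun y => ?_)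
    (integrable_one_add_norm_finrank C) (Filter.Eventually.of_forall fun y => ?_)
  · exact ((continuous_fourierChar_coe (by fun_prop)).mul
      (Ψ.continuous.comp (continuous_toLp_pair.comp (by fun_prop)))).aestronglyMeasurable
  · rw [norm_mul, Circle.norm_coe, one_mul]
    exact hC _ _ (norm_nonneg _) (norm_snd_le_withLp x y)
  · exact continuous_const.mul (Ψ.continuous.comp (continuous_toLp_pair.comp (by fun_prop)))

theorem integrable_char_mul_toLp_pair (Φ : 𝓢(WithLp 2 (E × E), ℂ)) {k : E × E → ℂ}
    (hk : Continuous k) {C : ℝ} (hk1 : ∀ p, ‖k p‖ ≤ C) :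
    Integrable (fun p : E × E => k p * Φ (WithLp.toLp 2 p)) (volume.prod volume) :=
  (integrable_toLp_pair Φ).bdd_mul (c := C) hk.aestronglyMeasurable
    (Filter.Eventually.of_forall hk1)

theorem integrable_partialFourier (Ψ : 𝓢(WithLp 2 (E × E), ℂ)) (ω : E) :
    Integrable (partialFourier Ψ ω) :=
  (integrable_char_mul_toLp_pair Ψ (k := fun p => (Real.fourierChar (-inner ℝ p.2 ω) : ℂ))
    (continuous_fourierChar_coe (by fun_prop)) (C := 1)
    (fun p => (Circle.norm_coe _).le)).integral_prod_left

theorem fourier_partialFourier (Ψ : 𝓢(WithLp 2 (E × E), ℂ)) (ω ζ : E) :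
    𝓕 (partialFourier Ψ ω) ζ = (𝓕 Ψ : 𝓢(WithLp 2 (E × E), ℂ)) (WithLp.toLp 2 (ζ, ω)) := by
  have hi := integrable_char_mul_toLp_pair Ψ
    (k := fun p => (Real.fourierChar (-inner ℝ p.1 ζ) : ℂ) * Real.fourierChar (-inner ℝ p.2 ω))
    ((continuous_fourierChar_coe (by fun_prop)).mul (continuous_fourierChar_coe (by fun_prop)))
    (C := 1) (fun p => by rw [norm_mul, Circle.norm_coe, Circle.norm_coe, one_mul])
  rw [SchwartzMap.fourier_coe, Real.fourier_eq, Real.fourier_eq, integral_withLp,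
    Measure.volume_eq_prod]
  have h1 : ∀ p : E × E, Real.fourierChar (-inner ℝ (WithLp.toLp 2 p) (WithLp.toLp 2 (ζ, ω))) •
      Ψ (WithLp.toLp 2 p) = (Real.fourierChar (-inner ℝ p.1 ζ) : ℂ) *
        Real.fourierChar (-inner ℝ p.2 ω) * Ψ (WithLp.toLp 2 p) := fun p => by
    rw [WithLp.prod_inner_apply, neg_add, AddChar.map_add_eq_mul, Circle.smul_def, smul_eq_mul,
      Circle.coe_mul]
  simp only [h1]
  rw [integral_prod _ hi]
  refine integral_congr_ae (Filter.Eventually.of_forall fun x => ?_)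
  beta_reduce
  rw [partialFourier, Circle.smul_def, smul_eq_mul, ← integral_const_mul]
  simp only [mul_assoc]

/-- Fourier inversion in the first variable. -/
theorem integral_fourierChar_mul_fourier (Ψ : 𝓢(WithLp 2 (E × E), ℂ)) (ω x : E) :
    ∫ ζ, (Real.fourierChar (inner ℝ ζ x) : ℂ) *
      (𝓕 Ψ : 𝓢(WithLp 2 (E × E), ℂ)) (WithLp.toLp 2 (ζ, ω)) = partialFourier Ψ ω x := by
  obtain ⟨C, hC⟩ := (𝓕 Ψ : 𝓢(WithLp 2 (E × E), ℂ)).exists_norm_le_one_add_norm_rpow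
    (Module.finrank ℝ E + 1)
  have hi : Integrable (𝓕 (partialFourier Ψ ω)) := by
    rw [funext (fourier_partialFourier Ψ ω)]
    refine (integrable_one_add_norm_finrank C).mono' ?_ (Filter.Eventually.of_forall fun ζ =>
      hC _ _ (norm_nonneg _) (norm_fst_le_withLp ζ ω))
    exact ((𝓕 Ψ : 𝓢(WithLp 2 (E × E), ℂ)).continuous.comp
      (continuous_toLp_pair.comp (by fun_prop))).aestronglyMeasurable
  rw [← congrFun ((continuous_partialFourier Ψ ω).fourierInv_fourier_eq
    (integrable_partialFourier Ψ ω) hi) x, Real.fourierInv_eq]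
  refine integral_congr_ae (Filter.Eventually.of_forall fun ζ => ?_)
  beta_reduce
  rw [fourier_partialFourier, Circle.smul_def, smul_eq_mul]

theorem integral_fourierChar_mul_mul_fourier (Ψ : 𝓢(WithLp 2 (E × E), ℂ)) (x : E) {k : E → ℂ}
    (hk : Continuous k) {C : ℝ} (hk1 : ∀ p, ‖k p‖ ≤ C) :
    ∫ z : WithLp 2 (E × E), (Real.fourierChar (inner ℝ z.fst x) : ℂ) * k z.snd *
      (𝓕 Ψ : 𝓢(WithLp 2 (E × E), ℂ)) z = ∫ ω, k ω * partialFourier Ψ ω x := by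
  have hi := integrable_char_mul_toLp_pair (𝓕 Ψ : 𝓢(WithLp 2 (E × E), ℂ))
    (k := fun p => (Real.fourierChar (inner ℝ p.1 x) : ℂ) * k p.2)
    ((continuous_fourierChar_coe (by fun_prop)).mul (hk.comp continuous_snd))
    (C := C) (fun p => by rw [norm_mul, Circle.norm_coe, one_mul]; exact hk1 p.2)
  rw [integral_withLp, Measure.volume_eq_prod]
  refine (integral_prod_symm _ hi).trans ?_
  refine integral_congr_ae (Filter.Eventually.of_forall fun ω => ?_)
  beta_reduce
  rw [← integral_fourierChar_mul_fourier, ← integral_const_mul]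
  refine integral_congr_ae (Filter.Eventually.of_forall fun ζ => ?_)
  beta_reduce
  ring

theorem continuous_sineSymbol (t : ℝ) : Continuous (sineSymbol E t) :=
  Complex.continuous_ofReal.comp
    (continuous_const.mul (Real.continuous_sinc.comp (by fun_prop)))

theorem norm_sineSymbol_le (t : ℝ) (ξ : E) : ‖sineSymbol E t ξ‖ ≤ |t| := by
  rw [sineSymbol, Complex.norm_real, Real.norm_eq_abs, abs_mul]
  exact mul_le_of_le_one_right (abs_nonneg t) (Real.abs_sinc_le_one _)

/-- Plancherel's formula in `y` for the pairing with `k₀(·, t)`; the symbol is even. -/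
theorem operatorA_eq_integral (f g : 𝓢(E, ℂ)) (z : WithLp 2 (E × ℝ)) :
    operatorA f g z =
      ∫ ω, sineSymbol E z.snd ω * partialFourier (diagProduct f g) ω z.fst := by
  rw [operatorA, sineKernel, TemperedDistribution.fourierInv_apply,
    Lp.toTemperedDistribution_apply, ← integral_neg_eq_self]
  refine integral_congr_ae ?_
  have h := (Measure.measurePreserving_neg (volume : Measure E)).quasiMeasurePreserving.ae
    (memLp_sineSymbol E z.snd).coeFn_toLp
  filter_upwards [h] with ω hω
  rw [hω, smul_eq_mul, mul_comm, SchwartzMap.fourierInv_coe, Real.fourierInv_eq, partialFourier]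
  congr 1
  · simp [sineSymbol]
  · refine integral_congr_ae (Filter.Eventually.of_forall fun y => ?_)
    beta_reduce
    rw [inner_neg_right, Circle.smul_def, smul_eq_mul, reflectedProduct_apply, diagProduct_apply]
    rfl

end PartialFourier

/-! ### Odd dimensions -/

section SphericalFormula

variable {E : Type} [NormedAddCommGroup E] [InnerProductSpace ℝ E] [FiniteDimensional ℝ E]
  [MeasurableSpace E] [BorelSpace E]

/-- The reflection `(x, t) ↦ (x, -t)`. -/
def timeReflection (E : Type) [NormedAddCommGroup E] [InnerProductSpace ℝ E] :
    WithLp 2 (E × ℝ) ≃ₗᵢ[ℝ] WithLp 2 (E × ℝ) :=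
  LinearIsometryEquiv.withLpProdCongr 2 (LinearIsometryEquiv.refl ℝ E) (LinearIsometryEquiv.neg ℝ)

theorem sphMeanS_timeReflection (Φ : 𝓢(WithLp 2 (E × E), ℂ)) (z : WithLp 2 (E × ℝ)) :
    sphMeanS 1 Φ (timeReflection E z) = sphMeanS 1 Φ z := by
  rw [sphMeanS_one_apply, sphMeanS_one_apply,
    ← integral_ray_linearIsometryEquiv Φ (LinearIsometryEquiv.neg ℝ) z]
  refine integral_congr_ae (Filter.Eventually.of_forall fun θ => ?_)
  beta_reduce
  congr 1
  rw [ray_eq, ray_eq]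
  congr 2
  change (-z.snd) • (θ : E) = z.snd • (-(θ : E))
  rw [neg_smul, smul_neg]

/-- For even powers of `|r|`, the symbol of `sin (t |D|) / |D|` times the weight of polar
coordinates is a smooth function of the signed radius `r`. -/
theorem pow_mul_sinc (m : ℕ) (t r : ℝ) :
    |r| ^ (2 * m + 2) * (t * Real.sinc (t * (2 * Real.pi * |r|))) =
      r ^ (2 * m + 1) * (Real.sin (2 * Real.pi * (t * r)) / (2 * Real.pi)) := by
  have hπ := Real.pi_pos
  rcases eq_or_ne t 0 with rfl | ht
  · simp
  have key : ∀ r : ℝ, 0 < r → r ^ (2 * m + 2) * (t * Real.sinc (t * (2 * Real.pi * r))) =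
      r ^ (2 * m + 1) * (Real.sin (2 * Real.pi * (t * r)) / (2 * Real.pi)) := fun r hr => by
    rw [Real.sinc_of_ne_zero (by positivity), show t * (2 * Real.pi * r) = 2 * Real.pi * (t * r)
      by ring]
    field_simp
    ring
  rcases lt_trichotomy r 0 with hr | rfl | hr
  · rw [abs_of_neg hr, key _ (neg_pos.2 hr), (odd_two_mul_add_one m).neg_pow,
      show 2 * Real.pi * (t * -r) = -(2 * Real.pi * (t * r)) by ring, Real.sin_neg]
    ring
  · simp
  · rw [abs_of_pos hr, key r hr]

theorem sin_eq_fourierChar (r : ℝ) : (Real.sin (2 * Real.pi * r) : ℂ) =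
    ((Real.fourierChar r : ℂ) - Real.fourierChar (-r)) * (2 * Complex.I)⁻¹ := by
  rw [Real.fourierChar_apply, Real.fourierChar_apply, Complex.ofReal_sin, Complex.sin]
  have : Complex.I ≠ 0 := Complex.I_ne_zero
  push_cast
  field_simp
  rw [Complex.I_sq]
  ring_nf

/-- In odd dimensions the Fourier transform of `A(f, g)` is a spherical mean of the Fourier
transform of `f(x - y) g(x + y)`, multiplied by a polynomial. In polar coordinates `ω = τ θ` with
signed radii the symbol of `sin (t |D|) / |D|` becomes `sin (2 π t τ) / (2 π τ)`, which is a
difference of two exponentials; both contribute the same, since the remaining factor is odd in `τ`.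
-/
theorem operatorA_eq_fourierInv [Nontrivial E] {m : ℕ} (hE : Module.finrank ℝ E = 2 * m + 3)
    (f g : 𝓢(E, ℂ)) (z : WithLp 2 (E × ℝ)) :
    operatorA f g z = (4 * Real.pi * Complex.I)⁻¹ *
      (𝓕⁻ (mulInnerPow (timeVec E) (2 * m + 1) (sphMeanS 1 (𝓕 (diagProduct f g)))) :
        𝓢(WithLp 2 (E × ℝ), ℂ)) z := by
  set Φ : 𝓢(WithLp 2 (E × E), ℂ) := 𝓕 (diagProduct f g) with hΦ
  set P : 𝓢(WithLp 2 (E × ℝ), ℂ) := mulInnerPow (timeVec E) (2 * m + 1) (sphMeanS 1 Φ) with hP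
  rw [operatorA_eq_integral, ← integral_fourierChar_mul_mul_fourier _ _
    (continuous_sineSymbol z.snd) (norm_sineSymbol_le z.snd)]
  have hi : Integrable fun w : WithLp 2 (E × E) =>
      (Real.fourierChar (inner ℝ w.fst z.fst) : ℂ) * sineSymbol E z.snd w.snd * Φ w := by
    refine Φ.integrable.bdd_mul (c := |z.snd|) ?_ (Filter.Eventually.of_forall fun w => ?_)
    · refine Continuous.aestronglyMeasurable ?_
      exact (continuous_fourierChar_coe (by fun_prop)).mul
        ((continuous_sineSymbol z.snd).comp (by fun_prop))
    · rw [norm_mul, Circle.norm_coe, one_mul]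
      exact norm_sineSymbol_le _ _
  have h1 := integral_ray hi
  set k : ℝ → WithLp 2 (E × ℝ) → ℂ := fun s w =>
    (Real.fourierChar (inner ℝ w.fst z.fst) : ℂ) * (Real.fourierChar (s * w.snd) : ℂ) with hk
  have hki : ∀ s, Integrable fun w => k s w * P w := fun s => by
    refine P.integrable.bdd_mul (c := 1) ?_ (Filter.Eventually.of_forall fun w => ?_)
    · refine Continuous.aestronglyMeasurable ?_
      exact (continuous_fourierChar_coe (by fun_prop)).mul
        (continuous_fourierChar_coe (by fun_prop))
    · simp only [hk]
      rw [norm_mul, Circle.norm_coe, Circle.norm_coe, one_mul]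
  have h2 : ∀ w : WithLp 2 (E × ℝ), (|w.snd| ^ (Module.finrank ℝ E - 1) : ℝ) •
      ∫ θ : sphere (0 : E) 1, (Real.fourierChar (inner ℝ (ray E (θ : E) w).fst z.fst) : ℂ) *
        sineSymbol E z.snd (ray E (θ : E) w).snd * Φ (ray E (θ : E) w)
          ∂(volume : Measure E).toSphere =
      (4 * Real.pi * Complex.I)⁻¹ * (k z.snd w * P w - k (-z.snd) w * P w) := fun w => by
    have h3 : ∀ θ : sphere (0 : E) 1, sineSymbol E z.snd (ray E (θ : E) w).snd =
        ((z.snd * Real.sinc (z.snd * (2 * Real.pi * |w.snd|)) : ℝ) : ℂ) := fun θ => by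
      rw [sineSymbol, ray_snd, norm_smul]
      simp
    simp only [h3, ray_fst]
    rw [integral_const_mul, ← sphMeanS_one_apply, Complex.real_smul, hP, mulInnerPow_apply,
      inner_timeVec, hE, show 2 * m + 3 - 1 = 2 * m + 2 by omega]
    have h4 := congrArg (Complex.ofReal) (pow_mul_sinc m z.snd w.snd)
    rw [Complex.ofReal_mul, Complex.ofReal_mul (w.snd ^ (2 * m + 1)), Complex.ofReal_div,
      sin_eq_fourierChar] at h4
    calc _ = (((|w.snd| ^ (2 * m + 2) : ℝ) : ℂ) *
          ((z.snd * Real.sinc (z.snd * (2 * Real.pi * |w.snd|)) : ℝ) : ℂ)) *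
          ((Real.fourierChar (inner ℝ w.fst z.fst) : ℂ) * sphMeanS 1 Φ w) := by ring
      _ = _ := by
        rw [h4, hk]
        have : Complex.I ≠ 0 := Complex.I_ne_zero
        have hπ : (Real.pi : ℂ) ≠ 0 := by exact_mod_cast Real.pi_ne_zero
        simp only [neg_mul]
        push_cast
        field_simp
        ring
  simp only [h2] at h1
  rw [integral_const_mul, integral_sub (hki _) (hki _)] at h1
  -- the reflection `τ ↦ -τ`
  have h5 : ∫ w, k (-z.snd) w * P w = -∫ w, k z.snd w * P w := by
    rw [← (timeReflection E).measurePreserving.integral_comp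
      (timeReflection E).toHomeomorph.measurableEmbedding, ← integral_neg]
    refine integral_congr_ae (Filter.Eventually.of_forall fun w => ?_)
    have h6 : (timeReflection E w).snd = -w.snd := rfl
    have h7 : (timeReflection E w).fst = w.fst := rfl
    beta_reduce
    rw [hP, mulInnerPow_apply, mulInnerPow_apply, inner_timeVec, inner_timeVec,
      sphMeanS_timeReflection, hk]
    beta_reduce
    rw [h6, h7, neg_mul_neg, Complex.ofReal_neg, (odd_two_mul_add_one m).neg_pow]
    ring
  have h8 : (𝓕⁻ P : 𝓢(WithLp 2 (E × ℝ), ℂ)) z = ∫ w, k z.snd w * P w := by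
    rw [SchwartzMap.fourierInv_coe, Real.fourierInv_eq]
    refine integral_congr_ae (Filter.Eventually.of_forall fun w => ?_)
    beta_reduce
    rw [WithLp.prod_inner_apply, AddChar.map_add_eq_mul, Circle.smul_def, smul_eq_mul,
      Circle.coe_mul]
    rfl
  rw [h5] at h1
  rw [h8]
  linear_combination (-(1 : ℂ) / 2) * h1

end SphericalFormula

/-! ### Extension of operators from Schwartz functions to weighted Sobolev spaces -/

namespace WeightedSobolev

variable (E : Type*) [NormedAddCommGroup E] [InnerProductSpace ℝ E] [FiniteDimensional ℝ E]
  [MeasurableSpace E] [BorelSpace E] (a b : ℝ)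

/-- The inclusion of the Schwartz functions in `H_(a,b)` as a linear map. -/
def ofSchwartzLM : 𝓢(E, ℂ) →ₗ[ℂ] WeightedSobolev E a b where
  toFun := ofSchwartz E a b
  map_add' f g := by
    apply toDistribution_injective
    rw [map_add]
    simp only [toDistribution_ofSchwartz]
    exact map_add (SchwartzMap.toTemperedDistributionCLM E ℂ) f g
  map_smul' c f := by
    apply toDistribution_injective
    rw [map_smul]
    simp only [toDistribution_ofSchwartz]
    exact map_smul (SchwartzMap.toTemperedDistributionCLM E ℂ) c f

theorem ofSchwartzLM_apply (f : 𝓢(E, ℂ)) : ofSchwartzLM E a b f = ofSchwartz E a b f := rfl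

theorem toL2_ofSchwartz (f : 𝓢(E, ℂ)) :
    toL2 E a b (ofSchwartz E a b f) = (SchwartzMap.smulLeftCLM ℂ (weight E a)
        (SchwartzMap.fourierMultiplierCLM ℂ (bracketSymbol E b) f)).toLp 2 := by
  apply toTemperedDistribution_injective E
  refine (toL2_spec E a b _).trans ?_
  rw [toDistribution_ofSchwartz, weightedBessel, ContinuousLinearMap.comp_apply,
    TemperedDistribution.fourierMultiplierCLM_toTemperedDistributionCLM_eq
      (bracketSymbol_hasTemperateGrowth E b)]
  refine Eq.trans ?_ (Lp.toTemperedDistribution_toLp_eq _).symm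
  ext φ
  simp [weight_hasTemperateGrowth E a, mul_left_comm, mul_assoc]

/-- The norm of `H_(a,b)` on Schwartz functions, as an energy. -/
theorem enorm_ofSchwartz_sq (f : 𝓢(E, ℂ)) : ‖ofSchwartz E a b f‖ₑ ^ 2 =
    wEnergy a (SchwartzMap.fourierMultiplierCLM ℂ (bracketSymbol E b) f) := by
  have h : ‖ofSchwartz E a b f‖ₑ = ‖toL2 E a b (ofSchwartz E a b f)‖ₑ := by
    rw [← ofReal_norm, norm_def, ofReal_norm]
  rw [h, toL2_ofSchwartz, SchwartzMap.toLp, Lp.enorm_toLp]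
  have h2 := eLpNorm_nnreal_pow_eq_lintegral (p := 2) (μ := (volume : Measure E)) (f :=
    SchwartzMap.smulLeftCLM ℂ (weight E a)
      (SchwartzMap.fourierMultiplierCLM ℂ (bracketSymbol E b) f)) (by norm_num)
  norm_num at h2
  rw [h2, wEnergy]
  refine lintegral_congr fun x => ?_
  rw [smulLeftCLM_apply_apply (weight_hasTemperateGrowth E a), smul_eq_mul, enorm_mul, mul_pow,
    enorm_weight_sq]

theorem surjective_toL2 : Function.Surjective (toL2 E a b) := by
  intro v
  set u : 𝓢'(E, ℂ) := TemperedDistribution.fourierMultiplierCLM ℂ (bracketSymbol E (-b))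
    (TemperedDistribution.smulLeftCLM ℂ (weight E (-a)) (v : 𝓢'(E, ℂ))) with hu
  have h1 : weightedBessel E a b u = (v : 𝓢'(E, ℂ)) := by
    rw [weightedBessel, ContinuousLinearMap.comp_apply, hu,
      TemperedDistribution.fourierMultiplierCLM_fourierMultiplierCLM_apply
      (bracketSymbol_hasTemperateGrowth E _) (bracketSymbol_hasTemperateGrowth E _)]
    have h2 : bracketSymbol E (-b) * bracketSymbol E b = fun _ => 1 :=
      funext fun ξ => weight_neg_mul E b _
    have h3 : weight E (-a) * weight E a = fun _ => 1 := funext (weight_neg_mul E a)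
    rw [h2, TemperedDistribution.fourierMultiplierCLM_const, one_smul,
      ContinuousLinearMap.id_apply, TemperedDistribution.smulLeftCLM_smulLeftCLM_apply
      (weight_hasTemperateGrowth E _) (weight_hasTemperateGrowth E _), h3,
      TemperedDistribution.smulLeftCLM_const, one_smul]
  refine ⟨(⟨u, (mem_weightedSobolevSubmodule E).2 ⟨v, h1.symm⟩⟩ :
    weightedSobolevSubmodule E a b), ?_⟩
  apply toTemperedDistribution_injective E
  exact (toL2_spec E a b _).trans h1

/-- The isometric isomorphism `u ↦ ⟨x⟩ ^ a ⟨D⟩ ^ b u` from `H_(a,b)` onto `L²`. -/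
def equivL2 : WeightedSobolev E a b ≃ₗᵢ[ℂ] Lp ℂ 2 (volume : Measure E) :=
  LinearIsometryEquiv.ofSurjective ⟨toL2 E a b, fun _ => rfl⟩ (surjective_toL2 E a b)

instance : CompleteSpace (WeightedSobolev E a b) :=
  (equivL2 E a b).toIsometryEquiv.completeSpace

theorem denseRange_ofSchwartzLM : DenseRange (ofSchwartzLM E a b) := by
  have h1 : DenseRange fun f : 𝓢(E, ℂ) => toL2 E a b (ofSchwartz E a b f) := by
    refine (SchwartzMap.denseRange_toLpCLM (F := ℂ) (μ := (volume : Measure E)) (p := 2)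
      (by norm_num)).mono ?_
    rintro _ ⟨φ, rfl⟩
    refine ⟨SchwartzMap.fourierMultiplierCLM ℂ (bracketSymbol E (-b))
      (SchwartzMap.smulLeftCLM ℂ (weight E (-a)) φ), ?_⟩
    have h2 : bracketSymbol E (-b) * bracketSymbol E b = fun _ => 1 :=
      funext fun ξ => weight_neg_mul E b _
    have h3 : weight E (-a) * weight E a = fun _ => 1 := funext (weight_neg_mul E a)
    beta_reduce
    rw [toL2_ofSchwartz, SchwartzMap.fourierMultiplierCLM_fourierMultiplierCLM_apply
      (bracketSymbol_hasTemperateGrowth E _) (bracketSymbol_hasTemperateGrowth E _), mul_comm, h2,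
      SchwartzMap.fourierMultiplierCLM_const, one_smul, ContinuousLinearMap.id_apply,
      SchwartzMap.smulLeftCLM_smulLeftCLM_apply (weight_hasTemperateGrowth E _)
      (weight_hasTemperateGrowth E _), mul_comm, h3, SchwartzMap.smulLeftCLM_const, one_smul]
    rfl
  have h4 : (ofSchwartzLM E a b : 𝓢(E, ℂ) → WeightedSobolev E a b) =
      (equivL2 E a b).symm ∘ fun f => toL2 E a b (ofSchwartz E a b f) := by
    funext f
    exact ((equivL2 E a b).symm_apply_apply _).symm
  rw [h4]
  exact (equivL2 E a b).symm.surjective.denseRange.comp h1 (equivL2 E a b).symm.continuous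

end WeightedSobolev

/-- A bounded bilinear map on dense subspaces extends to a continuous bilinear map. -/
theorem LinearMap.exists_extend₂ {A B X Y Z : Type*} [AddCommGroup A] [Module ℂ A]
    [AddCommGroup B] [Module ℂ B] [NormedAddCommGroup X] [NormedSpace ℂ X] [NormedAddCommGroup Y]
    [NormedSpace ℂ Y] [NormedAddCommGroup Z] [NormedSpace ℂ Z] [CompleteSpace Z]
    {i : A →ₗ[ℂ] X} {j : B →ₗ[ℂ] Y} (hi : DenseRange i) (hj : DenseRange j)
    (T : A →ₗ[ℂ] B →ₗ[ℂ] Z) {C : ℝ} (hC : 0 ≤ C)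
    (hT : ∀ f g, ‖T f g‖ ≤ C * ‖i f‖ * ‖j g‖) :
    ∃ S : X →L[ℂ] Y →L[ℂ] Z, ∀ f g, S (i f) (j g) = T f g := by
  have h1 : ∀ f g, (T f).extendOfNorm j (j g) = T f g := fun f g =>
    LinearMap.extendOfNorm_eq hj ⟨_, hT f⟩ g
  have hext : ∀ {S S' : Y →L[ℂ] Z}, (∀ g, S (j g) = S' (j g)) → S = S' := fun {S S'} h =>
    DFunLike.coe_injective (hj.equalizer S.continuous S'.continuous (funext h))
  let T' : A →ₗ[ℂ] (Y →L[ℂ] Z) :=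
    { toFun := fun f => (T f).extendOfNorm j
      map_add' := fun f f' => hext fun g => (h1 _ _).trans (by
        rw [map_add]
        simp only [LinearMap.add_apply, _root_.add_apply, h1])
      map_smul' := fun c f => hext fun g => (h1 _ _).trans (by
        rw [map_smul]
        simp only [LinearMap.smul_apply, _root_.smul_apply, h1, RingHom.id_apply]) }
  have h2 : ∀ f, ‖T' f‖ ≤ C * ‖i f‖ := fun f =>
    LinearMap.opNorm_extendOfNorm_le hj (by positivity) (hT f)
  refine ⟨T'.extendOfNorm i, fun f g => ?_⟩
  rw [LinearMap.extendOfNorm_eq hi ⟨C, h2⟩]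
  exact h1 f g

/-! ### Extension of the operator `A` -/

section Extend

variable {E : Type*} [NormedAddCommGroup E] [InnerProductSpace ℝ E] [FiniteDimensional ℝ E]
  [MeasurableSpace E] [BorelSpace E]

theorem reflectedProduct_add_left (f f' g : 𝓢(E, ℂ)) (x : E) :
    reflectedProduct (f + f') g x = reflectedProduct f g x + reflectedProduct f' g x := by
  ext y
  simp only [reflectedProduct_apply, _root_.add_apply, add_mul]

theorem reflectedProduct_add_right (f g g' : 𝓢(E, ℂ)) (x : E) :
    reflectedProduct f (g + g') x = reflectedProduct f g x + reflectedProduct f g' x := by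
  ext y
  simp only [reflectedProduct_apply, _root_.add_apply, mul_add]

theorem reflectedProduct_smul_left (c : ℂ) (f g : 𝓢(E, ℂ)) (x : E) :
    reflectedProduct (c • f) g x = c • reflectedProduct f g x := by
  ext y
  simp only [reflectedProduct_apply, _root_.smul_apply, smul_eq_mul, mul_assoc]

theorem reflectedProduct_smul_right (c : ℂ) (f g : 𝓢(E, ℂ)) (x : E) :
    reflectedProduct f (c • g) x = c • reflectedProduct f g x := by
  ext y
  simp only [reflectedProduct_apply, _root_.smul_apply, smul_eq_mul, mul_left_comm]

/-- An estimate for Schwartz functions gives the extension of `A`. -/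
theorem operatorAExtends_of_le {a' b' a'' b'' a b : ℝ}
    (G : 𝓢(E, ℂ) → 𝓢(E, ℂ) → 𝓢(WithLp 2 (E × ℝ), ℂ)) (hG : ∀ f g z, G f g z = operatorA f g z)
    (h : ∃ C : ℝ≥0∞, C < ∞ ∧ ∀ f g,
      ‖WeightedSobolev.ofSchwartz (WithLp 2 (E × ℝ)) a b (G f g)‖ₑ ^ 2 ≤
      C * (‖WeightedSobolev.ofSchwartz E a' b' f‖ₑ ^ 2 *
        ‖WeightedSobolev.ofSchwartz E a'' b'' g‖ₑ ^ 2)) :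
    OperatorAExtends E a' b' a'' b'' a b := by
  obtain ⟨C, hC, h⟩ := h
  let T : 𝓢(E, ℂ) →ₗ[ℂ] 𝓢(E, ℂ) →ₗ[ℂ] WeightedSobolev (WithLp 2 (E × ℝ)) a b :=
    (LinearMap.mk₂ ℂ G
      (fun f f' g => by
        ext z
        simp only [hG, operatorA, _root_.add_apply, reflectedProduct_add_left, map_add])
      (fun c f g => by
        ext z
        simp only [hG, operatorA, _root_.smul_apply, reflectedProduct_smul_left, map_smul])
      (fun f g g' => by
        ext z
        simp only [hG, operatorA, _root_.add_apply, reflectedProduct_add_right, map_add])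
      (fun c f g => by
        ext z
        simp only [hG, operatorA, _root_.smul_apply, reflectedProduct_smul_right, map_smul])).compr₂
      (WeightedSobolev.ofSchwartzLM (WithLp 2 (E × ℝ)) a b)
  have hT : ∀ f g, T f g = WeightedSobolev.ofSchwartz (WithLp 2 (E × ℝ)) a b (G f g) :=
    fun f g => rfl
  obtain ⟨S, hS⟩ := LinearMap.exists_extend₂ (WeightedSobolev.denseRange_ofSchwartzLM E a' b')
    (WeightedSobolev.denseRange_ofSchwartzLM E a'' b'') T (C := √C.toReal) (Real.sqrt_nonneg _)
    (fun f g => by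
      have h1 := ENNReal.toReal_mono (by finiteness) (h f g)
      simp only [ENNReal.toReal_mul, ENNReal.toReal_pow, toReal_enorm] at h1
      rw [hT, WeightedSobolev.ofSchwartzLM_apply, WeightedSobolev.ofSchwartzLM_apply]
      refine le_of_sq_le_sq ?_ (by positivity)
      rw [mul_pow, mul_pow, Real.sq_sqrt ENNReal.toReal_nonneg, mul_assoc]
      exact h1)
  exact ⟨S, fun f g => ⟨G f g, hG f g, hS f g⟩⟩

end Extend

/-! ### The estimates for the operator `A` -/

section SobolevNorms

variable {X : Type*} [NormedAddCommGroup X] [InnerProductSpace ℝ X] [FiniteDimensional ℝ X]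
  [MeasurableSpace X] [BorelSpace X]

theorem enorm_ofSchwartz_zero_right_sq (a : ℝ) (f : 𝓢(X, ℂ)) :
    ‖WeightedSobolev.ofSchwartz X a 0 f‖ₑ ^ 2 = wEnergy a f := by
  have h : bracketSymbol X 0 = fun _ => 1 := by
    funext x
    simp [bracketSymbol, weight]
  rw [WeightedSobolev.enorm_ofSchwartz_sq, h, SchwartzMap.fourierMultiplierCLM_const, one_smul]
  rfl

theorem enorm_ofSchwartz_zero_left_sq (b : ℝ) (f : 𝓢(X, ℂ)) :
    ‖WeightedSobolev.ofSchwartz X 0 b f‖ₑ ^ 2 =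
      ∫⁻ ξ, bracketSq b ((2 * Real.pi) • ξ) * ‖(𝓕 f : 𝓢(X, ℂ)) ξ‖ₑ ^ 2 := by
  rw [WeightedSobolev.enorm_ofSchwartz_sq, SchwartzMap.fourierMultiplierCLM_apply,
    wEnergy_fourierInv, wEnergy_zero_eq]
  refine lintegral_congr fun ξ => ?_
  rw [smulLeftCLM_apply_apply (bracketSymbol_hasTemperateGrowth X b), smul_eq_mul, enorm_mul,
    mul_pow, bracketSymbol, enorm_weight_sq]

/-- Dilations change the weights `⟨x⟩ ^ b` only by bounded factors. -/
theorem exists_bracketSq_smul_le (b : ℝ) {r s : ℝ} (hr : 0 < r) (hs : 0 < s) :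
    ∃ C : ℝ≥0∞, C < ∞ ∧ ∀ x : X, bracketSq b (r • x) ≤ C * bracketSq b (s • x) := by
  have key : ∀ {r s : ℝ}, 0 < r → 0 < s → ∀ x : X,
      1 + ‖r • x‖ ^ 2 ≤ (1 + r ^ 2 / s ^ 2) * (1 + ‖s • x‖ ^ 2) := fun {r s} hr hs x => by
    rw [norm_smul, norm_smul, Real.norm_of_nonneg hr.le, Real.norm_of_nonneg hs.le, mul_pow,
      mul_pow]
    have h : r ^ 2 / s ^ 2 * (s ^ 2 * ‖x‖ ^ 2) = r ^ 2 * ‖x‖ ^ 2 := by field_simp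
    have h' : 0 ≤ r ^ 2 / s ^ 2 := by positivity
    have h'' : 0 ≤ s ^ 2 * ‖x‖ ^ 2 := by positivity
    linarith
  rcases le_total 0 b with hb | hb
  · refine ⟨ENNReal.ofReal ((1 + r ^ 2 / s ^ 2) ^ b), by finiteness, fun x => ?_⟩
    rw [bracketSq, bracketSq, ← ENNReal.ofReal_mul (by positivity),
      ← Real.mul_rpow (by positivity) (by positivity)]
    exact ENNReal.ofReal_le_ofReal (Real.rpow_le_rpow (by positivity) (key hr hs x) hb)
  · refine ⟨ENNReal.ofReal ((1 + s ^ 2 / r ^ 2) ^ (-b)), by finiteness, fun x => ?_⟩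
    rw [bracketSq, bracketSq, ← ENNReal.ofReal_mul (by positivity)]
    refine ENNReal.ofReal_le_ofReal ?_
    have h1 := Real.rpow_le_rpow_of_nonpos (by positivity) (key hs hr x) hb
    rw [Real.mul_rpow (by positivity) (by positivity)] at h1
    calc _ = (1 + s ^ 2 / r ^ 2) ^ (-b) * ((1 + s ^ 2 / r ^ 2) ^ b * (1 + ‖r • x‖ ^ 2) ^ b) := by
          rw [← mul_assoc, ← Real.rpow_add (by positivity), neg_add_cancel, Real.rpow_zero, one_mul]
      _ ≤ _ := by gcongr

end SobolevNorms

section Estimates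

variable {E : Type} [NormedAddCommGroup E] [InnerProductSpace ℝ E] [FiniteDimensional ℝ E]
  [MeasurableSpace E] [BorelSpace E]

/-- The Schwartz function `A(f, g)`, in terms of its Fourier transform. The dimension `2 m + 3`
enters through `m` only. -/
def operatorAS (m : ℕ) (f g : 𝓢(E, ℂ)) : 𝓢(WithLp 2 (E × ℝ), ℂ) :=
  (4 * Real.pi * Complex.I : ℂ)⁻¹ •
    𝓕⁻ (mulInnerPow (timeVec E) (2 * m + 1) (sphMeanS 1 (𝓕 (diagProduct f g))))

theorem operatorAS_apply [Nontrivial E] {m : ℕ} (hE : Module.finrank ℝ E = 2 * m + 3)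
    (f g : 𝓢(E, ℂ)) (z : WithLp 2 (E × ℝ)) : operatorAS m f g z = operatorA f g z := by
  rw [operatorA_eq_fourierInv hE, operatorAS, _root_.smul_apply, smul_eq_mul]

theorem fourierMultiplierCLM_operatorAS (m : ℕ) (f g : 𝓢(E, ℂ)) :
    SchwartzMap.fourierMultiplierCLM ℂ (bracketSymbol (WithLp 2 (E × ℝ)) (-m)) (operatorAS m f g) =
      (4 * Real.pi * Complex.I : ℂ)⁻¹ • waveMean m (diagProduct f g) := by
  rw [operatorAS, map_smul, SchwartzMap.fourierMultiplierCLM_apply,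
    FourierTransform.fourier_fourierInv_eq, waveMean]
  congr 2
  ext z
  rw [smulLeftCLM_apply_apply (bracketSymbol_hasTemperateGrowth _ _), mulInnerPow_apply,
    mulInnerPow_apply, smulLeftCLM_apply_apply (bracketSymbol_hasTemperateGrowth _ _)]
  simp only [smul_eq_mul]
  ring

theorem enorm_sphMeanS_le {Φ : 𝓢(WithLp 2 (E × E), ℂ)} {p q : E → ℝ≥0∞}
    (h : ∀ z : WithLp 2 (E × E), ‖Φ z‖ₑ ≤ p (z.fst - z.snd) * q (z.fst + z.snd))
    (z : WithLp 2 (E × ℝ)) : ‖sphMeanS 1 Φ z‖ₑ ≤ ∫⁻ θ : sphere (0 : E) 1,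
      p (z.fst - z.snd • (θ : E)) * q (z.fst + z.snd • (θ : E)) ∂(volume : Measure E).toSphere := by
  rw [sphMeanS_one_apply]
  exact (enorm_integral_le_lintegral_enorm _).trans (lintegral_mono fun θ => h _)

/-- The estimate with weights on `f` and `g`: the bound for `waveMean` in terms of the spherical
means of `f(x - y) g(x + y)`, and the weighted Cauchy-Schwarz estimate in the space variables. -/
theorem exists_enorm_ofSchwartz_operatorAS_le_of_weight [Nontrivial E] [CompleteSpace E] {m : ℕ}
    (hE : Module.finrank ℝ E = 2 * m + 3) {a a' a'' : ℝ} (h0 : 0 ≤ a)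
    (h1 : a < m + 1 + min a' a'') (h2 : a ≤ a' + a'') :
    ∃ C : ℝ≥0∞, C < ∞ ∧ ∀ f g : 𝓢(E, ℂ),
      ‖WeightedSobolev.ofSchwartz (WithLp 2 (E × ℝ)) a (-m) (operatorAS m f g)‖ₑ ^ 2 ≤
        C * (‖WeightedSobolev.ofSchwartz E a' 0 f‖ₑ ^ 2 *
          ‖WeightedSobolev.ofSchwartz E a'' 0 g‖ₑ ^ 2) := by
  obtain ⟨C, hC, hCle⟩ := exists_wEnergy_waveMean_le (E := E) hE h0
  obtain ⟨D, hD, hDle⟩ := exists_lintegral_sphere_mul_le (E := E) (k := 2 * m + 2) hE (by omega)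
    (b := a) (b' := a') (b'' := a'') (by push_cast; linarith) h2
  set κ : ℂ := (4 * Real.pi * Complex.I : ℂ)⁻¹
  refine ⟨‖κ‖ₑ ^ 2 * (C * D), by finiteness, fun f g => ?_⟩
  rw [WeightedSobolev.enorm_ofSchwartz_sq, fourierMultiplierCLM_operatorAS,
    enorm_ofSchwartz_zero_right_sq, enorm_ofSchwartz_zero_right_sq]
  refine (wEnergy_const_mul a κ (waveMean m (diagProduct f g))).le.trans ?_
  rw [mul_assoc, mul_assoc]
  refine mul_le_mul_right ((hCle _).trans (mul_le_mul_right ?_ _)) _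
  refine le_trans (lintegral_mono fun z => ?_) (hDle (fun x => ‖f x‖ₑ) (fun x => ‖g x‖ₑ)
    f.continuous.measurable.enorm g.continuous.measurable.enorm)
  gcongr
  refine enorm_sphMeanS_le (p := fun x => ‖f x‖ₑ) (q := fun x => ‖g x‖ₑ) (fun z => ?_) z
  rw [diagProduct_apply, enorm_mul]

theorem exists_lintegral_bracketSq_fourier_le (b : ℝ) : ∃ C : ℝ≥0∞, C < ∞ ∧ ∀ f : 𝓢(E, ℂ),
    ∫⁻ x, bracketSq b x * ‖(𝓕 f : 𝓢(E, ℂ)) ((2 : ℝ)⁻¹ • x)‖ₑ ^ 2 ≤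
      C * ‖WeightedSobolev.ofSchwartz E 0 b f‖ₑ ^ 2 := by
  obtain ⟨C, hC, h⟩ := exists_bracketSq_smul_le (X := E) b (r := 2) (s := 2 * Real.pi) (by norm_num)
    (by positivity)
  refine ⟨ENNReal.ofReal |((2⁻¹ : ℝ) ^ Module.finrank ℝ E)⁻¹| * C, by finiteness, fun f => ?_⟩
  set h' : E → ℝ≥0∞ := fun y => bracketSq b ((2 : ℝ) • y) * ‖(𝓕 f : 𝓢(E, ℂ)) y‖ₑ ^ 2 with hh'
  have hm : Measurable h' := ((measurable_bracketSq b).comp (measurable_const_smul _)).mul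
    ((𝓕 f : 𝓢(E, ℂ)).continuous.measurable.enorm.pow_const 2)
  have h1 : ∀ x : E, bracketSq b x * ‖(𝓕 f : 𝓢(E, ℂ)) ((2 : ℝ)⁻¹ • x)‖ₑ ^ 2 =
      h' ((2 : ℝ)⁻¹ • x) := fun x => by simp [hh']
  rw [lintegral_congr h1, lintegral_comp_smul hm (by norm_num), mul_assoc,
    enorm_ofSchwartz_zero_left_sq, ← lintegral_const_mul' _ _ hC.ne]
  refine mul_le_mul_right (lintegral_mono fun y => ?_) _
  rw [← mul_assoc]
  exact mul_le_mul_left (h y) _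

/-- The estimate with derivatives on `f` and `g`: Plancherel's theorem, and the weighted
Cauchy-Schwarz estimate on the Fourier side. -/
theorem exists_enorm_ofSchwartz_operatorAS_le_of_deriv [Nontrivial E] {m : ℕ}
    (hE : Module.finrank ℝ E = 2 * m + 3) {b b' b'' : ℝ}
    (h1 : b < m + 1 + min b' b'') (h2 : b ≤ b' + b'') :
    ∃ C : ℝ≥0∞, C < ∞ ∧ ∀ f g : 𝓢(E, ℂ),
      ‖WeightedSobolev.ofSchwartz (WithLp 2 (E × ℝ)) 0 (b - m) (operatorAS m f g)‖ₑ ^ 2 ≤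
        C * (‖WeightedSobolev.ofSchwartz E 0 b' f‖ₑ ^ 2 *
          ‖WeightedSobolev.ofSchwartz E 0 b'' g‖ₑ ^ 2) := by
  obtain ⟨D, hD, hDle⟩ := exists_lintegral_sphere_mul_le (E := E) (k := 2 * m + 2) hE (by omega)
    (b := b) (b' := b') (b'' := b'') (by push_cast; linarith) h2
  obtain ⟨C, hC, hCle⟩ := exists_lintegral_bracketSq_fourier_le (E := E) b'
  obtain ⟨C', hC', hCle'⟩ := exists_lintegral_bracketSq_fourier_le (E := E) b''
  obtain ⟨K, hK, hKle⟩ := exists_bracketSq_smul_le (X := WithLp 2 (E × ℝ)) b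
    (r := 2 * Real.pi) (s := 1) (by positivity) one_pos
  set κ : ℂ := (4 * Real.pi * Complex.I : ℂ)⁻¹
  set c : ℂ := ((|(√2 ^ Module.finrank ℝ E)⁻¹| : ℝ) : ℂ) ^ 2
  refine ⟨‖κ‖ₑ ^ 2 * (K * ‖c‖ₑ ^ 2) * (D * (C * C')), by finiteness, fun f g => ?_⟩
  set p : E → ℝ≥0∞ := fun x => ‖(𝓕 f : 𝓢(E, ℂ)) ((2 : ℝ)⁻¹ • x)‖ₑ
  set q : E → ℝ≥0∞ := fun x => ‖(𝓕 g : 𝓢(E, ℂ)) ((2 : ℝ)⁻¹ • x)‖ₑ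
  have hp : Measurable p :=
    ((𝓕 f : 𝓢(E, ℂ)).continuous.comp (continuous_const_smul _)).measurable.enorm
  have hq : Measurable q :=
    ((𝓕 g : 𝓢(E, ℂ)).continuous.comp (continuous_const_smul _)).measurable.enorm
  have hM : ∀ z, ‖sphMeanS 1 (𝓕 (diagProduct f g)) z‖ₑ ≤ ‖c‖ₑ * ∫⁻ θ : sphere (0 : E) 1,
      p (z.fst - z.snd • (θ : E)) * q (z.fst + z.snd • (θ : E))
        ∂(volume : Measure E).toSphere := fun z => by
    rw [← lintegral_const_mul' _ _ (by finiteness)]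
    have := enorm_sphMeanS_le (Φ := 𝓕 (diagProduct f g)) (p := fun x => ‖c‖ₑ * p x) (q := q)
      (fun z => by rw [fourier_diagProduct, enorm_mul, enorm_mul, mul_assoc]) z
    simpa only [mul_assoc] using this
  -- of the `4 m + 2` factors `τ`, the weight of polar coordinates takes `2 m + 2`, and `⟨D⟩ ^ (-m)`
  -- compensates the remaining `2 m`
  have hweight : ∀ z : WithLp 2 (E × ℝ), bracketSq (b - m) ((2 * Real.pi) • z) *
      ‖((z.snd : ℂ)) ^ (2 * m + 1)‖ₑ ^ 2 ≤ polarWeight z * (K * bracketSq b z) := fun z => by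
    have e1 : ‖((z.snd : ℂ)) ^ (2 * m + 1)‖ₑ ^ 2 =
        polarWeight z * (‖((z.snd : ℂ))‖ₑ ^ 2) ^ m := by
      rw [polarWeight, hE, ← ofReal_norm, ← ofReal_norm, norm_pow, Complex.norm_real,
        Real.norm_eq_abs, ← ENNReal.ofReal_pow (by positivity),
        ← ENNReal.ofReal_pow (by positivity), ← ENNReal.ofReal_pow (by positivity),
        ← ENNReal.ofReal_mul (by positivity),
        show 2 * m + 3 - 1 = 2 * m + 2 by omega]
      congr 1
      ring
    have e2 : (‖((z.snd : ℂ))‖ₑ ^ 2) ^ m ≤ bracketSq m ((2 * Real.pi) • z) := by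
      have e3 := enorm_inner_sq_le_of_norm_eq_one (norm_timeVec (E := E)) z
      rw [inner_timeVec] at e3
      have e4 : bracketSq 1 z ≤ bracketSq 1 ((2 * Real.pi) • z) := by
        refine ENNReal.ofReal_le_ofReal (Real.rpow_le_rpow (by positivity) ?_ zero_le_one)
        rw [norm_smul, Real.norm_of_nonneg (by positivity)]
        have : (1 : ℝ) ≤ 2 * Real.pi := by linarith [Real.pi_gt_three]
        gcongr
        exact le_mul_of_one_le_left (norm_nonneg z) this
      calc _ ≤ bracketSq 1 ((2 * Real.pi) • z) ^ m := by gcongr; exact e3.trans e4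
        _ = _ := by rw [bracketSq_pow, one_mul]
    rw [e1]
    calc _ ≤ bracketSq (b - m) ((2 * Real.pi) • z) *
          (polarWeight z * bracketSq m ((2 * Real.pi) • z)) := by gcongr
      _ = polarWeight z * bracketSq (b - m + m) ((2 * Real.pi) • z) := by
          rw [bracketSq_add]; ring
      _ ≤ _ := by
          rw [sub_add_cancel]
          gcongr
          simpa using hKle z
  rw [enorm_ofSchwartz_zero_left_sq]
  have hF : (𝓕 (operatorAS m f g) : 𝓢(WithLp 2 (E × ℝ), ℂ)) =
      κ • mulInnerPow (timeVec E) (2 * m + 1) (sphMeanS 1 (𝓕 (diagProduct f g))) := by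
    rw [operatorAS, FourierTransform.fourier_smul, FourierTransform.fourier_fourierInv_eq]
  calc _ ≤ ∫⁻ z, ‖κ‖ₑ ^ 2 * (K * ‖c‖ₑ ^ 2) * (polarWeight z * (bracketSq b z *
        (∫⁻ θ : sphere (0 : E) 1, p (z.fst - z.snd • (θ : E)) * q (z.fst + z.snd • (θ : E))
          ∂(volume : Measure E).toSphere) ^ 2)) := by
        refine lintegral_mono fun z => ?_
        rw [hF, _root_.smul_apply, mulInnerPow_apply, inner_timeVec, smul_eq_mul, enorm_mul,
          enorm_mul, mul_pow, mul_pow]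
        set M := ‖sphMeanS 1 (𝓕 (diagProduct f g)) z‖ₑ
        calc _ = ‖κ‖ₑ ^ 2 * ((bracketSq (b - m) ((2 * Real.pi) • z) *
              ‖((z.snd : ℂ)) ^ (2 * m + 1)‖ₑ ^ 2) * M ^ 2) := by ring
          _ ≤ ‖κ‖ₑ ^ 2 * ((polarWeight z * (K * bracketSq b z)) * (‖c‖ₑ *
              ∫⁻ θ : sphere (0 : E) 1, p (z.fst - z.snd • (θ : E)) * q (z.fst + z.snd • (θ : E))
                ∂(volume : Measure E).toSphere) ^ 2) := by
              exact mul_le_mul_right (mul_le_mul' (hweight z)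
                (pow_le_pow_left₀ zero_le (hM z) 2)) _
          _ = _ := by ring
    _ = ‖κ‖ₑ ^ 2 * (K * ‖c‖ₑ ^ 2) * ∫⁻ z, (polarWeight z * (bracketSq b z *
        (∫⁻ θ : sphere (0 : E) 1, p (z.fst - z.snd • (θ : E)) * q (z.fst + z.snd • (θ : E))
          ∂(volume : Measure E).toSphere) ^ 2)) := lintegral_const_mul' _ _ (by finiteness)
    _ ≤ ‖κ‖ₑ ^ 2 * (K * ‖c‖ₑ ^ 2) * (D * ((C * ‖WeightedSobolev.ofSchwartz E 0 b' f‖ₑ ^ 2) *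
          (C' * ‖WeightedSobolev.ofSchwartz E 0 b'' g‖ₑ ^ 2))) := by
        gcongr
        refine (hDle p q hp hq).trans ?_
        gcongr
        · exact hCle f
        · exact hCle' g
    _ = _ := by ring

end Estimates

end

theorem mainTheorem6 (n : ℕ) (hn : 3 ≤ n) (hodd : Odd n) (m : ℝ) (hm : m = ((n : ℝ) - 3) / 2) :
    (∀ a' a'' a : ℝ, 0 ≤ a → a < m + 1 + min a' a'' → a ≤ a' + a'' →
      OperatorAExtends (EuclideanSpace ℝ (Fin n)) a' 0 a'' 0 a (-m)) ∧
    (∀ b' b'' b : ℝ, b < m + 1 + min b' b'' → b ≤ b' + b'' →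
      OperatorAExtends (EuclideanSpace ℝ (Fin n)) 0 b' 0 b'' 0 (b - m)) := by
  obtain ⟨k, rfl⟩ : ∃ k, n = 2 * k + 3 := by
    obtain ⟨j, hj⟩ := hodd
    exact ⟨j - 1, by omega⟩
  obtain rfl : m = k := by rw [hm]; push_cast; ring
  have hE : Module.finrank ℝ (EuclideanSpace ℝ (Fin (2 * k + 3))) = 2 * k + 3 := by simp
  exact ⟨fun a' a'' a h0 h1 h2 => operatorAExtends_of_le (operatorAS k) (operatorAS_apply hE)
      (exists_enorm_ofSchwartz_operatorAS_le_of_weight hE h0 h1 h2),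
    fun b' b'' b h1 h2 => operatorAExtends_of_le (operatorAS k) (operatorAS_apply hE)
      (exists_enorm_ofSchwartz_operatorAS_le_of_deriv hE h1 h2)⟩
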